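/- **Setting.** A *light condensed abelian group* is a sheaf of abelian groups on the category of light profinite sets (countable inverse limits of finite sets) for the topology generated by finite jointly surjective families (the coherent topology). For a light profinite set $S$ let $\mathbb{Z}[S]$ be the free light condensed abelian group on $S$, and put $P=\mathbb{Z}[\mathbb{N}\cup\{\infty\}]/\mathbb{Z}[\infty]$. Let $\mathrm{Shift}\colon P\to P$ be the endomorphism induced by $n\mapsto n+1$, $\infty\mapsto\infty$. A light condensed abelian group $A$ is *solid* if $1-\mathrm{Shift}^*\colon\underline{\mathrm{Hom}}(P,A)\to\underline{\mathrm{Hom}}(P,A)$ is an isomorphism, where $\underline{\mathrm{Hom}}$ is the internal Hom. Let $\mathsf{Solid}$ be the full subcategory of solid abelian groups; it is an abelian category, closed under limits and finite colimits in light condensed abelian groups, and its inclusion has a left adjoint, solidification. The *solid tensor product* $\otimes_\square$ is the symmetric monoidal structure on $\mathsf{Solid}$ for which solidification is symmetric monoidal. The light condensed abelian group $\mathbb{Z}$, whose sections on $S$ are the locally constant functions $S\to\mathbb{Z}$, is solid, and hence so is the countable product $\prod_{\mathbb{N}}\mathbb{Z}$. A solid abelian group is *finitely presented* if it is isomorphic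 to the cokernel of a map $\prod_{\mathbb{N}}\mathbb{Z}\to\prod_{\mathbb{N}}\mathbb{Z}$; let $\mathsf{Solid}^{\mathrm{fp}}\subset\mathsf{Solid}$ be the full subcategory of these objects. **Theorem.** 1. $\mathsf{Solid}^{\mathrm{fp}}$ is stable under kernels, cokernels and extensions in $\mathsf{Solid}$; it is an abelian category and its inclusion into $\mathsf{Solid}$ is exact. 2. $\mathsf{Solid}=\mathrm{Ind}(\mathsf{Solid}^{\mathrm{fp}})$: there is an equivalence of categories $\mathrm{Ind}(\mathsf{Solid}^{\mathrm{fp}})\simeq\mathsf{Solid}$ whose restriction along the Yoneda embedding $\mathsf{Solid}^{\mathrm{fp}}\to\mathrm{Ind}(\mathsf{Solid}^{\mathrm{fp}})$ is isomorphic to the inclusion $\mathsf{Solid}^{\mathrm{fp}}\subset\mathsf{Solid}$. 3. For every finitely presented solid abelian group $M$ there is a short exact sequence in $\mathsf{Solid}$ $$0\to\prod_{\mathbb{N}}\mathbb{Z}\to\prod_{\mathbb{N}}\mathbb{Z}\to M\to 0 .$$ 4. $\prod_{\mathbb{N}}\mathbb{Z}$ is flat for the solid tensor product: the functor $\prod_{\mathbb{N}}\mathbb{Z}\otimes_\square-\colon\mathsf{Solid}\to\mathsf{Solid}$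 is exact. -/

import Mathlib

open CategoryTheory Limits MonoidalCategory LightProfinite

noncomputable section

namespace LightSolid

/-- The inclusion of the point `∞` into `ℕ ∪ {∞}`. -/
def pointInfty : LightProfinite.of PUnit.{1} ⟶ ℕ∪{∞} :=
  ConcreteCategory.ofHom ⟨fun _ => OnePoint.infty, continuous_const⟩

/-- The shift map of `ℕ ∪ {∞}`: it fixes `∞` and sends `n` to `n + 1`. -/
def shiftNat : ℕ∪{∞} ⟶ ℕ∪{∞} :=
  ConcreteCategory.ofHom ⟨fun x : OnePoint ℕ => OnePoint.map (fun n : ℕ => n + 1) x,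
    OnePoint.continuous_map continuous_of_discreteTopology
      (by rw [Filter.coclosedCompact_eq_cocompact, Filter.cocompact_eq_cofinite]
          exact (add_left_injective 1).tendsto_cofinite)⟩

/-- The free light condensed abelian group `ℤ[S]` on a light profinite set `S`. -/
abbrev freeAb : LightProfinite.{0} ⥤ LightCondAb :=
  lightProfiniteToLightCondSet ⋙ LightCondensed.free ℤ

/-- `P = ℤ[ℕ ∪ {∞}] / ℤ[∞]`, the light condensed abelian group classifying null sequences. -/
def nullSeq : LightCondAb := cokernel (freeAb.map pointInfty)

/-- The projection `ℤ[ℕ ∪ {∞}] ⟶ P`. -/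
def nullSeqπ : freeAb.obj ℕ∪{∞} ⟶ nullSeq := cokernel.π (freeAb.map pointInfty)

instance : Epi nullSeqπ := inferInstanceAs (Epi (cokernel.π (freeAb.map pointInfty)))

lemma pointInfty_nullSeqπ : freeAb.map pointInfty ≫ nullSeqπ = 0 :=
  cokernel.condition (freeAb.map pointInfty)

/-- The universal property of `P` as a quotient of `ℤ[ℕ ∪ {∞}]`. -/
def nullSeqDesc {A : LightCondAb} (g : freeAb.obj ℕ∪{∞} ⟶ A)
    (hg : freeAb.map pointInfty ≫ g = 0) : nullSeq ⟶ A :=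
  cokernel.desc (freeAb.map pointInfty) g hg

lemma nullSeqπ_desc {A : LightCondAb} (g : freeAb.obj ℕ∪{∞} ⟶ A)
    (hg : freeAb.map pointInfty ≫ g = 0) : nullSeqπ ≫ nullSeqDesc g hg = g :=
  cokernel.π_desc (freeAb.map pointInfty) g hg

lemma pointInfty_shiftNat : pointInfty ≫ shiftNat = pointInfty := rfl

/-- The endomorphism of `P` induced by the shift map of `ℕ ∪ {∞}`. -/
def shift : nullSeq ⟶ nullSeq :=
  nullSeqDesc (freeAb.map shiftNat ≫ nullSeqπ) (by
    rw [← freeAb.map_comp_assoc, pointInfty_shiftNat, pointInfty_nullSeqπ])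

/-- A light condensed abelian group `A` is solid if `1 - shift` induces an automorphism of the
internal Hom `Hom(P, A)`. -/
def isSolid : ObjectProperty LightCondAb := fun A =>
  IsIso ((MonoidalClosed.pre (𝟙 nullSeq - shift)).app A)

/-- The category of solid abelian groups, a full subcategory of light condensed abelian groups. -/
abbrev Solid := isSolid.FullSubcategory

lemma retract_aux : freeAb.map pointInfty ≫ (𝟙 (freeAb.obj ℕ∪{∞}) -
      freeAb.map ((CompHausLike.isTerminalPUnit.from ℕ∪{∞}) ≫ pointInfty)) = 0 := by
  rw [Preadditive.comp_sub, Category.comp_id, ← freeAb.map_comp, sub_eq_zero]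
  rfl

/-- `P` is a direct summand of `ℤ[ℕ ∪ {∞}]`. -/
def nullSeqRetract : Retract nullSeq (freeAb.obj ℕ∪{∞}) where
  i := nullSeqDesc _ retract_aux
  r := nullSeqπ
  retract := by
    rw [← cancel_epi nullSeqπ, ← Category.assoc, nullSeqπ_desc, Preadditive.sub_comp, Category.id_comp,
      Functor.map_comp, Category.assoc, pointInfty_nullSeqπ, comp_zero, sub_zero, Category.comp_id]

instance : InternallyProjective nullSeq :=
  have : InternallyProjective (freeAb.obj ℕ∪{∞}) := LightCondensed.internallyProjective_free_natUnionInfty ℤ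
  InternallyProjective.ofRetract nullSeqRetract

instance : PreservesLimits (ihom nullSeq) :=
  (ihom.adjunction nullSeq).rightAdjoint_preservesLimits

instance : (ihom nullSeq).Additive := Functor.additive_of_preserves_binary_products _

instance : PreservesFiniteColimits (ihom nullSeq) := by
  have h := (Functor.exact_tfae (ihom nullSeq)).out 0 3
  refine (h.1 fun S hS => ?_).2
  have := hS.mono_f
  have := hS.epi_g
  have : Mono (S.map (ihom nullSeq)).f := inferInstanceAs (Mono ((ihom nullSeq).map S.f))
  have : Epi (S.map (ihom nullSeq)).g := inferInstanceAs (Epi ((ihom nullSeq).map S.g))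
  exact ⟨ShortComplex.exact_of_f_is_kernel _ (KernelFork.mapIsLimit _ hS.fIsKernel (ihom nullSeq))⟩

instance (J : Type) [SmallCategory J] [FinCategory J] : isSolid.IsClosedUnderColimitsOfShape J where
  colimitsOfShape_le := by
    rintro A ⟨p⟩
    have (j : J) : IsIso ((Functor.whiskerLeft p.diag
        (MonoidalClosed.pre (𝟙 nullSeq - shift))).app j) := p.prop_diag_obj j
    have : IsIso (Functor.whiskerLeft p.diag (MonoidalClosed.pre (𝟙 nullSeq - shift))) :=
      NatIso.isIso_of_isIso_app _
    exact isIso_app_coconePt_of_preservesColimit _ _ _ p.isColimit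

/-- Morphisms `ℤ[S] ⟶ A` are the same as sections of `A` over `S`. -/
def freeEquiv (S : LightProfinite.{0}) (A : LightCondAb) :
    (freeAb.obj S ⟶ A) ≃ A.obj.obj (Opposite.op S) :=
  ((LightCondensed.freeForgetAdjunction ℤ).homEquiv S.toCondensed A).trans
    (coherentTopology LightProfinite.{0}).yonedaEquiv

lemma freeEquiv_comp {S : LightProfinite.{0}} {A B : LightCondAb} (g : freeAb.obj S ⟶ A)
    (f : A ⟶ B) : freeEquiv S B (g ≫ f) = f.hom.app (Opposite.op S) (freeEquiv S A g) := by
  exact (congrArg (coherentTopology LightProfinite.{0}).yonedaEquiv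
    ((LightCondensed.freeForgetAdjunction ℤ).homEquiv_naturality_right g f)).trans rfl

lemma freeEquiv_map {S T : LightProfinite.{0}} {A : LightCondAb} (φ : S ⟶ T)
    (g : freeAb.obj T ⟶ A) :
    freeEquiv S A (freeAb.map φ ≫ g) = A.obj.map φ.op (freeEquiv T A g) := by
  exact (congrArg (coherentTopology LightProfinite.{0}).yonedaEquiv
    ((LightCondensed.freeForgetAdjunction ℤ).homEquiv_naturality_left
      (lightProfiniteToLightCondSet.map φ) g)).trans
    ((coherentTopology LightProfinite.{0}).yonedaEquiv_naturality _ φ).symm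

lemma isIso_of_bijective_free {A B : LightCondAb} (f : A ⟶ B)
    (h : ∀ S : LightProfinite.{0}, Function.Bijective (fun g : freeAb.obj S ⟶ A => g ≫ f)) :
    IsIso f := by
  have (S : LightProfinite.{0}ᵒᵖ) : IsIso (f.hom.app S) := by
    rw [ConcreteCategory.isIso_iff_bijective]
    have h2 : (fun x => f.hom.app S x) =
        freeEquiv S.unop B ∘ (fun g => g ≫ f) ∘ (freeEquiv S.unop A).symm := by
      ext x
      refine Eq.trans ?_ (freeEquiv_comp _ f).symm
      rw [Equiv.apply_symm_apply]
    change Function.Bijective (fun x => f.hom.app S x)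
    rw [h2]
    exact (freeEquiv _ _).bijective.comp ((h _).comp (freeEquiv _ _).symm.bijective)
  have : IsIso ((sheafToPresheaf _ _).map f) :=
    (NatIso.isIso_of_isIso_app _ : IsIso f.hom)
  exact isIso_of_reflects_iso f (sheafToPresheaf _ _)

lemma bijective_comp_pre_iff {A X : LightCondAb} (σ : nullSeq ⟶ nullSeq) :
    Function.Bijective (fun g : X ⟶ (ihom nullSeq).obj A => g ≫ (MonoidalClosed.pre σ).app A) ↔
      Function.Bijective (fun g : nullSeq ⊗ X ⟶ A => (σ ▷ X) ≫ g) := by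
  have h : (fun g : X ⟶ (ihom nullSeq).obj A => g ≫ (MonoidalClosed.pre σ).app A) ∘
      ((ihom.adjunction nullSeq).homEquiv X A) =
      ((ihom.adjunction nullSeq).homEquiv X A) ∘
        (fun g : nullSeq ⊗ X ⟶ A => (σ ▷ X) ≫ g) := by
    ext1 g
    exact MonoidalClosed.curry_pre_app _ _
  rw [← Function.Bijective.of_comp_iff _ ((ihom.adjunction nullSeq).homEquiv X A).bijective, h,
    Function.Bijective.of_comp_iff' ((ihom.adjunction nullSeq).homEquiv X A).bijective]

lemma isSolid.bijective {A : LightCondAb} (hA : isSolid A) (X : LightCondAb) :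
    Function.Bijective (fun g : nullSeq ⊗ X ⟶ A => ((𝟙 nullSeq - shift) ▷ X) ≫ g) := by
  rw [← bijective_comp_pre_iff]
  have : IsIso ((MonoidalClosed.pre (𝟙 nullSeq - shift)).app A) := hA
  exact ⟨fun a b h => (cancel_mono _).1 h, fun b =>
    ⟨b ≫ inv ((MonoidalClosed.pre (𝟙 nullSeq - shift)).app A), by
      simp only [Category.assoc, IsIso.inv_hom_id, Category.comp_id]⟩⟩

lemma isSolid_of_bijective {A : LightCondAb} (hA : ∀ S : LightProfinite.{0}, Function.Bijective
    (fun g : nullSeq ⊗ freeAb.obj S ⟶ A => ((𝟙 nullSeq - shift) ▷ freeAb.obj S) ≫ g)) :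
    isSolid A :=
  isIso_of_bijective_free _ fun S => (bijective_comp_pre_iff _).2 (hA S)

/-- The maps `(1 - shift) ⊗ ℤ[S] : P ⊗ ℤ[S] ⟶ P ⊗ ℤ[S]` for `S` in a small skeleton of the
category of light profinite sets. -/
def solidMaps : MorphismProperty LightCondAb :=
  MorphismProperty.ofHoms (fun S : SmallModel.{0} LightProfinite.{0} =>
    (𝟙 nullSeq - shift) ▷ freeAb.obj ((equivSmallModel.{0} LightProfinite.{0}).inverse.obj S))

instance : MorphismProperty.IsSmall.{0} solidMaps := by
  unfold solidMaps; infer_instance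

lemma isSolid_eq_isLocal : isSolid = solidMaps.isLocal := by
  ext A
  constructor
  · rintro h _ _ _ ⟨S⟩
    exact isSolid.bijective h _
  · intro h
    refine isSolid_of_bijective fun S => ?_
    have h1 := h _ (MorphismProperty.ofHoms.mk ((equivSmallModel.{0} LightProfinite.{0}).functor.obj S))
    let e := freeAb.mapIso ((equivSmallModel.{0} LightProfinite.{0}).unitIso.app S)
    have h2 : (fun g : nullSeq ⊗ freeAb.obj S ⟶ A => ((𝟙 nullSeq - shift) ▷ freeAb.obj S) ≫ g) =
      (fun g => (nullSeq ◁ e.hom) ≫ g) ∘ (fun g => ((𝟙 nullSeq - shift) ▷ _) ≫ g) ∘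
        (fun g => (nullSeq ◁ e.inv) ≫ g) := by
      ext1 g
      simp only [Function.comp_apply]
      rw [← whisker_exchange_assoc, ← MonoidalCategory.whiskerLeft_comp_assoc]
      simp
    rw [h2]
    refine Function.Bijective.comp ?_ (h1.comp ?_)
    · exact ⟨fun a b h => (cancel_epi _).1 h, fun b => ⟨inv (nullSeq ◁ e.hom) ≫ b, by simp⟩⟩
    · exact ⟨fun a b h => (cancel_epi _).1 h, fun b => ⟨inv (nullSeq ◁ e.inv) ≫ b, by simp⟩⟩

/-- A filtered colimit of sheaves for the coherent topology, computed in presheaves, is a sheaf. -/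
instance (J : Type) [SmallCategory J] [IsFiltered J] :
    ObjectProperty.IsClosedUnderColimitsOfShape
      (Presheaf.IsSheaf (coherentTopology LightProfinite.{0}) (A := ModuleCat.{0} ℤ)) J where
  colimitsOfShape_le := by
    rintro G ⟨h⟩
    have h1 : Presheaf.IsSheaf (coherentTopology LightProfinite.{0}) h.diag.flip := by
      rw [Presheaf.isSheaf_iff_isLimit]
      intro X S hS
      refine ⟨evaluationJointlyReflectsLimits _ fun j => ?_⟩
      exact ((Presheaf.isSheaf_iff_isLimit _ _).1 (h.prop_diag_obj j) S hS).some
    have h2 := Presheaf.isSheaf_coherent_of_hasPullbacks_comp h.diag.flip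
      (colim (J := J) (C := ModuleCat.{0} ℤ)) h1
    let e : h.diag.flip ⋙ colim ≅ G :=
      NatIso.ofComponents
        (fun j ↦ (colimit.isColimit (h.diag.flip.obj j)).coconePointUniqueUpToIso
          (isColimitOfPreserves ((evaluation _ _).obj j) h.isColimit)) (by
          intro X Y f
          refine colimit.hom_ext fun j => ?_
          simp)
    exact (Presheaf.isSheaf_of_iso_iff e).1 h2

instance (J : Type) [SmallCategory J] [IsFiltered J] : PreservesColimitsOfShape J
    (sheafToPresheaf (coherentTopology LightProfinite.{0}) (ModuleCat.{0} ℤ)) :=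
  inferInstanceAs (PreservesColimitsOfShape J (ObjectProperty.ι (Presheaf.IsSheaf (coherentTopology LightProfinite.{0}) (A := ModuleCat.{0} ℤ))))

/-- Sections over `S`, as a functor. -/
abbrev sectionsFunctor (S : LightProfinite.{0}) : LightCondAb ⥤ Type :=
  sheafToPresheaf (coherentTopology LightProfinite.{0}) (ModuleCat.{0} ℤ) ⋙
    (evaluation _ _).obj (Opposite.op S) ⋙ CategoryTheory.forget _

/-- `ℤ[S]` represents the sections over `S`. -/
def coyonedaFreeIso (S : LightProfinite.{0}) :
    coyoneda.obj (Opposite.op (freeAb.obj S)) ≅ sectionsFunctor S ⋙ uliftFunctor.{1} :=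
  NatIso.ofComponents (fun A => ((freeEquiv S A).trans Equiv.ulift.symm).toIso) (by
    intro A B f
    ext g
    exact congrArg ULift.up (freeEquiv_comp g f))

instance : Fact (Cardinal.aleph0.{0}.IsRegular) := Cardinal.fact_isRegular_aleph0

instance (S : LightProfinite.{0}) : IsCardinalPresentable (freeAb.obj S) Cardinal.aleph0.{0} where
  preservesColimitOfShape J _ _ := by
    have := isFiltered_of_isCardinalFiltered J Cardinal.aleph0.{0}
    exact preservesColimitsOfShape_of_natIso (coyonedaFreeIso S).symm
instance (S : LightProfinite.{0}) :
    IsCardinalPresentable (nullSeq ⊗ freeAb.obj S) Cardinal.aleph0.{0} := by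
  let e : freeAb.obj ℕ∪{∞} ⊗ freeAb.obj S ≅ freeAb.obj (ℕ∪{∞} ⊗ S) :=
    Functor.Monoidal.μIso freeAb _ _
  have : IsCardinalPresentable ((tensorRight (freeAb.obj S)).obj (freeAb.obj ℕ∪{∞})) Cardinal.aleph0.{0} :=
    isCardinalPresentable_of_iso e.symm Cardinal.aleph0.{0}
  exact Retract.isCardinalPresentable (nullSeqRetract.map (tensorRight (freeAb.obj S))) _

instance : isSolid.ι.IsRightAdjoint := by
  rw [isSolid_eq_isLocal]
  have : HasColimitsOfSize.{0, 0} LightCondAb := IsGrothendieckAbelian.hasColimits.{0} LightCondAb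
  refine MorphismProperty.isRightAdjoint_ι_isLocal solidMaps Cardinal.aleph0.{0} ?_
  rintro _ _ _ ⟨S⟩
  constructor <;> infer_instance

/-- The solidification functor, left adjoint to the inclusion of solid abelian groups. -/
def solidification : LightCondAb ⥤ Solid := isSolid.ι.leftAdjoint

/-- The adjunction between solidification and the inclusion. -/
def solidificationAdj : solidification ⊣ isSolid.ι := Adjunction.ofIsRightAdjoint _

/-- The isomorphism permuting the first two factors of a triple tensor product. -/
def swapIso (X N F : LightCondAb) : X ⊗ (N ⊗ F) ≅ N ⊗ (X ⊗ F) :=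
  (α_ X N F).symm ≪≫ whiskerRightIso (β_ X N) F ≪≫ α_ N X F

lemma swapIso_naturality (X F : LightCondAb) {N N' : LightCondAb} (σ : N ⟶ N') :
    X ◁ (σ ▷ F) ≫ (swapIso X N' F).hom = (swapIso X N F).hom ≫ σ ▷ (X ⊗ F) := by
  simp only [swapIso, Iso.trans_hom, Iso.symm_hom, whiskerRightIso_hom, Category.assoc]
  rw [associator_inv_naturality_middle_assoc, ← comp_whiskerRight_assoc,
    BraidedCategory.braiding_naturality_right, comp_whiskerRight_assoc, associator_naturality_left]

lemma isSolid_ihom {A : LightCondAb} (hA : isSolid A) (X : LightCondAb) :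
    isSolid ((ihom X).obj A) := by
  refine isSolid_of_bijective fun S => ?_
  let E := (ihom.adjunction X).homEquiv (nullSeq ⊗ freeAb.obj S) A
  let e := swapIso X nullSeq (freeAb.obj S)
  have h : (fun g : nullSeq ⊗ freeAb.obj S ⟶ (ihom X).obj A =>
      ((𝟙 nullSeq - shift) ▷ freeAb.obj S) ≫ g) ∘ E ∘ (fun g => e.hom ≫ g) =
      E ∘ (fun g => e.hom ≫ g) ∘ (fun g => ((𝟙 nullSeq - shift) ▷ (X ⊗ freeAb.obj S)) ≫ g) := by
    ext1 g
    simp only [Function.comp_apply]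
    refine ((ihom.adjunction X).homEquiv_naturality_left _ _).symm.trans (congrArg E ?_)
    refine (Category.assoc _ _ _).symm.trans ?_
    refine Eq.trans ?_ (Category.assoc _ _ _)
    exact congrArg (· ≫ g) (swapIso_naturality X (freeAb.obj S) (𝟙 nullSeq - shift))
  have he : Function.Bijective (fun g : nullSeq ⊗ (X ⊗ freeAb.obj S) ⟶ A => e.hom ≫ g) :=
    ⟨fun a b h => (cancel_epi _).1 h, fun b => ⟨e.inv ≫ b, by simp⟩⟩
  have hE := E.bijective.comp he
  rw [← Function.Bijective.of_comp_iff _ hE, h]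
  exact E.bijective.comp (he.comp (isSolid.bijective hA _))

instance (J : Type) [SmallCategory J] : isSolid.IsClosedUnderLimitsOfShape J := by
  rw [isSolid_eq_isLocal]
  infer_instance

instance : isSolid.IsClosedUnderKernels where
  kernels_le := by
    rintro _ ⟨f, k, hk, hf⟩
    refine isSolid.prop_of_isLimit hk ?_
    rintro (_ | _)
    · exact hf.1
    · exact hf.2

instance : isSolid.IsClosedUnderCokernels where
  cokernels_le := by
    rintro _ ⟨f, k, hk, hf⟩
    refine isSolid.prop_of_isColimit hk ?_
    rintro (_ | _)
    · exact hf.1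
    · exact hf.2

instance : isSolid.IsClosedUnderFiniteProducts where
  isClosedUnderLimitsOfShape J _ := by
    obtain ⟨n, ⟨e⟩⟩ := Finite.exists_equiv_fin J
    exact .of_equivalence (Discrete.equivalence e).symm

instance : isSolid.ContainsZero where
  exists_zero := ⟨_, isZero_zero _, by
    refine isSolid_of_bijective fun S => ⟨fun a b _ => (isZero_zero _).eq_of_tgt _ _, fun b =>
      ⟨0, (isZero_zero _).eq_of_tgt _ _⟩⟩⟩

instance : Abelian Solid := inferInstance

/-- The maps of light condensed abelian groups which become isomorphisms after solidification. -/
def solidEquivalences : MorphismProperty LightCondAb :=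
  (MorphismProperty.isomorphisms Solid).inverseImage solidification

instance : solidification.IsLocalization solidEquivalences :=
  solidificationAdj.isLocalization

lemma solidEquivalences_iff {X Y : LightCondAb} (f : X ⟶ Y) :
    solidEquivalences f ↔
      ∀ A : LightCondAb, isSolid A → Function.Bijective (fun g : Y ⟶ A => f ≫ g) := by
  have h (A : Solid) : Function.Bijective (fun g : Y ⟶ A.obj => f ≫ g) ↔
      Function.Bijective (fun g : solidification.obj Y ⟶ A => solidification.map f ≫ g) := by
    have h2 : (fun g : Y ⟶ A.obj => f ≫ g) ∘ solidificationAdj.homEquiv Y A =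
        solidificationAdj.homEquiv X A ∘
          (fun g : solidification.obj Y ⟶ A => solidification.map f ≫ g) := by
      ext1 g
      exact (solidificationAdj.homEquiv_naturality_left f g).symm
    rw [← Function.Bijective.of_comp_iff _ (solidificationAdj.homEquiv Y A).bijective, h2,
      Function.Bijective.of_comp_iff' (solidificationAdj.homEquiv X A).bijective]
  constructor
  · intro hf A hA
    refine (h ⟨A, hA⟩).2 ?_
    have : IsIso (solidification.map f) := hf
    exact ⟨fun a b h => (cancel_epi _).1 h, fun b => ⟨inv (solidification.map f) ≫ b, by simp⟩⟩
  · intro hf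
    refine isIso_iff_coyoneda_map_bijective _ |>.2 fun A => (h A).1 (hf A.obj A.property)

instance : solidEquivalences.IsMultiplicative := by
  unfold solidEquivalences; infer_instance

lemma solidEquivalences_whiskerLeft (X : LightCondAb) {Y₁ Y₂ : LightCondAb} (f : Y₁ ⟶ Y₂)
    (hf : solidEquivalences f) : solidEquivalences (X ◁ f) := by
  rw [solidEquivalences_iff] at hf ⊢
  intro A hA
  have h2 : (fun g : Y₂ ⟶ (ihom X).obj A => f ≫ g) ∘ (ihom.adjunction X).homEquiv Y₂ A =
      (ihom.adjunction X).homEquiv Y₁ A ∘ (fun g : X ⊗ Y₂ ⟶ A => (X ◁ f) ≫ g) := by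
    ext1 g
    exact ((ihom.adjunction X).homEquiv_naturality_left f g).symm
  rw [← Function.Bijective.of_comp_iff' ((ihom.adjunction X).homEquiv Y₁ A).bijective, ← h2,
    Function.Bijective.of_comp_iff _ ((ihom.adjunction X).homEquiv Y₂ A).bijective]
  exact hf _ (isSolid_ihom hA X)

instance : solidEquivalences.IsMonoidal where
  whiskerLeft := solidEquivalences_whiskerLeft
  whiskerRight {X₁ X₂} f hf Y := by
    have h : f ▷ Y = (β_ X₁ Y).hom ≫ Y ◁ f ≫ (β_ X₂ Y).inv := by simp
    have h2 : IsIso (solidification.map (Y ◁ f)) := solidEquivalences_whiskerLeft Y f hf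
    change IsIso (solidification.map (f ▷ Y))
    rw [h, Functor.map_comp, Functor.map_comp]
    infer_instance

/-- The category of solid abelian groups, as the monoidal localization of the category of light
condensed abelian groups at the maps which become isomorphisms after solidification. -/
abbrev SolidLoc := LocalizedMonoidal solidification solidEquivalences
  (Iso.refl (solidification.obj (𝟙_ LightCondAb)))

/-- The solid tensor product: the monoidal structure for which solidification is monoidal. -/
instance : MonoidalCategory Solid := inferInstanceAs (MonoidalCategory SolidLoc)

instance : BraidedCategory Solid := inferInstanceAs (BraidedCategory SolidLoc)

instance : SymmetricCategory Solid := inferInstanceAs (SymmetricCategory SolidLoc)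

/-- Solidification is symmetric monoidal. -/
instance : solidification.Monoidal := inferInstanceAs
  (Localization.Monoidal.toMonoidalCategory solidification solidEquivalences
    (Iso.refl (solidification.obj (𝟙_ LightCondAb)))).Monoidal

instance : solidification.Braided := inferInstanceAs
  (Localization.Monoidal.toMonoidalCategory solidification solidEquivalences
    (Iso.refl (solidification.obj (𝟙_ LightCondAb)))).Braided

instance (X : LightCondAb) : PreservesColimitsOfSize.{0, 0} (tensorLeft X) :=
  (ihom.adjunction X).leftAdjoint_preservesColimits

instance (X : LightCondAb) : PreservesColimitsOfSize.{0, 0} (tensorRight X) :=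
  preservesColimits_of_natIso (BraidedCategory.tensorLeftIsoTensorRight X)

instance (X : LightCondAb) : (tensorRight X).Additive :=
  have : PreservesColimitsOfShape (Discrete WalkingPair) (tensorRight X) :=
    PreservesColimitsOfSize.preservesColimitsOfShape.{0, 0}
  have := preservesBinaryBiproducts_of_preservesBinaryCoproducts (tensorRight X)
  Functor.additive_of_preservesBinaryBiproducts _

instance (X : LightCondAb) : Epi (nullSeqπ ▷ X) :=
  inferInstanceAs (Epi ((tensorRight X).map nullSeqπ))

lemma freeEquiv_zero (S : LightProfinite.{0}) (A : LightCondAb) :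
    freeEquiv S A 0 = 0 := by
  have h := freeEquiv_comp (0 : freeAb.obj S ⟶ A) (0 : A ⟶ A)
  rw [comp_zero] at h
  exact h

lemma bijective_sub_of_nilpotent {V : Type*} [AddCommGroup V] (T : V →+ V)
    (h : ∀ v, ∃ N, (⇑T)^[N] v = 0) : Function.Bijective (fun v => v - T v) := by
  constructor
  · intro v w hvw
    have h1 : T (v - w) = v - w := by
      rw [map_sub]
      have h2 : v - T v = w - T w := hvw
      rw [sub_eq_sub_iff_sub_eq_sub] at h2
      exact h2.symm
    obtain ⟨N, hN⟩ := h (v - w)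
    rw [Function.iterate_fixed h1] at hN
    exact sub_eq_zero.1 hN
  · intro w
    obtain ⟨N, hN⟩ := h w
    refine ⟨∑ k ∈ Finset.range N, (⇑T)^[k] w, ?_⟩
    change (∑ k ∈ Finset.range N, (⇑T)^[k] w) - T (∑ k ∈ Finset.range N, (⇑T)^[k] w) = w
    rw [map_sum, ← Finset.sum_sub_distrib]
    simp only [← Function.iterate_succ_apply' (⇑T)]
    rw [Finset.sum_range_sub' (fun k => (⇑T)^[k] w), hN, Function.iterate_zero_apply, sub_zero]

/-- The iterates of the shift map. -/
def shiftPow : ℕ → (ℕ∪{∞} ⟶ ℕ∪{∞})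
  | 0 => 𝟙 _
  | n + 1 => shiftPow n ≫ shiftNat

lemma shiftPow_infty (n : ℕ) : shiftPow n (OnePoint.infty : OnePoint ℕ) = (OnePoint.infty : OnePoint ℕ) := by
  induction n with
  | zero => rfl
  | succ n ih => exact (congrArg shiftNat ih).trans rfl

lemma shiftPow_coe (n k : ℕ) : shiftPow n (OnePoint.some k : OnePoint ℕ) = (OnePoint.some (k + n) : OnePoint ℕ) := by
  induction n with
  | zero => rfl
  | succ n ih => exact (congrArg shiftNat ih).trans rfl

lemma whiskerRight_iterate {F A : LightCondAb} (n : ℕ) (g : nullSeq ⊗ F ⟶ A) :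
    (nullSeqπ ▷ F) ≫ (⇑(Preadditive.leftComp A (shift ▷ F)))^[n] g =
      (freeAb.map (shiftPow n) ▷ F) ≫ (nullSeqπ ▷ F) ≫ g := by
  induction n generalizing g with
  | zero =>
    have : freeAb.map (shiftPow 0) = 𝟙 _ := freeAb.map_id _
    rw [this, id_whiskerRight, Category.id_comp]
    rfl
  | succ n ih =>
    have h1 : freeAb.map (shiftPow (n + 1)) = freeAb.map (shiftPow n) ≫ freeAb.map shiftNat :=
      freeAb.map_comp _ _
    have h2 : nullSeqπ ≫ shift = freeAb.map shiftNat ≫ nullSeqπ := nullSeqπ_desc _ _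
    rw [Function.iterate_succ_apply, ih, h1, comp_whiskerRight, Category.assoc,
      ← comp_whiskerRight_assoc (freeAb.map shiftNat), ← h2, comp_whiskerRight_assoc]
    rfl

/-- The discrete light condensed abelian group `ℤ`: its sections over `S` are the locally constant
maps `S → ℤ`. -/
def intZ : LightCondAb := (LightCondMod.LocallyConstant.functor ℤ).obj (ModuleCat.of ℤ ℤ)

/-- A locally constant function on `(ℕ ∪ {∞}) × S` which vanishes on `{∞} × S` vanishes on
`{n, n + 1, …} × S` for large `n`. -/
lemma exists_shiftPow {S : Type} [TopologicalSpace S] [CompactSpace S]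
    (a : LocallyConstant (OnePoint ℕ × S) ℤ) (ha : ∀ s, a (OnePoint.infty, s) = 0) :
    ∃ N, ∀ x s, a (shiftPow N x, s) = 0 := by
  have h1 : IsClosed (Prod.fst '' {x | a x ≠ 0}) := by
    refine IsCompact.isClosed (IsCompact.image ?_ continuous_fst)
    exact (a.isLocallyConstant {0}).isClosed_compl.isCompact
  have h2 : OnePoint.infty ∉ (Prod.fst '' {x | a x ≠ 0} : Set (OnePoint ℕ)) := by
    rintro ⟨⟨x, s⟩, hx, rfl⟩
    exact hx (ha s)
  have h3 := (OnePoint.tendsto_coe_infty (X := ℕ)).eventually (h1.isOpen_compl.mem_nhds h2)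
  rw [Filter.coclosedCompact_eq_cocompact, Filter.cocompact_eq_cofinite, Nat.cofinite_eq_atTop,
    Filter.eventually_atTop] at h3
  obtain ⟨N, hN⟩ := h3
  refine ⟨N, fun x s => ?_⟩
  induction x using OnePoint.rec with
  | infty => exact (congrArg (fun y => a (y, s)) (shiftPow_infty N)).trans (ha s)
  | coe k =>
    refine (congrArg (fun y => a (y, s)) (shiftPow_coe N k)).trans ?_
    by_contra h
    exact hN (k + N) (Nat.le_add_left N k) ⟨(OnePoint.some (k + N), s), h, rfl⟩

lemma isSolid_intZ : isSolid intZ := by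
  refine isSolid_of_bijective fun S => ?_
  have h1 : (𝟙 nullSeq - shift) ▷ freeAb.obj S =
      𝟙 (nullSeq ⊗ freeAb.obj S) - shift ▷ freeAb.obj S := by
    refine ((tensorRight (freeAb.obj S)).map_sub).trans ?_
    exact congrArg (· - shift ▷ freeAb.obj S) ((tensorRight (freeAb.obj S)).map_id _)
  have h2 : (fun g : nullSeq ⊗ freeAb.obj S ⟶ intZ =>
      ((𝟙 nullSeq - shift) ▷ freeAb.obj S) ≫ g) =
      (fun g => g - Preadditive.leftComp intZ (shift ▷ freeAb.obj S) g) := by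
    ext1 g
    rw [h1, Preadditive.sub_comp, Category.id_comp]
    rfl
  rw [h2]
  refine bijective_sub_of_nilpotent _ fun g => ?_
  let μ : freeAb.obj ℕ∪{∞} ⊗ freeAb.obj S ≅ freeAb.obj (ℕ∪{∞} ⊗ S) :=
    Functor.Monoidal.μIso freeAb _ _
  let k : freeAb.obj (ℕ∪{∞} ⊗ S) ⟶ intZ := μ.inv ≫ (nullSeqπ ▷ freeAb.obj S) ≫ g
  have hk {X : LightProfinite.{0}} (φ : X ⟶ ℕ∪{∞}) :
      (freeAb.map φ ▷ freeAb.obj S) ≫ (nullSeqπ ▷ freeAb.obj S) ≫ g =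
      (Functor.Monoidal.μIso freeAb _ _).hom ≫ freeAb.map (φ ▷ S) ≫ k := by
    have h3 := Functor.LaxMonoidal.μ_natural_left freeAb φ S
    have h4 : (nullSeqπ ▷ freeAb.obj S) ≫ g = μ.hom ≫ k := (μ.hom_inv_id_assoc _).symm
    rw [h4]
    refine (Category.assoc _ _ _).symm.trans ?_
    refine Eq.trans ?_ (Category.assoc _ _ _)
    exact congrArg (· ≫ k) h3
  let a : LocallyConstant (OnePoint ℕ × S) ℤ := freeEquiv _ _ k
  have ha : ∀ s, a (OnePoint.infty, s) = 0 := by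
    intro s
    have h3 : freeAb.map (pointInfty ▷ S) ≫ k = 0 := by
      rw [← cancel_epi (Functor.Monoidal.μIso freeAb _ _).hom, ← hk, ← comp_whiskerRight_assoc,
        pointInfty_nullSeqπ, comp_zero]
      exact (congrArg (· ≫ g) ((tensorRight (freeAb.obj S)).map_zero _ _)).trans zero_comp
    have h4 := (freeEquiv_map (pointInfty ▷ S) k).symm.trans
      ((congrArg _ h3).trans (freeEquiv_zero _ _))
    exact LocallyConstant.congr_fun h4 (PUnit.unit, s)
  obtain ⟨N, hN⟩ := exists_shiftPow a ha
  refine ⟨N, ?_⟩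
  rw [← cancel_epi (nullSeqπ ▷ freeAb.obj S), whiskerRight_iterate, hk, comp_zero]
  have h5 : freeAb.map (shiftPow N ▷ S) ≫ k = 0 := by
    apply (freeEquiv _ _).injective
    rw [freeEquiv_map, freeEquiv_zero]
    exact LocallyConstant.ext fun x => hN x.1 x.2
  rw [h5, comp_zero]

/-- The solid abelian group `∏_ℕ ℤ`. -/
def prodZ : Solid :=
  ⟨∏ᶜ fun _ : ℕ => intZ, isSolid.prop_limit _ fun _ => isSolid_intZ⟩

/-- A solid abelian group is finitely presented if it is a cokernel of a map
`∏_ℕ ℤ ⟶ ∏_ℕ ℤ`. -/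
def finPres : ObjectProperty Solid := fun M =>
  ∃ f : prodZ ⟶ prodZ, Nonempty (cokernel f ≅ M)

/-- The category of finitely presented solid abelian groups. -/
abbrev SolidFP := finPres.FullSubcategory

instance : LocallySmall.{0} LightCondAb := inferInstance

instance : LocallySmall.{0} Solid := inferInstance

instance : LocallySmall.{0} SolidFP := inferInstance

/-- The category of finitely presented solid abelian groups, with its (essentially small) hom-sets
replaced by sets in `Type`. This way the filtered diagrams in `Ind SmallSolidFP` are indexed by
categories in `Type`, the same universe as that of the light profinite sets and of the modules. -/
abbrev SmallSolidFP := ShrinkHoms.{1} SolidFP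

/-- The inclusion of finitely presented solid abelian groups into solid abelian groups. -/
def smallSolidFPι : SmallSolidFP ⥤ Solid := (ShrinkHoms.equivalence.{0} SolidFP).inverse ⋙ finPres.ι

end LightSolid

end

noncomputable section

namespace LightSolid

/-! ### Sections of light condensed groups and descent along covers -/

section

/-! Everything rests on the object `∏_ℕ ℤ`, which is shown to be a compact projective generator of
the solid groups with very simple endomorphisms.

Solidity says that null sequences can be summed: inverting `1 - Shift` on null sequences
parametrized by `S` gives tail sums, uniquely and naturally. A variant of this gives sums `∑ c_n
f_n` with locally constant coefficients `c_n` on `S`. Sections of `∏_ℕ ℤ` over `S` are exactly such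
families of coefficients, and each is the sum of its coordinates times the basis vectors. So maps
from `∏_ℕ ℤ` to a solid group are its null sequences, and `∏_ℕ ℤ` is the solidification of `P`
(`bijective_basisMap_comp`). As `P` is compact and projective and the inclusion of solid groups is
exact and preserves filtered colimits, `∏_ℕ ℤ` is compact and projective. It generates: a section
over `S` is a limit of its approximations along finite quotients, and the successive differences
form a null sequence indexed by a countable set, so a solid group without null sequences is zero
(`isSolid.eq_zero_of_null`). The finitely presented objects are then the compact ones, and the solid
groups are their ind-completion.

Endomorphisms of `∏_ℕ ℤ` are row-finite matrices, dual to endomorphisms of the countable free group.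
Pontryagin's theorem that countable torsionless groups are free (`free_of_countable`) shows that the
image of an endomorphism is again a countable product of copies of `ℤ`, onto which `∏_ℕ ℤ` projects
as onto a direct summand (`isCoherentProjective_piSolid`). Stability under kernels, cokernels and
extensions, and resolutions of length one, follow formally.

For flatness, `P ⊗ P ≅ P`, because the square of `ℕ ∪ {∞}` with its axes collapsed is again `ℕ ∪
{∞}`. Hence the coordinates of `∏_ℕ ℤ ⊗ ∏_ℕ ℤ` are jointly monic, and tensoring a monic endomorphism
of `∏_ℕ ℤ` with `∏_ℕ ℤ` gives a monomorphism (`mono_tensor_of_mono`). The resolutions extend this to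
monomorphisms with finitely presented cokernel, and compactness of `∏_ℕ ℤ` reduces the general case
to that one. -/

lemma continuous_hom {S T : LightProfinite.{0}} (φ : S ⟶ T) : Continuous φ :=
  (ConcreteCategory.hom φ).continuous

/-- The group of sections of a light condensed abelian group over a light profinite set. -/
abbrev Sec (A : LightCondAb) (S : LightProfinite.{0}) : Type := A.obj.obj (Opposite.op S)

/-- Restriction of sections along a map of light profinite sets. -/
def res (A : LightCondAb) {S T : LightProfinite.{0}} (φ : S ⟶ T) : Sec A T →+ Sec A S :=
  (A.obj.map φ.op).hom.toAddMonoidHom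

/-- The action of a morphism of light condensed abelian groups on sections. -/
def secMap {A B : LightCondAb} (f : A ⟶ B) (S : LightProfinite.{0}) : Sec A S →+ Sec B S :=
  (f.hom.app (Opposite.op S)).hom.toAddMonoidHom

section

variable {A B C : LightCondAb} {S T U : LightProfinite.{0}}

lemma res_res (φ : S ⟶ T) (ψ : T ⟶ U) (x : Sec A U) :
    res A φ (res A ψ x) = res A (φ ≫ ψ) x := by
  have := ConcreteCategory.congr_hom (A.obj.map_comp ψ.op φ.op) x
  exact this.symm

lemma res_id (x : Sec A S) : res A (𝟙 S) x = x :=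
  ConcreteCategory.congr_hom (A.obj.map_id (Opposite.op S)) x

lemma res_secMap (f : A ⟶ B) (φ : S ⟶ T) (x : Sec A T) :
    res B φ (secMap f T x) = secMap f S (res A φ x) :=
  (ConcreteCategory.congr_hom (f.hom.naturality φ.op) x).symm

lemma secMap_comp (f : A ⟶ B) (g : B ⟶ C) (x : Sec A S) :
    secMap (f ≫ g) S x = secMap g S (secMap f S x) := rfl

lemma freeEquiv_comp' (g : freeAb.obj S ⟶ A) (f : A ⟶ B) :
    freeEquiv S B (g ≫ f) = secMap f S (freeEquiv S A g) := freeEquiv_comp g f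

lemma freeEquiv_map' (φ : S ⟶ T) (g : freeAb.obj T ⟶ A) :
    freeEquiv S A (freeAb.map φ ≫ g) = res A φ (freeEquiv T A g) := freeEquiv_map φ g

lemma freeEquiv_add (g h : freeAb.obj S ⟶ A) :
    freeEquiv S A (g + h) = freeEquiv S A g + freeEquiv S A h := by
  have h1 (g : freeAb.obj S ⟶ A) : freeEquiv S A g = secMap g S (freeEquiv S _ (𝟙 _)) := by
    rw [← freeEquiv_comp', Category.id_comp]
  rw [h1, h1 g, h1 h]
  rfl

/-- Morphisms `ℤ[S] ⟶ A` are the same as sections of `A` over `S`, additively. -/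
def freeAddEquiv (S : LightProfinite.{0}) (A : LightCondAb) :
    (freeAb.obj S ⟶ A) ≃+ Sec A S :=
  { freeEquiv S A with map_add' := freeEquiv_add }

lemma hom_ext_sec {f g : A ⟶ B} (h : ∀ S (x : Sec A S), secMap f S x = secMap g S x) :
    f = g := by
  apply CategoryTheory.Sheaf.hom_ext
  ext S x
  exact h S.unop x

/-- A natural family of additive maps on sections is a morphism. -/
def homOfSec (F : ∀ S, Sec A S →+ Sec B S)
    (hF : ∀ {S T : LightProfinite.{0}} (φ : S ⟶ T) (x : Sec A T),
      res B φ (F T x) = F S (res A φ x)) : A ⟶ B where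
  hom :=
    { app := fun S => ModuleCat.ofHom
        { toFun := F S.unop
          map_add' := map_add _
          map_smul' := fun n x => by
            exact (congrArg (F S.unop) (int_smul_eq_zsmul _ n x)).trans
              ((map_zsmul (F S.unop) n x).trans (int_smul_eq_zsmul _ n _).symm) }
      naturality := fun S T φ => by
        ext x
        exact (hF φ.unop x).symm }

/-- A surjection of light profinite sets is an effective epimorphism, so by itself it generates a
covering sieve of the coherent topology. -/
lemma isSheafFor_of_surjective {W : LightProfinite.{0}} (f : W ⟶ T)
    (hf : Function.Surjective f) :
    Presieve.IsSheafFor (A.obj ⋙ CategoryTheory.forget _) (Presieve.singleton f) := by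
  have h : Presieve.IsSheaf (coherentTopology LightProfinite.{0})
      (A.obj ⋙ CategoryTheory.forget _) :=
    (isSheaf_iff_isSheaf_of_type _ _).1 ((LightCondensed.forget ℤ).obj A).property
  rw [Presieve.isSheafFor_iff_generate]
  refine h _ ((coherentTopology.mem_sieves_iff_hasEffectiveEpiFamily _).2
    ⟨Unit, inferInstance, fun _ => W, fun _ => f, ?_, fun _ => ?_⟩)
  · have := (LightProfinite.effectiveEpi_iff_surjective f).2 hf
    infer_instance
  · exact Sieve.le_generate _ _ _ (Presieve.singleton_self f)

lemma eq_of_surjective {W : LightProfinite.{0}} (f : W ⟶ T) (hf : Function.Surjective f)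
    {a b : Sec A T} (h : res A f a = res A f b) : a = b :=
  (isSheafFor_of_surjective f hf).isSeparatedFor.ext (by rintro _ _ ⟨⟩; exact h)

/-- Jointly surjective finite families cover. Two pieces suffice for the identities below that hold
for different reasons on two closed subsets. -/
lemma eq_of_jointly_surjective {W₁ W₂ : LightProfinite.{0}} (r₁ : W₁ ⟶ T) (r₂ : W₂ ⟶ T)
    (h : ∀ t, (∃ w, r₁ w = t) ∨ ∃ w, r₂ w = t) {a b : Sec A T}
    (h₁ : res A r₁ a = res A r₁ b) (h₂ : res A r₂ a = res A r₂ b) : a = b := by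
  have hs : Presieve.IsSheaf (coherentTopology LightProfinite.{0})
      (A.obj ⋙ CategoryTheory.forget _) :=
    (isSheaf_iff_isSheaf_of_type _ _).1 ((LightCondensed.forget ℤ).obj A).property
  let W : Bool → LightProfinite.{0} := fun i => if i then W₁ else W₂
  let r : ∀ i, W i ⟶ T := fun i => match i with
    | true => r₁
    | false => r₂
  have hr : EffectiveEpiFamily W r := by
    rw [← effectiveEpi_desc_iff_effectiveEpiFamily, LightProfinite.effectiveEpi_iff_surjective]
    intro t
    have h3 (i : Bool) (w : W i) : Sigma.desc r (Sigma.ι W i w) = r i w :=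
      ConcreteCategory.congr_hom (Sigma.ι_desc r i) w
    rcases h t with ⟨w, rfl⟩ | ⟨w, rfl⟩
    · exact ⟨_, h3 true w⟩
    · exact ⟨_, h3 false w⟩
  have h3 : Presieve.IsSheafFor (A.obj ⋙ CategoryTheory.forget _) (Presieve.ofArrows W r) := by
    rw [Presieve.isSheafFor_iff_generate]
    exact hs _ ((coherentTopology.mem_sieves_iff_hasEffectiveEpiFamily _).2
      ⟨Bool, inferInstance, W, r, hr, fun i => Sieve.le_generate _ _ _ ⟨i⟩⟩)
  refine h3.isSeparatedFor.ext ?_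
  rintro _ _ ⟨_ | _⟩
  · exact h₂
  · exact h₁

/-- Let `f : W ⟶ T` be a surjection which is injective outside of a closed subset `j : Z ⟶ W`. Then
the sections over `W` which vanish on `Z` descend to `T`. -/
lemma exists_res_eq {W Z : LightProfinite.{0}} (f : W ⟶ T) (hf : Function.Surjective f)
    (j : Z ⟶ W) (h : ∀ w w', f w = f w' → w = w' ∨ ((∃ z, j z = w) ∧ ∃ z, j z = w'))
    (a : Sec A W) (ha : res A j a = 0) : ∃ b, res A f b = a := by
  have h1 : Presieve.FamilyOfElements.Compatible
      (P := A.obj ⋙ CategoryTheory.forget _) (R := Presieve.singleton f)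
      (fun _ _ hg => by
        obtain ⟨⟩ := hg
        exact a) := by
    rintro Y₁ Y₂ V g₁ g₂ _ _ ⟨⟩ ⟨⟩ hg
    change res A g₁ a = res A g₂ a
    have hg' (v : V) : f (g₁ v) = f (g₂ v) := ConcreteCategory.congr_hom hg v
    -- Compatibility over `V` is checked on two pieces covering it: the closed locus where `g₁ =
    -- g₂`, and the space of points of `V` with chosen lifts of both images to `Z`, where both
    -- pullbacks of `a` vanish.
    have h1 : IsClosed {v : V | g₁ v = g₂ v} := isClosed_eq (continuous_hom g₁) (continuous_hom g₂)
    have h2 : IsClosed {x : V × Z × Z | g₁ x.1 = j x.2.1 ∧ g₂ x.1 = j x.2.2} :=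
      (isClosed_eq ((continuous_hom g₁).comp continuous_fst)
        ((continuous_hom j).comp (continuous_fst.comp continuous_snd))).inter
      (isClosed_eq ((continuous_hom g₂).comp continuous_fst)
        ((continuous_hom j).comp (continuous_snd.comp continuous_snd)))
    have := isCompact_iff_compactSpace.1 h1.isCompact
    have := isCompact_iff_compactSpace.1 h2.isCompact
    let r₁ : LightProfinite.of {v : V | g₁ v = g₂ v} ⟶ V :=
      ConcreteCategory.ofHom ⟨fun v => v.1, continuous_subtype_val⟩
    let r₂ : LightProfinite.of {x : V × Z × Z | g₁ x.1 = j x.2.1 ∧ g₂ x.1 = j x.2.2} ⟶ V :=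
      ConcreteCategory.ofHom ⟨fun x => x.1.1, continuous_fst.comp continuous_subtype_val⟩
    let p₁ : LightProfinite.of {x : V × Z × Z | g₁ x.1 = j x.2.1 ∧ g₂ x.1 = j x.2.2} ⟶ Z :=
      ConcreteCategory.ofHom ⟨fun x => x.1.2.1,
        (continuous_fst.comp continuous_snd).comp continuous_subtype_val⟩
    let p₂ : LightProfinite.of {x : V × Z × Z | g₁ x.1 = j x.2.1 ∧ g₂ x.1 = j x.2.2} ⟶ Z :=
      ConcreteCategory.ofHom ⟨fun x => x.1.2.2,
        (continuous_snd.comp continuous_snd).comp continuous_subtype_val⟩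
    have e₀ : r₁ ≫ g₁ = r₁ ≫ g₂ := by
      ext x
      exact x.2
    have e₁ : r₂ ≫ g₁ = p₁ ≫ j := by
      ext x
      exact x.2.1
    have e₂ : r₂ ≫ g₂ = p₂ ≫ j := by
      ext x
      exact x.2.2
    refine eq_of_jointly_surjective r₁ r₂ (fun v => ?_) ?_ ?_
    · rcases h _ _ (hg' v) with h3 | ⟨⟨z, hz⟩, z', hz'⟩
      · exact Or.inl ⟨⟨v, h3⟩, rfl⟩
      · exact Or.inr ⟨⟨⟨v, z, z'⟩, hz.symm, hz'.symm⟩, rfl⟩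
    · rw [res_res, res_res, e₀]
    · rw [res_res, res_res, e₁, e₂, ← res_res, ← res_res, ha, map_zero, map_zero]
  exact ⟨_, (isSheafFor_of_surjective f hf).valid_glue h1 f (Presieve.singleton_self f)⟩

end

end

/-! ### One-point compactifications of countable discrete sets -/

section

section Topology

variable {X : Type*} [TopologicalSpace X] [DiscreteTopology X]

lemma isClopen_singleton_coe (x : X) : IsClopen ({(x : OnePoint X)} : Set (OnePoint X)) := by
  refine ⟨isClosed_singleton, ?_⟩
  have := OnePoint.isOpenEmbedding_coe.isOpenMap {x} (isOpen_discrete _)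
  rwa [Set.image_singleton] at this

/-- An open set containing `∞` has finite complement, so its preimage is the complement of a finite
union of clopen fibres; an open set missing `∞` pulls back to a union of such fibres. -/
lemma continuous_onePoint {K : Type*} [TopologicalSpace K] {g : K → OnePoint X}
    (h : ∀ x : X, IsClopen {k | g k = x}) : Continuous g := by
  rw [continuous_def]
  intro U hU
  by_cases hinf : OnePoint.infty ∈ U
  · have hfin := isCompact_iff_finite.1 ((OnePoint.isOpen_def.1 hU).1 hinf)
    have h2 : (g ⁻¹' U)ᶜ = ⋃ x ∈ ((OnePoint.some ⁻¹' U)ᶜ : Set X), {k | g k = x} := by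
      ext k
      simp only [Set.mem_compl_iff, Set.mem_preimage, Set.mem_iUnion, Set.mem_ofPred_eq, exists_prop]
      constructor
      · intro hk
        induction hgk : g k using OnePoint.rec with
        | infty => exact absurd (hgk ▸ hinf) hk
        | coe x => exact ⟨x, hgk ▸ hk, rfl⟩
      · rintro ⟨x, hx, hk⟩
        rwa [hk]
    rw [← isClosed_compl_iff, h2]
    exact (hfin.isClopen_biUnion fun x _ => h x).1
  · have h2 : g ⁻¹' U = ⋃ x ∈ (OnePoint.some ⁻¹' U : Set X), {k | g k = x} := by
      ext k
      simp only [Set.mem_preimage, Set.mem_iUnion, Set.mem_ofPred_eq, exists_prop]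
      constructor
      · intro hk
        induction hgk : g k using OnePoint.rec with
        | infty => exact absurd (hgk ▸ hk) hinf
        | coe x => exact ⟨x, hgk ▸ hk, rfl⟩
      · rintro ⟨x, hx, hk⟩
        rwa [hk]
    rw [h2]
    exact isOpen_biUnion fun x _ => (h x).2

/-- A family of maps `X → OnePoint X'` which tend to `∞` uniformly is continuous. -/
lemma continuous_smash {X' S : Type*} [TopologicalSpace S] [TopologicalSpace X']
    [DiscreteTopology X'] {g : OnePoint X × S → OnePoint X'}
    (h0 : ∀ s, g (OnePoint.infty, s) = OnePoint.infty)
    (h1 : ∀ (x : X) (x' : X'), IsClopen {s | g (x, s) = x'})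
    (h2 : ∀ x' : X', {x : X | ∃ s, g (x, s) = x'}.Finite) : Continuous g := by
  refine continuous_onePoint fun x' => ?_
  -- The fibre over a finite point meets only finitely many slices `{x} × S` and misses the one at
  -- `∞`, so it is a finite union of clopen boxes.
  have h3 : {k | g k = x'} = ⋃ x ∈ {x : X | ∃ s, g (x, s) = x'},
      {(x : OnePoint X)} ×ˢ {s | g (x, s) = x'} := by
    ext ⟨y, s⟩
    simp only [Set.mem_ofPred_eq, Set.mem_iUnion, Set.mem_prod, Set.mem_singleton_iff, exists_prop]
    constructor
    · intro h
      induction y using OnePoint.rec with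
      | infty => exact absurd ((h0 s).symm.trans h) (OnePoint.infty_ne_coe _)
      | coe x => exact ⟨x, ⟨s, h⟩, rfl, h⟩
    · rintro ⟨x, -, rfl, h⟩
      exact h
  rw [h3]
  exact (h2 x').isClopen_biUnion fun x _ => (isClopen_singleton_coe x).prod (h1 x x')

/-- The indicators of the finite points embed `OnePoint X` into the countable power `X → Bool`. This
is the countability that makes it a light profinite set. -/
instance [Countable X] : SecondCountableTopology (OnePoint X) := by
  classical
  let g : OnePoint X → X → Bool := fun y x => decide (y = x)
  have hg : Continuous g := by
    refine continuous_pi fun x => ?_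
    rw [continuous_bool_rng true]
    convert isClopen_singleton_coe x
    ext y
    simp [g]
  have hi : Function.Injective g := by
    intro y z h
    have h2 (x : X) : y = x ↔ z = x := by simpa [g] using congrFun h x
    induction y using OnePoint.rec with
    | infty =>
      induction z using OnePoint.rec with
      | infty => rfl
      | coe x => exact (h2 x).2 rfl
    | coe x => exact ((h2 x).1 rfl).symm
  exact (hg.isClosedEmbedding hi).isEmbedding.secondCountableTopology

end Topology

/-- A continuous map as a morphism. -/
abbrev mkHom {S T : LightProfinite.{0}} (f : S → T) (hf : Continuous f) : S ⟶ T :=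
  ConcreteCategory.ofHom ⟨f, hf⟩

/-- The product `(X ∪ {∞}) × S`. -/
abbrev smash (X : Type) [TopologicalSpace X] [DiscreteTopology X] [Countable X]
    (S : LightProfinite.{0}) : LightProfinite.{0} :=
  LightProfinite.of (OnePoint X × S)

section

variable (X : Type) [TopologicalSpace X] [DiscreteTopology X] [Countable X]

/-- The inclusion of `{∞} × S`. -/
def inf (S : LightProfinite.{0}) : S ⟶ smash X S :=
  mkHom (fun s => (OnePoint.infty, s)) (by fun_prop)

variable {X}

/-- The inclusion of `{x} × S`. -/
def sliceAt (x : OnePoint X) (S : LightProfinite.{0}) : S ⟶ smash X S :=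
  mkHom (fun s => (x, s)) (by fun_prop)

/-- The map `(X ∪ {∞}) × S ⟶ (X ∪ {∞}) × T` induced by a map `S ⟶ T`. -/
def smashMap {S T : LightProfinite.{0}} (φ : S ⟶ T) : smash X S ⟶ smash X T :=
  mkHom (fun x => (x.1, φ x.2))
    (continuous_fst.prodMk ((continuous_hom φ).comp continuous_snd))

end

/-- The map induced by the shift on `ℕ ∪ {∞}`. -/
def smashShift (S : LightProfinite.{0}) : smash ℕ S ⟶ smash ℕ S :=
  mkHom (fun x => (shiftNat x.1, x.2))
    (((continuous_hom shiftNat).comp continuous_fst).prodMk continuous_snd)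

/-! ### Solidity in terms of sections -/

section Solid

variable {A : LightCondAb}

/-- Morphisms `P ⊗ ℤ[S] ⟶ A` as sections over `(ℕ ∪ {∞}) × S`. -/
def nullSec (S : LightProfinite.{0}) (g : nullSeq ⊗ freeAb.obj S ⟶ A) : Sec A (smash ℕ S) :=
  freeEquiv (ℕ∪{∞} ⊗ S) A ((Functor.Monoidal.μIso freeAb _ _).inv ≫ (nullSeqπ ▷ freeAb.obj S) ≫ g)

lemma nullSec_injective (S : LightProfinite.{0}) :
    Function.Injective (nullSec S : (nullSeq ⊗ freeAb.obj S ⟶ A) → _) := by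
  intro g h hgh
  have := (freeEquiv _ _).injective hgh
  rwa [cancel_epi, cancel_epi] at this

lemma res_freeEquiv_μ {X Y S : LightProfinite.{0}} (φ : X ⟶ Y)
    (g : freeAb.obj Y ⊗ freeAb.obj S ⟶ A) :
    res A (φ ▷ S) (freeEquiv (Y ⊗ S) A ((Functor.Monoidal.μIso freeAb _ _).inv ≫ g)) =
      freeEquiv (X ⊗ S) A ((Functor.Monoidal.μIso freeAb _ _).inv ≫
        (freeAb.map φ ▷ freeAb.obj S) ≫ g) := by
  have h3 := Functor.LaxMonoidal.μ_natural_left freeAb φ S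
  rw [← freeEquiv_map']
  congr 1
  rw [Iso.eq_inv_comp]
  refine (Category.assoc _ _ _).symm.trans ?_
  have h4 : freeAb.map φ ▷ freeAb.obj S =
    ((Functor.Monoidal.μIso freeAb X S).hom ≫ freeAb.map (φ ▷ S)) ≫
      (Functor.Monoidal.μIso freeAb Y S).inv := by
    rw [Iso.eq_comp_inv]
    exact h3
  rw [h4]
  simp only [Category.assoc]

lemma nullSec_whisker (S : LightProfinite.{0}) (φ : ℕ∪{∞} ⟶ ℕ∪{∞}) (σ : nullSeq ⟶ nullSeq)
    (h : nullSeqπ ≫ σ = freeAb.map φ ≫ nullSeqπ) (g : nullSeq ⊗ freeAb.obj S ⟶ A) :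
    nullSec S ((σ ▷ freeAb.obj S) ≫ g) = res A (φ ▷ S : ℕ∪{∞} ⊗ S ⟶ ℕ∪{∞} ⊗ S) (nullSec S g) := by
  unfold nullSec
  rw [res_freeEquiv_μ, ← comp_whiskerRight_assoc, h, comp_whiskerRight_assoc]

lemma res_inf_nullSec (S : LightProfinite.{0}) (g : nullSeq ⊗ freeAb.obj S ⟶ A) :
    res A (inf ℕ S) (nullSec S g) = 0 := by
  have h1 : res A (pointInfty ▷ S) (nullSec S g) = 0 := by
    unfold nullSec
    rw [res_freeEquiv_μ, ← comp_whiskerRight_assoc, pointInfty_nullSeqπ]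
    have h2 : (0 : freeAb.obj (LightProfinite.of PUnit.{1}) ⟶ nullSeq) ▷ freeAb.obj S = 0 :=
      (tensorRight (freeAb.obj S)).map_zero _ _
    rw [h2, zero_comp, comp_zero]
    exact freeEquiv_zero _ _
  let i : S ⟶ LightProfinite.of PUnit.{1} ⊗ S :=
    mkHom (fun s => (⟨⟩, s)) (continuous_const.prodMk continuous_id)
  have h2 : inf ℕ S = i ≫ (pointInfty ▷ S) := rfl
  exact (congrArg (fun φ => res A φ (nullSec S g)) h2).trans
    ((res_res i (pointInfty ▷ S) _).symm.trans ((congrArg _ h1).trans (map_zero _)))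

/-- Since `P` is a direct summand of `ℤ[ℕ ∪ {∞}]`, the morphism is obtained by composing with the
inclusion of the summand. The complementary idempotent factors through the point `∞`, where `f`
vanishes. -/
lemma exists_nullSec (S : LightProfinite.{0}) (f : Sec A (smash ℕ S)) (hf : res A (inf ℕ S) f = 0) :
    ∃ g : nullSeq ⊗ freeAb.obj S ⟶ A, nullSec S g = f := by
  let k : freeAb.obj ℕ∪{∞} ⊗ freeAb.obj S ⟶ A :=
    (Functor.Monoidal.μIso freeAb _ _).hom ≫ (freeEquiv (ℕ∪{∞} ⊗ S) A).symm f
  have hk : freeEquiv (ℕ∪{∞} ⊗ S) A ((Functor.Monoidal.μIso freeAb _ _).inv ≫ k) = f := by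
    simp only [k, Iso.inv_hom_id_assoc]
    exact Equiv.apply_symm_apply _ _
  have h0 : (freeAb.map pointInfty ▷ freeAb.obj S) ≫ k = 0 := by
    have h1 := res_freeEquiv_μ pointInfty k
    rw [hk] at h1
    have h2 : res A (pointInfty ▷ S) f = 0 := by
      let q : LightProfinite.of PUnit.{1} ⊗ S ⟶ S := mkHom Prod.snd continuous_snd
      have h3 : pointInfty ▷ S = q ≫ inf ℕ S := rfl
      exact (congrArg (fun φ => res A φ f) h3).trans
        ((res_res q (inf ℕ S) f).symm.trans ((congrArg _ hf).trans (map_zero _)))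
    have h3 := h1.symm.trans (h2.trans (freeEquiv_zero _ _).symm)
    have h4 := (freeEquiv _ _).injective h3
    rwa [← comp_zero (f := (Functor.Monoidal.μIso freeAb _ _).inv), cancel_epi] at h4
  refine ⟨(nullSeqRetract.i ▷ freeAb.obj S) ≫ k, ?_⟩
  have h5 : (nullSeqπ ▷ freeAb.obj S) ≫ (nullSeqRetract.i ▷ freeAb.obj S) ≫ k = k := by
    rw [← comp_whiskerRight_assoc]
    have h6 : nullSeqπ ≫ nullSeqRetract.i = 𝟙 (freeAb.obj ℕ∪{∞}) -
      freeAb.map ((CompHausLike.isTerminalPUnit.from ℕ∪{∞}) ≫ pointInfty) := nullSeqπ_desc _ _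
    have h7 : (𝟙 (freeAb.obj ℕ∪{∞}) -
      freeAb.map ((CompHausLike.isTerminalPUnit.from ℕ∪{∞}) ≫ pointInfty)) ▷ freeAb.obj S =
      𝟙 _ - freeAb.map ((CompHausLike.isTerminalPUnit.from ℕ∪{∞}) ≫ pointInfty) ▷ freeAb.obj S := by
      refine ((tensorRight (freeAb.obj S)).map_sub).trans ?_
      exact congrArg (· - _) ((tensorRight (freeAb.obj S)).map_id _)
    rw [h6, h7, Preadditive.sub_comp, Category.id_comp, Functor.map_comp, comp_whiskerRight,
      Category.assoc, h0, comp_zero, sub_zero]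
  unfold nullSec
  rw [h5, hk]

lemma nullSec_sub (S : LightProfinite.{0}) (g h : nullSeq ⊗ freeAb.obj S ⟶ A) :
    nullSec S (g - h) = nullSec S g - nullSec S h := by
  unfold nullSec
  rw [Preadditive.comp_sub, Preadditive.comp_sub]
  exact map_sub (freeAddEquiv _ _) _ _

/-- Solidity tested against `ℤ[S]`: the equation reads `h_n - h_{n+1} = f_n`, so that `h_n` is the
sum of the tail `∑_{k ≥ n} f_k`. -/
lemma isSolid.existsUnique_sub_shift (hA : isSolid A) (S : LightProfinite.{0})
    (f : Sec A (smash ℕ S)) (hf : res A (inf ℕ S) f = 0) :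
    ∃! h : Sec A (smash ℕ S), res A (inf ℕ S) h = 0 ∧ h - res A (smashShift S) h = f := by
  have key (g : nullSeq ⊗ freeAb.obj S ⟶ A) :
      nullSec S (((𝟙 nullSeq - shift) ▷ freeAb.obj S) ≫ g) =
        nullSec S g - res A (smashShift S) (nullSec S g) := by
    have h1 : (𝟙 nullSeq - shift) ▷ freeAb.obj S =
      𝟙 (nullSeq ⊗ freeAb.obj S) - shift ▷ freeAb.obj S := by
      refine ((tensorRight (freeAb.obj S)).map_sub).trans ?_
      exact congrArg (· - shift ▷ freeAb.obj S) ((tensorRight (freeAb.obj S)).map_id _)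
    rw [h1, Preadditive.sub_comp, Category.id_comp, nullSec_sub,
      nullSec_whisker S shiftNat shift (nullSeqπ_desc _ _)]
    rfl
  obtain ⟨g, rfl⟩ := exists_nullSec S f hf
  obtain ⟨g', hg'⟩ := (isSolid.bijective hA (freeAb.obj S)).2 g
  refine ⟨nullSec S g', ⟨res_inf_nullSec S g', ?_⟩, ?_⟩
  · rw [← key]
    exact congrArg _ hg'
  · rintro h ⟨hh1, hh2⟩
    obtain ⟨g'', rfl⟩ := exists_nullSec S h hh1
    rw [← key] at hh2
    exact congrArg _ ((isSolid.bijective hA (freeAb.obj S)).1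
      ((nullSec_injective S hh2).trans hg'.symm))

lemma isSolid.eq_zero_of_eq_shift (hA : isSolid A) {S : LightProfinite.{0}}
    {h : Sec A (smash ℕ S)} (h0 : res A (inf ℕ S) h = 0) (h1 : res A (smashShift S) h = h) :
    h = 0 :=
  (hA.existsUnique_sub_shift S 0 (map_zero _)).unique ⟨h0, by rw [h1, sub_self]⟩
    ⟨map_zero _, by rw [map_zero, sub_zero]⟩

/-- The operator `1 - T` is invertible on sections vanishing on `Z`, if `T` moves everything
towards `Z`. -/
lemma isSolid.existsUnique_sub (hA : isSolid A) {Y Z : LightProfinite.{0}} (j : Z ⟶ Y) (T : Y ⟶ Y)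
    (m : smash ℕ Y ⟶ Y)
    (h₀ : sliceAt (0 : ℕ) Y ≫ m = 𝟙 Y) (h₁ : smashShift Y ≫ m = smashMap T ≫ m)
    (hm₁ : m ≫ T = smashMap T ≫ m)
    (q : Y ⟶ Z) (hq : inf ℕ Y ≫ m = q ≫ j) (m' : smash ℕ Z ⟶ Z) (hm' : smashMap j ≫ m = m' ≫ j)
    (f : Sec A Y) (hf : res A j f = 0) :
    ∃! h : Sec A Y, res A j h = 0 ∧ h - res A T h = f := by
  have hs {S S' : LightProfinite.{0}} (φ : S ⟶ S') :
    smashShift S ≫ smashMap φ = smashMap φ ≫ smashShift S' := rfl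
  have hi {S S' : LightProfinite.{0}} (φ : S ⟶ S') :
    inf ℕ S ≫ smashMap φ = φ ≫ inf ℕ S' := rfl
  have h0 (g : Sec A Y) (hg : res A j g = 0) : res A (inf ℕ Y) (res A m g) = 0 := by
    rw [res_res, hq, ← res_res, hg, map_zero]
  -- By `h₀` and `h₁`, `m` is the action `(k, y) ↦ T^k y`, extended to `k = ∞` with values in `Z`.
  -- So the pullback of `f` along `m` is the null sequence `f ∘ T^k`, `h` consists of its tail sums,
  -- and the solution is their value at `k = 0`.
  obtain ⟨h, ⟨hh1, hh2⟩, -⟩ := hA.existsUnique_sub_shift Y (res A m f) (h0 f hf)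
  -- Applying `T` to `y` and shifting `k` have the same effect on `h`: the difference is a null
  -- sequence fixed by the shift.
  have h3 : res A (smashMap T) h = res A (smashShift Y) h := by
    rw [← sub_eq_zero]
    refine hA.eq_zero_of_eq_shift ?_ ?_
    · rw [map_sub, res_res, hi, ← res_res, hh1, res_res]
      have : inf ℕ Y ≫ smashShift Y = inf ℕ Y := rfl
      rw [this, hh1, map_zero, sub_zero]
    · rw [map_sub, res_res, res_res, hs, ← res_res, ← res_res]
      have e1 : res A (smashShift Y) h = h - res A m f := by rw [← hh2, sub_sub_cancel]
      have e2 : res A (smashMap T) (res A m f) = res A (smashShift Y) (res A m f) := by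
        rw [res_res, res_res, h₁]
      rw [e1, map_sub, map_sub, e1, e2]
      abel
  have h4 : res A (smashMap j) h = 0 := by
    refine hA.eq_zero_of_eq_shift ?_ ?_
    · rw [res_res, hi, ← res_res, hh1, map_zero]
    · rw [res_res, hs, ← res_res]
      have e1 : res A (smashShift Y) h = h - res A m f := by rw [← hh2, sub_sub_cancel]
      rw [e1, map_sub, res_res, hm', ← res_res, hf, map_zero, sub_zero]
  have hsl {S S' : LightProfinite.{0}} (φ : S ⟶ S') :
    sliceAt ((0 : ℕ) : OnePoint ℕ) S ≫ smashMap φ = φ ≫ sliceAt ((0 : ℕ) : OnePoint ℕ) S' := rfl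
  refine ⟨res A (sliceAt (0 : ℕ) Y) h, ⟨?_, ?_⟩, ?_⟩
  · rw [res_res, ← hsl, ← res_res, h4, map_zero]
  · rw [res_res, ← hsl, ← res_res, h3, ← map_sub, hh2, res_res, h₀, res_id]
  · suffices H : ∀ g : Sec A Y, res A j g = 0 → g - res A T g = 0 → g = 0 by
      rintro g ⟨hg1, hg2⟩
      rw [← sub_eq_zero]
      have e3 : res A (sliceAt (0 : ℕ) Y) h - res A T (res A (sliceAt (0 : ℕ) Y) h) = f := by
        rw [res_res, ← hsl, ← res_res, h3, ← map_sub, hh2, res_res, h₀, res_id]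
      refine H _ ?_ ?_
      · rw [map_sub, hg1, res_res, ← hsl, ← res_res, h4, map_zero, sub_zero]
      · rw [map_sub, sub_sub_sub_comm, hg2, e3, sub_self]
    -- For uniqueness: if `g` is fixed by `T`, its pullback along `m` is constant in `k` and
    -- vanishes at `∞`, hence is zero.
    intro g hg1 hg2
    have e4 : res A m g = 0 := by
      refine hA.eq_zero_of_eq_shift (h0 g hg1) ?_
      rw [res_res, h₁, ← hm₁, ← res_res, (sub_eq_zero.1 hg2).symm]
    rw [← res_id g, ← h₀, ← res_res, e4, map_zero]

end Solid

end

/-! ### Series with natural number coefficients in solid groups -/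

section

section

variable {A B : LightCondAb} {X : Type} [TopologicalSpace X] [DiscreteTopology X]
  {S S' : LightProfinite.{0}}

open Classical in
/-- The retraction of `(X ∪ {∞}) × S` which is the identity on a subset `D` and moves the
complement of `D` to `{∞} × S`. -/
def cutFun (D : X → S → Prop) : OnePoint X × S → OnePoint X
  | (OnePoint.infty, _) => OnePoint.infty
  | (OnePoint.some x, s) => if D x s then x else OnePoint.infty

lemma continuous_cutFun (D : X → S → Prop) (hD : ∀ x, IsClopen {s | D x s}) :
    Continuous (cutFun D) := by
  refine continuous_smash (fun _ => rfl) (fun x x' => ?_) fun x' => ?_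
  · by_cases h : x = x'
    · subst h
      convert hD x
      simp [cutFun]
    · convert isClopen_empty
      ext s
      simp only [cutFun, Set.mem_ofPred_eq, Set.mem_empty_iff_false, iff_false]
      split_ifs <;> simp [h]
  · refine (Set.finite_singleton x').subset ?_
    rintro x ⟨s, hs⟩
    simp only [cutFun] at hs
    split_ifs at hs
    · exact OnePoint.coe_injective hs
    · exact absurd hs (OnePoint.infty_ne_coe _)

variable [Countable X]

lemma hom_ext_point {S T : LightProfinite.{0}} {φ ψ : S ⟶ T} (h : ∀ s, φ s = ψ s) : φ = ψ :=
  ConcreteCategory.hom_ext _ _ h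

lemma smash_hom_ext {T : LightProfinite.{0}} {φ ψ : smash X S ⟶ T}
    (h₁ : ∀ s : S, φ (OnePoint.infty, s) = ψ (OnePoint.infty, s))
    (h₂ : ∀ (x : X) (s : S), φ (OnePoint.some x, s) = ψ (OnePoint.some x, s)) : φ = ψ := by
  refine hom_ext_point ?_
  rintro ⟨x, s⟩
  induction x using OnePoint.rec with
  | infty => exact h₁ s
  | coe x => exact h₂ x s

lemma res_eq_zero_of_infty {K : LightProfinite.{0}} (φ : K ⟶ ℕ∪{∞})
    (hφ : ∀ k, φ k = (OnePoint.infty : OnePoint ℕ)) {f : Sec A ℕ∪{∞}}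
    (hf : res A pointInfty f = 0) : res A φ f = 0 := by
  have h : φ = mkHom (fun _ => PUnit.unit) continuous_const ≫ pointInfty := by
    ext k
    exact hφ k
  rw [h, ← res_res, hf, map_zero]

/-- The retraction `cutFun` as a morphism. -/
def cut (D : X → S → Prop) (hD : ∀ x, IsClopen {s | D x s}) : smash X S ⟶ smash X S :=
  mkHom (fun k => (cutFun D k, k.2)) ((continuous_cutFun D hD).prodMk continuous_snd)

lemma cut_pos {D : X → S → Prop} (hD : ∀ x, IsClopen {s | D x s}) {x : X} {s : S} (h : D x s) :
    cut D hD (OnePoint.some x, s) = (OnePoint.some x, s) := Prod.ext (if_pos h) rfl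

lemma cut_neg {D : X → S → Prop} (hD : ∀ x, IsClopen {s | D x s}) {x : X} {s : S} (h : ¬ D x s) :
    cut D hD (OnePoint.some x, s) = (OnePoint.infty, s) := Prod.ext (if_neg h) rfl

/-- The two retractions are jointly surjective, so an identity can be checked separately where `D`
holds and where it fails, each time with everything else moved to `∞`. -/
lemma eq_of_cut (D : X → S → Prop) (hD : ∀ x, IsClopen {s | D x s}) {a b : Sec A (smash X S)}
    (h₁ : res A (cut D hD) a = res A (cut D hD) b)
    (h₂ : res A (cut (fun x s => ¬ D x s) fun x => (hD x).compl) a =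
      res A (cut (fun x s => ¬ D x s) fun x => (hD x).compl) b) : a = b := by
  refine eq_of_jointly_surjective _ _ ?_ h₁ h₂
  rintro ⟨x, s⟩
  induction x using OnePoint.rec with
  | infty => exact Or.inl ⟨(OnePoint.infty, s), rfl⟩
  | coe x =>
    by_cases h : D x s
    · exact Or.inl ⟨(x, s), cut_pos hD h⟩
    · exact Or.inr ⟨(x, s), cut_pos _ h⟩

/-- The map `(n, j) ↦ (n, j + 1)`. -/
def upFun : OnePoint (ℕ × ℕ) → OnePoint (ℕ × ℕ)
  | OnePoint.infty => OnePoint.infty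
  | OnePoint.some x => ((x.1, x.2 + 1) : ℕ × ℕ)

/-- The map `(k, (n, j)) ↦ (n, j + k)`. -/
def upActFun : OnePoint ℕ → OnePoint (ℕ × ℕ) → OnePoint (ℕ × ℕ)
  | OnePoint.infty, _ => OnePoint.infty
  | OnePoint.some _, OnePoint.infty => OnePoint.infty
  | OnePoint.some k, OnePoint.some x => ((x.1, x.2 + k) : ℕ × ℕ)

lemma isClopen_const (p : Prop) {K : Type*} [TopologicalSpace K] : IsClopen {_k : K | p} := by
  by_cases h : p
  · convert isClopen_univ
    simp [h]
  · convert isClopen_empty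
    simp [h]

lemma continuous_upActFun :
    Continuous (fun x : OnePoint ℕ × OnePoint (ℕ × ℕ) => upActFun x.1 x.2) := by
  refine continuous_smash (fun _ => rfl) (fun k x' => ?_) fun x' => ?_
  · by_cases h : k ≤ x'.2
    · convert isClopen_singleton_coe (X := ℕ × ℕ) (x'.1, x'.2 - k)
      ext y
      induction y using OnePoint.rec with
      | infty => simp [upActFun]
      | coe y =>
        obtain ⟨a, b⟩ := x'
        obtain ⟨c, d⟩ := y
        simp only [upActFun, Set.mem_ofPred_eq, OnePoint.coe_eq_coe, Prod.mk.injEq,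
          Set.mem_singleton_iff]
        dsimp only at h ⊢
        omega
    · convert isClopen_empty
      ext y
      induction y using OnePoint.rec with
      | infty => simp [upActFun]
      | coe y =>
        obtain ⟨a, b⟩ := x'
        obtain ⟨c, d⟩ := y
        simp only [upActFun, Set.mem_ofPred_eq, OnePoint.coe_eq_coe, Prod.mk.injEq,
          Set.mem_empty_iff_false, iff_false]
        dsimp only at h ⊢
        omega
  · refine (Set.finite_Iic x'.2).subset ?_
    rintro k ⟨y, hy⟩
    induction y using OnePoint.rec with
    | infty => simp [upActFun] at hy
    | coe y =>
      obtain ⟨a, b⟩ := x'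
      obtain ⟨c, d⟩ := y
      simp only [upActFun, OnePoint.coe_eq_coe, Prod.mk.injEq] at hy
      simp only [Set.mem_Iic]
      omega

lemma upActFun_one (y : OnePoint (ℕ × ℕ)) : upActFun (1 : ℕ) y = upFun y := by
  induction y using OnePoint.rec <;> rfl

lemma continuous_upFun : Continuous upFun := by
  have h := continuous_upActFun.comp (Continuous.prodMk_right ((1 : ℕ) : OnePoint ℕ))
  exact h.congr upActFun_one

/-- The map `((n, j), s) ↦ ((n, j + 1), s)`. -/
def up (S : LightProfinite.{0}) : smash (ℕ × ℕ) S ⟶ smash (ℕ × ℕ) S :=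
  mkHom (fun k => (upFun k.1, k.2)) ((continuous_upFun.comp continuous_fst).prodMk continuous_snd)

/-- The translates `(n, j + k)` tend to `∞` with `k`, uniformly in `(n, j)`, so the action of the
powers of `up` extends continuously to `k = ∞` and `isSolid.existsUnique_sub` applies. -/
lemma isSolid.existsUnique_sub_up (hA : isSolid A) (f : Sec A (smash (ℕ × ℕ) S))
    (hf : res A (inf _ S) f = 0) :
    ∃! h : Sec A (smash (ℕ × ℕ) S), res A (inf _ S) h = 0 ∧ h - res A (up S) h = f := by
  refine hA.existsUnique_sub (inf _ S) (up S)
    (mkHom (fun k => (upActFun k.1 k.2.1, k.2.2)) ((continuous_upActFun.comp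
      (continuous_fst.prodMk (continuous_fst.comp continuous_snd))).prodMk
      (continuous_snd.comp continuous_snd)))
    ?_ ?_ ?_ (mkHom Prod.snd continuous_snd) ?_ (mkHom Prod.snd continuous_snd) ?_ f hf
  · exact smash_hom_ext (fun _ => rfl) fun _ _ => rfl
  · refine smash_hom_ext (fun _ => rfl) fun k y => ?_
    obtain ⟨x, s⟩ := y
    induction x using OnePoint.rec with
    | infty => rfl
    | coe x =>
      refine Prod.ext (congrArg OnePoint.some (Prod.ext rfl ?_)) rfl
      change x.2 + (k + 1) = x.2 + 1 + k
      omega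
  · refine smash_hom_ext (fun _ => rfl) fun k y => ?_
    obtain ⟨x, s⟩ := y
    induction x using OnePoint.rec with
    | infty => rfl
    | coe x =>
      refine Prod.ext (congrArg OnePoint.some (Prod.ext rfl ?_)) rfl
      change x.2 + k + 1 = x.2 + 1 + k
      omega
  · rfl
  · exact smash_hom_ext (fun _ => rfl) fun _ _ => rfl

/-- The map `((n, j), s) ↦ n` if `j < c n s`, `((n, j), s) ↦ ∞` otherwise. -/
def belowFun (c : ℕ → S → ℕ) : OnePoint (ℕ × ℕ) × S → OnePoint ℕ
  | (OnePoint.infty, _) => OnePoint.infty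
  | (OnePoint.some x, s) => if x.2 < c x.1 s then x.1 else OnePoint.infty

lemma exists_bound (c : S → ℕ) (hc : Continuous c) : ∃ N, ∀ s, c s ≤ N := by
  obtain ⟨N, hN⟩ := (isCompact_range hc).bddAbove
  exact ⟨N, fun s => hN ⟨s, rfl⟩⟩

lemma isClopen_of_continuous {K : Type*} [TopologicalSpace K] {c : K → ℕ} (hc : Continuous c)
    (D : ℕ → Prop) : IsClopen {k | D (c k)} :=
  (isClopen_discrete {n | D n}).preimage hc

lemma continuous_belowFun (c : ℕ → S → ℕ) (hc : ∀ n, Continuous (c n)) :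
    Continuous (belowFun c) := by
  refine continuous_smash (fun _ => rfl) (fun x x' => ?_) fun x' => ?_
  · convert (isClopen_of_continuous (hc x.1) (fun i => x.2 < i)).inter (isClopen_const (x.1 = x'))
    ext s
    simp only [belowFun, Set.mem_ofPred_eq, Set.mem_inter_iff]
    split_ifs with h <;> simp [h]
  -- Although `c` may be unbounded in `n`, for fixed `n` it is bounded on the compact `S`.
  · obtain ⟨N, hN⟩ := exists_bound (c x') (hc x')
    refine ((Set.finite_singleton x').prod (Set.finite_Iic N)).subset ?_
    rintro ⟨a, b⟩ ⟨s, hs⟩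
    simp only [belowFun] at hs
    split_ifs at hs with h
    · obtain rfl := OnePoint.coe_injective hs
      exact ⟨rfl, h.le.trans (hN s)⟩
    · exact absurd hs (OnePoint.infty_ne_coe _)

/-- `belowFun` as a morphism. -/
def below (c : ℕ → S → ℕ) (hc : ∀ n, Continuous (c n)) : smash (ℕ × ℕ) S ⟶ ℕ∪{∞} :=
  mkHom (belowFun c) (continuous_belowFun c hc)

/-- The map `((n, j), s) ↦ (n, j - c n s)`. -/
def truncFun (c : ℕ → S → ℕ) : OnePoint (ℕ × ℕ) × S → OnePoint (ℕ × ℕ)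
  | (OnePoint.infty, _) => OnePoint.infty
  | (OnePoint.some x, s) => ((x.1, x.2 - c x.1 s) : ℕ × ℕ)

lemma continuous_truncFun (c : ℕ → S → ℕ) (hc : ∀ n, Continuous (c n)) :
    Continuous (truncFun c) := by
  refine continuous_smash (fun _ => rfl) (fun x x' => ?_) fun x' => ?_
  · convert (isClopen_of_continuous (hc x.1) (fun i => x.2 - i = x'.2)).inter
      (isClopen_const (x.1 = x'.1))
    ext s
    obtain ⟨a, b⟩ := x'
    simp only [truncFun, Set.mem_ofPred_eq, Set.mem_inter_iff, OnePoint.coe_eq_coe, Prod.mk.injEq]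
    tauto
  · obtain ⟨N, hN⟩ := exists_bound (c x'.1) (hc x'.1)
    refine ((Set.finite_singleton x'.1).prod (Set.finite_Iic (x'.2 + N))).subset ?_
    rintro ⟨a, b⟩ ⟨s, hs⟩
    obtain rfl := OnePoint.coe_injective hs
    have := hN s
    refine ⟨rfl, ?_⟩
    simp only [Set.mem_Iic] at *
    omega

/-- `truncFun` as a morphism over `S`. -/
def trunc (c : ℕ → S → ℕ) (hc : ∀ n, Continuous (c n)) : smash (ℕ × ℕ) S ⟶ smash (ℕ × ℕ) S :=
  mkHom (fun k => (truncFun c k, k.2)) ((continuous_truncFun c hc).prodMk continuous_snd)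

/-- The map `n ↦ (n, 0)`. -/
def baseFun : OnePoint ℕ → OnePoint (ℕ × ℕ)
  | OnePoint.infty => OnePoint.infty
  | OnePoint.some n => ((n, 0) : ℕ × ℕ)

lemma continuous_baseFun : Continuous baseFun := by
  refine continuous_onePoint fun x => ?_
  obtain ⟨a, b⟩ := x
  by_cases h : b = 0
  · subst h
    convert isClopen_singleton_coe a
    ext y
    induction y using OnePoint.rec <;> simp [baseFun]
  · convert isClopen_empty
    ext y
    induction y using OnePoint.rec with
    | infty => simp [baseFun]
    | coe y => simp [baseFun, Ne.symm h]

/-- The map `(n, s) ↦ ((n, 0), s)`. -/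
def base (S : LightProfinite.{0}) : smash ℕ S ⟶ smash (ℕ × ℕ) S :=
  mkHom (fun k => (baseFun k.1, k.2))
    ((continuous_baseFun.comp continuous_fst).prodMk continuous_snd)

/-- `a` is the sum of the series `∑ c n • f n`, where `c` is a family of natural numbers
parametrized by `S` and `f` is a null sequence. -/
def IsSum (c : ℕ → S → ℕ) (f : Sec A ℕ∪{∞}) (a : Sec A S) : Prop :=
  ∃ (hc : ∀ n, Continuous (c n)) (F : Sec A (smash (ℕ × ℕ) S)) (h : Sec A (smash ℕ S)),
    res A (inf _ S) F = 0 ∧ F - res A (up S) F = res A (below c hc) f ∧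
    res A (inf _ S) h = 0 ∧ h - res A (smashShift S) h = res A (base S) F ∧
    a = res A (sliceAt (0 : ℕ) S) h

/-- The family `F` is `(n, j) ↦ (c_n - j)⁺ • f_n`: its difference in the direction of `j` is `f_n`
for `j < c_n` and zero beyond. At `j = 0` it is the null sequence `c_n • f_n`, whose tail sums are
`h`. Multiplication by `c_n` is thus itself carried out by a summation, uniformly in `n`. -/
lemma isSolid.exists_isSum (hA : isSolid A) (c : ℕ → S → ℕ) (hc : ∀ n, Continuous (c n))
    (f : Sec A ℕ∪{∞}) (hf : res A pointInfty f = 0) : ∃ a, IsSum c f a := by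
  obtain ⟨F, ⟨hF1, hF2⟩, -⟩ := hA.existsUnique_sub_up (res A (below c hc) f) (by
    rw [res_res]
    exact res_eq_zero_of_infty _ (fun _ => rfl) hf)
  obtain ⟨h, ⟨hh1, hh2⟩, -⟩ := hA.existsUnique_sub_shift S (res A (base S) F) (by
    rw [res_res]
    exact hF1)
  exact ⟨_, hc, F, h, hF1, hF2, hh1, hh2, rfl⟩

lemma isSolid.isSum_unique (hA : isSolid A) {c : ℕ → S → ℕ} {f : Sec A ℕ∪{∞}}
    {a b : Sec A S} (hf : res A pointInfty f = 0) (ha : IsSum c f a) (hb : IsSum c f b) :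
    a = b := by
  obtain ⟨hc, F, h, hF1, hF2, hh1, hh2, rfl⟩ := ha
  obtain ⟨_, F', h', hF1', hF2', hh1', hh2', rfl⟩ := hb
  obtain rfl := (hA.existsUnique_sub_up (res A (below c hc) f) (by
    rw [res_res]
    exact res_eq_zero_of_infty _ (fun _ => rfl) hf)).unique ⟨hF1, hF2⟩ ⟨hF1', hF2'⟩
  obtain rfl := (hA.existsUnique_sub_shift S (res A (base S) F) (by
    rw [res_res]
    exact hF1)).unique ⟨hh1, hh2⟩ ⟨hh1', hh2'⟩
  rfl

lemma IsSum.res {c : ℕ → S → ℕ} {f : Sec A ℕ∪{∞}} {a : Sec A S} (h : IsSum c f a)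
    (φ : S' ⟶ S) : IsSum (fun n s => c n (φ s)) f (res A φ a) := by
  obtain ⟨hc, F, h, hF1, hF2, hh1, hh2, rfl⟩ := h
  refine ⟨fun n => (hc n).comp (continuous_hom φ), LightSolid.res A (smashMap φ) F,
    LightSolid.res A (smashMap φ) h, ?_, ?_, ?_, ?_, ?_⟩
  · have : inf (ℕ × ℕ) S' ≫ smashMap φ = φ ≫ inf _ S := rfl
    rw [res_res, this, ← res_res, hF1, map_zero]
  · have h1 : up S' ≫ smashMap φ = smashMap φ ≫ up S := rfl
    have h2 : below (fun n s => c n (φ s)) (fun n => (hc n).comp (continuous_hom φ)) =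
        smashMap φ ≫ below c hc := by
      ext ⟨x, s⟩
      induction x using OnePoint.rec <;> rfl
    rw [res_res, h1, ← res_res, ← map_sub, hF2, h2, res_res]
  · have : inf ℕ S' ≫ smashMap φ = φ ≫ inf _ S := rfl
    rw [res_res, this, ← res_res, hh1, map_zero]
  · have h1 : smashShift S' ≫ smashMap φ = smashMap φ ≫ smashShift S := rfl
    have h2 : base S' ≫ smashMap φ = smashMap φ ≫ base S := rfl
    rw [res_res, h1, ← res_res, ← map_sub, hh2, res_res, res_res, h2]
  · rw [res_res, res_res]
    rfl

lemma IsSum.map {c : ℕ → S → ℕ} {f : Sec A ℕ∪{∞}} {a : Sec A S} (h : IsSum c f a)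
    (g : A ⟶ B) : IsSum c (secMap g _ f) (secMap g _ a) := by
  obtain ⟨hc, F, h, hF1, hF2, hh1, hh2, rfl⟩ := h
  refine ⟨hc, secMap g _ F, secMap g _ h, ?_, ?_, ?_, ?_, ?_⟩
  · rw [res_secMap, hF1, map_zero]
  · rw [res_secMap, res_secMap, ← hF2, map_sub]
  · rw [res_secMap, hh1, map_zero]
  · rw [res_secMap, res_secMap, ← hh2, map_sub]
  · rw [res_secMap]

/-- The witness is `F (n, j) + F' (n, j - c_n)` with truncated subtraction, which counts `c_n`
copies of `f_n` and then `c'_n` more. For `j < c_n` the second term does not change with `j`; for `j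
≥ c_n` the first one does not. At `j = 0` truncation gives `F + F'`. -/
lemma IsSum.add {c c' : ℕ → S → ℕ} {f : Sec A ℕ∪{∞}} {a a' : Sec A S}
    (hf : LightSolid.res A pointInfty f = 0) (h : IsSum c f a)
    (h' : IsSum c' f a') : IsSum (fun n s => c n s + c' n s) f (a + a') := by
  obtain ⟨hc, F, h, hF1, hF2, hh1, hh2, rfl⟩ := h
  obtain ⟨hc', F', h', hF1', hF2', hh1', hh2', rfl⟩ := h'
  refine ⟨fun n => (hc n).add (hc' n), F + LightSolid.res A (trunc c hc) F', h + h', ?_, ?_, ?_,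
    ?_, ?_⟩
  · rw [map_add, hF1, res_res]
    have : inf _ S ≫ trunc c hc = inf _ S := rfl
    rw [this, hF1', add_zero]
  · have hD (x : ℕ × ℕ) : IsClopen {s : S | x.2 < c x.1 s} :=
      isClopen_of_continuous (hc x.1) (fun i => x.2 < i)
    refine eq_of_cut (fun x s => x.2 < c x.1 s) hD ?_ ?_
    · have e1 : cut (fun x s => x.2 < c x.1 s) hD ≫ up S ≫ trunc c hc =
          cut (fun x s => x.2 < c x.1 s) hD ≫ trunc c hc := by
        refine smash_hom_ext (fun _ => rfl) fun x s => ?_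
        change trunc c hc (up S (cut _ hD _)) = trunc c hc (cut _ hD _)
        by_cases h : x.2 < c x.1 s
        · rw [cut_pos hD h]
          refine Prod.ext (congrArg OnePoint.some (Prod.ext rfl ?_)) rfl
          change x.2 + 1 - c x.1 s = x.2 - c x.1 s
          omega
        · rw [cut_neg hD h]
          rfl
      have e2 : cut (fun x s => x.2 < c x.1 s) hD ≫ below (fun n s => c n s + c' n s)
          (fun n => (hc n).add (hc' n)) = cut (fun x s => x.2 < c x.1 s) hD ≫ below c hc := by
        refine smash_hom_ext (fun _ => rfl) fun x s => ?_
        change below (fun n s => c n s + c' n s) (fun n => (hc n).add (hc' n)) (cut _ hD _) =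
          below c hc (cut _ hD _)
        by_cases h : x.2 < c x.1 s
        · rw [cut_pos hD h]
          exact (if_pos (show x.2 < c x.1 s + c' x.1 s by omega)).trans (if_pos h).symm
        · rw [cut_neg hD h]
          rfl
      rw [map_add, add_sub_add_comm, hF2, map_add, map_sub, res_res (up S), res_res _ (trunc c hc),
        res_res _ (up S ≫ trunc c hc), e1, sub_self, add_zero, res_res, res_res, e2]
    · have e1 : cut (fun x s => ¬ x.2 < c x.1 s) (fun x => (hD x).compl) ≫ up S ≫ trunc c hc =
          cut (fun x s => ¬ x.2 < c x.1 s) (fun x => (hD x).compl) ≫ trunc c hc ≫ up S := by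
        refine smash_hom_ext (fun _ => rfl) fun x s => ?_
        change trunc c hc (up S (cut _ (fun x => (hD x).compl) _)) =
          up S (trunc c hc (cut _ (fun x => (hD x).compl) _))
        by_cases h : ¬ x.2 < c x.1 s
        · rw [cut_pos _ h]
          refine Prod.ext (congrArg OnePoint.some (Prod.ext rfl ?_)) rfl
          change x.2 + 1 - c x.1 s = x.2 - c x.1 s + 1
          omega
        · rw [cut_neg _ h]
          rfl
      have e2 : cut (fun x s => ¬ x.2 < c x.1 s) (fun x => (hD x).compl) ≫
          below (fun n s => c n s + c' n s) (fun n => (hc n).add (hc' n)) =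
            cut (fun x s => ¬ x.2 < c x.1 s) (fun x => (hD x).compl) ≫ trunc c hc ≫ below c' hc' := by
        refine smash_hom_ext (fun _ => rfl) fun x s => ?_
        change below (fun n s => c n s + c' n s) (fun n => (hc n).add (hc' n))
          (cut (fun x s => ¬ x.2 < c x.1 s) (fun x => (hD x).compl) _) =
          below c' hc' (trunc c hc (cut (fun x s => ¬ x.2 < c x.1 s) (fun x => (hD x).compl) _))
        by_cases h : ¬ x.2 < c x.1 s
        · rw [cut_pos _ h]
          change (if _ then _ else _) = (if _ then _ else _)
          congr 1
          simp only [eq_iff_iff]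
          omega
        · rw [cut_neg _ h]
          rfl
      have e3 : LightSolid.res A (cut (fun x s => ¬ x.2 < c x.1 s) (fun x => (hD x).compl))
          (LightSolid.res A (below c hc) f) = 0 := by
        rw [res_res]
        refine res_eq_zero_of_infty _ ?_ hf
        rintro ⟨x, s⟩
        change belowFun c (cut _ (fun x => (hD x).compl) _) = _
        induction x using OnePoint.rec with
        | infty => rfl
        | coe x =>
          by_cases h : ¬ x.2 < c x.1 s
          · rw [cut_pos _ h]
            exact if_neg h
          · rw [cut_neg _ h]
            rfl
      rw [map_add, add_sub_add_comm, hF2, map_add, e3, zero_add, res_res _ (below _ _), e2, map_sub,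
        res_res (up S), res_res _ (up S ≫ trunc c hc), e1]
      simp only [← res_res]
      rw [← map_sub, ← map_sub, hF2']
  · rw [map_add, hh1, hh1', add_zero]
  · have : base S ≫ trunc c hc = base S := by
      refine smash_hom_ext (fun _ => rfl) fun x s => ?_
      refine Prod.ext (congrArg OnePoint.some (Prod.ext rfl ?_)) rfl
      exact Nat.zero_sub _
    rw [map_add, map_add, add_sub_add_comm, hh2, hh2', res_res, this]
  · rw [map_add]

end

end

/-! ### Sections of products of copies of `ℤ`, and explicit series -/

section

section IntSections

variable {S T : LightProfinite.{0}}

/-- The function underlying a section of `ℤ`. -/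
def val (a : Sec intZ S) : S → ℤ := fun s => (show LocallyConstant S ℤ from a) s

/-- A continuous function as a section of `ℤ`. -/
def mkInt (f : S → ℤ) (hf : Continuous f) : Sec intZ S :=
  show LocallyConstant S ℤ from ⟨f, (IsLocallyConstant.iff_continuous f).2 hf⟩

lemma val_injective : Function.Injective (val : Sec intZ S → S → ℤ) := fun _ _ h =>
  LocallyConstant.ext (congrFun h)

lemma continuous_val (a : Sec intZ S) : Continuous (val a) :=
  LocallyConstant.continuous (show LocallyConstant S ℤ from a)

lemma val_add (a b : Sec intZ S) (s : S) : val (a + b) s = val a s + val b s := rfl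

lemma val_sub (a b : Sec intZ S) (s : S) : val (a - b) s = val a s - val b s := rfl

lemma val_res (φ : S ⟶ T) (a : Sec intZ T) (s : S) : val (res intZ φ a) s = val a (φ s) := rfl

end IntSections

lemma continuous_of_finite_support {X S : Type*} [TopologicalSpace X] [DiscreteTopology X]
    [TopologicalSpace S] {g : OnePoint X × S → ℤ} (h0 : ∀ s, g (OnePoint.infty, s) = 0)
    (h1 : ∀ x : X, Continuous fun s => g (x, s)) (h2 : {x : X | ∃ s, g (x, s) ≠ 0}.Finite) :
    Continuous g := by
  have key (D : Set ℤ) (hD : 0 ∉ D) : IsClopen (g ⁻¹' D) := by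
    have h3 : g ⁻¹' D = ⋃ x ∈ {x : X | ∃ s, g (x, s) ≠ 0},
        {(x : OnePoint X)} ×ˢ {s | g (x, s) ∈ D} := by
      ext ⟨y, s⟩
      simp only [Set.mem_ofPred_eq, Set.mem_iUnion, Set.mem_prod, Set.mem_singleton_iff, exists_prop,
        Set.mem_preimage]
      constructor
      · intro h
        induction y using OnePoint.rec with
        | infty => exact absurd (h0 s ▸ h) hD
        | coe x => exact ⟨x, ⟨s, fun h3 => hD (h3 ▸ h)⟩, rfl, h⟩
      · rintro ⟨x, -, rfl, h⟩
        exact h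
    rw [h3]
    exact h2.isClopen_biUnion fun x _ =>
      (isClopen_singleton_coe x).prod ((isClopen_discrete D).preimage (h1 x))
  rw [continuous_def]
  intro U _
  by_cases hU : (0 : ℤ) ∈ U
  · have := (key Uᶜ fun h => h hU).compl
    rw [Set.preimage_compl, compl_compl] at this
    exact this.2
  · exact (key U hU).2

section Product

variable {S T : LightProfinite.{0}}

/-- The light condensed abelian group `∏_I ℤ`. -/
abbrev piZ (I : Type) : LightCondAb := ∏ᶜ fun _ : I => intZ

/-- The coordinates of a section of a product of copies of `ℤ`. -/
def coord {I : Type} (i : I) (x : Sec (piZ I) S) : Sec intZ S :=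
  secMap (Pi.π (fun _ : I => intZ) i) S x

lemma coord_ext {I : Type} {x y : Sec (piZ I) S} (h : ∀ i, coord i x = coord i y) : x = y := by
  apply (freeEquiv S (piZ I)).symm.injective
  refine Limits.Pi.hom_ext _ _ fun i => (freeEquiv S _).injective ?_
  rw [freeEquiv_comp', freeEquiv_comp', Equiv.apply_symm_apply, Equiv.apply_symm_apply]
  exact h i

lemma exists_coord {I : Type} (a : I → Sec intZ S) :
    ∃ x : Sec (piZ I) S, ∀ i, coord i x = a i := by
  refine ⟨freeEquiv S (piZ I) (Pi.lift fun i => (freeEquiv S _).symm (a i)), fun i => ?_⟩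
  refine (freeEquiv_comp' _ _).symm.trans ?_
  rw [Limits.Pi.lift_π, Equiv.apply_symm_apply]

lemma coord_add {I : Type} (i : I) (x y : Sec (piZ I) S) : coord i (x + y) = coord i x + coord i y :=
  map_add _ _ _

lemma coord_res {I : Type} (i : I) (φ : S ⟶ T) (x : Sec (piZ I) T) :
    coord i (res (piZ I) φ x) = res intZ φ (coord i x) := (res_secMap _ _ _).symm

end Product

section Sum

variable {A B : LightCondAb} {S T : LightProfinite.{0}}

lemma isSum_zero (f : Sec A ℕ∪{∞}) (hf : res A pointInfty f = 0) :
    IsSum (fun _ _ => 0) f (0 : Sec A S) := by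
  refine ⟨fun _ => continuous_const, 0, 0, map_zero _, ?_, map_zero _, ?_, (map_zero _).symm⟩
  · rw [map_zero, sub_zero]
    refine (res_eq_zero_of_infty _ ?_ hf).symm
    rintro ⟨x, s⟩
    induction x using OnePoint.rec <;> rfl
  · rw [map_zero, map_zero, sub_zero]

/-- The map `(m, s) ↦ s` if `m ≤ s`, `(m, s) ↦ ∞` otherwise. -/
def tailFun : OnePoint ℕ × OnePoint ℕ → OnePoint ℕ
  | (OnePoint.infty, _) => OnePoint.infty
  | (OnePoint.some _, OnePoint.infty) => OnePoint.infty
  | (OnePoint.some m, OnePoint.some s) => if m ≤ s then s else OnePoint.infty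

lemma continuous_tailFun : Continuous tailFun := by
  refine continuous_smash (fun _ => rfl) (fun m x' => ?_) fun x' => ?_
  · by_cases h : m ≤ x'
    · convert isClopen_singleton_coe (X := ℕ) x'
      ext y
      induction y using OnePoint.rec with
      | infty => simp [tailFun]
      | coe y =>
        simp only [tailFun, Set.mem_ofPred_eq, Set.mem_singleton_iff]
        split_ifs with h'
        · rfl
        · simp only [OnePoint.infty_ne_coe, OnePoint.coe_eq_coe, false_iff]
          rintro rfl
          exact h' h
    · convert isClopen_empty
      ext y
      induction y using OnePoint.rec with
      | infty => simp [tailFun]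
      | coe y =>
        simp only [tailFun, Set.mem_ofPred_eq, Set.mem_empty_iff_false, iff_false]
        split_ifs with h'
        · rw [OnePoint.coe_eq_coe]
          rintro rfl
          exact h h'
        · exact OnePoint.infty_ne_coe _
  · refine (Set.finite_Iic x').subset ?_
    rintro m ⟨y, hy⟩
    induction y using OnePoint.rec with
    | infty => simp [tailFun] at hy
    | coe y =>
      simp only [tailFun] at hy
      split_ifs at hy with h
      · exact h.trans_eq (OnePoint.coe_injective hy)
      · exact absurd hy (OnePoint.infty_ne_coe _)

/-- The indicator function of a finite point. -/
def delta (n : ℕ) (s : OnePoint ℕ) : ℕ := by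
  classical exact if s = OnePoint.some n then 1 else 0

lemma delta_pos (n : ℕ) : delta n (OnePoint.some n) = 1 := if_pos rfl

lemma delta_neg {n : ℕ} {s : OnePoint ℕ} (h : s ≠ OnePoint.some n) : delta n s = 0 := if_neg h

lemma continuous_delta (n : ℕ) : Continuous (delta n) := by
  classical
  refine continuous_const.if (fun a ha => ?_) continuous_const
  have h := (isClopen_singleton_coe n).frontier_eq
  exact absurd (h ▸ ha) (Set.notMem_empty a)

/-- Any null sequence is its own sum with respect to the universal coefficients. -/
lemma isSum_delta (f : Sec A ℕ∪{∞}) (hf : res A pointInfty f = 0) :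
    IsSum (S := ℕ∪{∞}) delta f f := by
  -- At the point `s` the coefficients are the indicator of `s`, so the tail sum from `m` on is
  -- `f_s` if `m ≤ s` and zero otherwise. The coefficients being at most `1`, the family `F`
  -- vanishes for `j ≥ 1` and is simply the pullback of `f` along `below`.
  let tail : smash ℕ ℕ∪{∞} ⟶ ℕ∪{∞} := mkHom tailFun continuous_tailFun
  refine ⟨continuous_delta, res A (below (S := ℕ∪{∞}) delta continuous_delta) f, res A tail f,
    ?_, ?_, ?_, ?_, ?_⟩
  · rw [res_res]
    exact res_eq_zero_of_infty _ (fun _ => rfl) hf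
  · rw [sub_eq_self, res_res]
    refine res_eq_zero_of_infty _ ?_ hf
    rintro ⟨x, s⟩
    induction x using OnePoint.rec with
    | infty => rfl
    | coe x =>
      refine if_neg ?_
      by_cases h : s = OnePoint.some x.1
      · rw [h, delta_pos]
        omega
      · rw [delta_neg h]
        omega
  · rw [res_res]
    exact res_eq_zero_of_infty _ (fun _ => rfl) hf
  · have hD (n : ℕ) : IsClopen {s : ℕ∪{∞} | s = (OnePoint.some n : OnePoint ℕ)} :=
      isClopen_singleton_coe n
    have hb (n : ℕ) (s : OnePoint ℕ) : (base ℕ∪{∞} ≫ below (S := ℕ∪{∞}) delta continuous_delta)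
        (OnePoint.some n, s) = if 0 < delta n s then (n : OnePoint ℕ) else OnePoint.infty := rfl
    have e₀ : res A (cut (fun n (s : ℕ∪{∞}) => s = (OnePoint.some n : OnePoint ℕ)) hD)
        (res A (smashShift ℕ∪{∞}) (res A tail f)) = 0 := by
      rw [res_res, res_res]
      refine res_eq_zero_of_infty _ ?_ hf
      rintro ⟨x, s⟩
      induction x using OnePoint.rec with
      | infty => rfl
      | coe n =>
        change tail (smashShift _ (cut (fun n (s : ℕ∪{∞}) => s = (OnePoint.some n : OnePoint ℕ))
          hD _)) = _
        by_cases h : s = (OnePoint.some n : OnePoint ℕ)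
        · rw [cut_pos hD h]
          subst h
          exact if_neg (show ¬ n + 1 ≤ n by omega)
        · rw [cut_neg hD h]
          rfl
    have e₁ : cut (fun n (s : ℕ∪{∞}) => s = (OnePoint.some n : OnePoint ℕ)) hD ≫ tail =
        cut (fun n (s : ℕ∪{∞}) => s = (OnePoint.some n : OnePoint ℕ)) hD ≫ base ℕ∪{∞} ≫
          below (S := ℕ∪{∞}) delta continuous_delta := by
      refine smash_hom_ext (fun _ => rfl) fun n s => ?_
      change tail (cut (fun n (s : ℕ∪{∞}) => s = (OnePoint.some n : OnePoint ℕ)) hD _) =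
        (base ℕ∪{∞} ≫ below (S := ℕ∪{∞}) delta continuous_delta)
          (cut (fun n (s : ℕ∪{∞}) => s = (OnePoint.some n : OnePoint ℕ)) hD _)
      by_cases h : s = (OnePoint.some n : OnePoint ℕ)
      · rw [cut_pos hD h]
        subst h
        rw [hb, delta_pos]
        exact (if_pos le_rfl).trans (if_pos Nat.zero_lt_one).symm
      · rw [cut_neg hD h]
        rfl
    have e₂ : res A (cut (fun n (s : ℕ∪{∞}) => ¬ s = (OnePoint.some n : OnePoint ℕ))
        fun n => (hD n).compl) (res A (base ℕ∪{∞})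
          (res A (below (S := ℕ∪{∞}) delta continuous_delta) f)) = 0 := by
      rw [res_res (base _), res_res]
      refine res_eq_zero_of_infty _ ?_ hf
      rintro ⟨x, s⟩
      induction x using OnePoint.rec with
      | infty => rfl
      | coe n =>
        change (base ℕ∪{∞} ≫ below (S := ℕ∪{∞}) delta continuous_delta)
          (cut (fun n (s : ℕ∪{∞}) => ¬ s = (OnePoint.some n : OnePoint ℕ))
            (fun n => (hD n).compl) _) = _
        by_cases h : ¬ s = (OnePoint.some n : OnePoint ℕ)
        · rw [cut_pos _ h, hb, delta_neg h]
          rfl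
        · rw [cut_neg _ h]
          rfl
    have e₃ : cut (fun n (s : ℕ∪{∞}) => ¬ s = (OnePoint.some n : OnePoint ℕ))
        (fun n => (hD n).compl) ≫ smashShift ℕ∪{∞} ≫ tail =
          cut (fun n (s : ℕ∪{∞}) => ¬ s = (OnePoint.some n : OnePoint ℕ))
            (fun n => (hD n).compl) ≫ tail := by
      refine smash_hom_ext (fun _ => rfl) fun n s => ?_
      change tail (smashShift _ (cut (fun n (s : ℕ∪{∞}) => ¬ s = (OnePoint.some n : OnePoint ℕ))
        (fun n => (hD n).compl) _)) = tail (cut (fun n (s : ℕ∪{∞}) =>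
          ¬ s = (OnePoint.some n : OnePoint ℕ)) (fun n => (hD n).compl) _)
      by_cases h : ¬ s = (OnePoint.some n : OnePoint ℕ)
      · rw [cut_pos _ h]
        induction s using OnePoint.rec with
        | infty => rfl
        | coe s =>
          change (if n + 1 ≤ s then (s : OnePoint ℕ) else OnePoint.infty) =
            if n ≤ s then (s : OnePoint ℕ) else OnePoint.infty
          have h' : s ≠ n := fun h' => h (congrArg _ h')
          congr 1
          simp only [eq_iff_iff]
          omega
      · rw [cut_neg _ h]
        rfl
    -- Where `s = n`, the shifted tail vanishes and the tail is `f_n`. Elsewhere `n ≤ s` and `n + 1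
    -- ≤ s` are equivalent, so the tail equals its shift, and the coefficient is zero.
    refine eq_of_cut (fun n s => s = (OnePoint.some n : OnePoint ℕ)) hD ?_ ?_
    · rw [map_sub, e₀, sub_zero, res_res, e₁, res_res (base _), res_res]
    · rw [e₂, map_sub, res_res (smashShift _), res_res, res_res, e₃, sub_self]
  · have : sliceAt ((0 : ℕ) : OnePoint ℕ) ℕ∪{∞} ≫ tail = 𝟙 _ := by
      refine hom_ext_point fun s => ?_
      change tailFun _ = s
      induction s using OnePoint.rec with
      | infty => rfl
      | coe s =>
        change (if 0 ≤ s then (s : OnePoint ℕ) else OnePoint.infty) = s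
        exact if_pos (Nat.zero_le s)
    rw [res_res, this, res_id]

/-- Only the term `n = k` is nonzero, so the witnesses are explicit: `(c_k - j)⁺` at `(k, j)`, and
the tail sums `c_k` for `m ≤ k`. Boundedness of `c_k` makes the first one finitely supported. This
computes the coordinates of a series of basis vectors in `∏_ℕ ℤ`. -/
lemma isSum_intZ (c : ℕ → S → ℕ) (hc : ∀ n, Continuous (c n)) (k : ℕ) (f : Sec intZ ℕ∪{∞})
    (hf : ∀ s, val f s = delta k s) :
    IsSum c f (mkInt (fun s => c k s) (continuous_of_discreteTopology.comp (hc k))) := by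
  classical
  let F : OnePoint (ℕ × ℕ) × S → ℤ := fun x => match x with
    | (OnePoint.infty, _) => 0
    | (OnePoint.some p, s) => if p.1 = k then ((c k s - p.2 : ℕ) : ℤ) else 0
  let h : OnePoint ℕ × S → ℤ := fun x => match x with
    | (OnePoint.infty, _) => 0
    | (OnePoint.some m, s) => if m ≤ k then (c k s : ℤ) else 0
  have hF : Continuous F := by
    refine continuous_of_finite_support (fun _ => rfl) (fun p => ?_) ?_
    · by_cases hp : p.1 = k
      · simp only [F, hp, if_true]
        exact (continuous_of_discreteTopology (f := fun i : ℕ => ((i - p.2 : ℕ) : ℤ))).comp (hc k)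
      · simp only [F, hp, if_false]
        exact continuous_const
    · obtain ⟨N, hN⟩ := exists_bound (c k) (hc k)
      refine ((Set.finite_singleton k).prod (Set.finite_Iic N)).subset ?_
      rintro ⟨a, b⟩ ⟨s, hs⟩
      simp only [F] at hs
      split_ifs at hs with hab
      · have := hN s
        refine ⟨hab, ?_⟩
        simp only [Set.mem_Iic]
        omega
      · exact absurd rfl hs
  have hh : Continuous h := by
    refine continuous_of_finite_support (fun _ => rfl) (fun m => ?_) ?_
    · by_cases hm : m ≤ k
      · simp only [h, hm, if_true]
        exact continuous_of_discreteTopology.comp (hc k)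
      · simp only [h, hm, if_false]
        exact continuous_const
    · refine (Set.finite_Iic k).subset ?_
      rintro m ⟨s, hs⟩
      simp only [h] at hs
      split_ifs at hs with hm
      · exact hm
      · exact absurd rfl hs
  refine ⟨hc, mkInt (S := smash (ℕ × ℕ) S) F hF, mkInt (S := smash ℕ S) h hh, ?_, ?_, ?_, ?_, ?_⟩
  · exact val_injective (funext fun _ => rfl)
  · refine val_injective (funext fun x => ?_)
    obtain ⟨x, s⟩ := x
    rw [val_sub, val_res, val_res, hf]
    induction x using OnePoint.rec with
    | infty => exact (congrArg Nat.cast (delta_neg (OnePoint.infty_ne_coe k))).symm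
    | coe p =>
      obtain ⟨a, b⟩ := p
      change (if a = k then ((c k s - b : ℕ) : ℤ) else 0) -
        (if a = k then ((c k s - (b + 1) : ℕ) : ℤ) else 0) =
        (delta k (if b < c a s then (a : OnePoint ℕ) else OnePoint.infty) : ℤ)
      by_cases hab : a = k
      · subst hab
        simp only [if_true]
        split_ifs with hb
        · rw [delta_pos]
          omega
        · rw [delta_neg (OnePoint.infty_ne_coe a)]
          omega
      · simp only [hab, if_false]
        rw [delta_neg]
        · rfl
        · split_ifs
          · simpa using hab
          · exact OnePoint.infty_ne_coe k
  · exact val_injective (funext fun _ => rfl)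
  · refine val_injective (funext fun x => ?_)
    obtain ⟨x, s⟩ := x
    induction x using OnePoint.rec with
    | infty => rfl
    | coe m =>
      rw [val_sub, val_res, val_res]
      change (if m ≤ k then (c k s : ℤ) else 0) - (if m + 1 ≤ k then (c k s : ℤ) else 0) =
        if m = k then ((c k s - 0 : ℕ) : ℤ) else 0
      split_ifs <;> omega
  · refine val_injective (funext fun s => ?_)
    change (c k s : ℤ) = if 0 ≤ k then (c k s : ℤ) else 0
    exact (if_pos (Nat.zero_le k)).symm

end Sum

end

/-! ### Series with integer coefficients; `∏_ℕ ℤ` is the solidification of `P` -/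

section

variable {A B : LightCondAb} {S T : LightProfinite.{0}}

/-- `a` is the sum of the series `∑ x n • f n`, where `x` is a section of `∏_ℕ ℤ` and `f` is a
null sequence. -/
def IsIntSum (x : Sec (piZ ℕ) S) (f : Sec A ℕ∪{∞}) (a : Sec A S) : Prop :=
  ∃ (c c' : ℕ → S → ℕ) (b b' : Sec A S), IsSum c f b ∧ IsSum c' f b' ∧
    (∀ n s, val (coord n x) s = c n s - c' n s) ∧ a = b - b'

lemma isSolid.exists_isIntSum (hA : isSolid A) (x : Sec (piZ ℕ) S) (f : Sec A ℕ∪{∞})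
    (hf : res A pointInfty f = 0) : ∃ a, IsIntSum x f a := by
  obtain ⟨b, hb⟩ := hA.exists_isSum (fun n s => (val (coord n x) s).toNat)
    (fun n => (continuous_of_discreteTopology (f := Int.toNat)).comp
      (continuous_val (coord n x))) f hf
  obtain ⟨b', hb'⟩ := hA.exists_isSum (fun n s => (- val (coord n x) s).toNat)
    (fun n => (continuous_of_discreteTopology (f := fun i : ℤ => (-i).toNat)).comp
      (continuous_val (coord n x))) f hf
  exact ⟨b - b', _, _, b, b', hb, hb', fun n s => (Int.toNat_sub_toNat_neg _).symm, rfl⟩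

/-- If `c - c' = d - d'` then `c + d' = d + c'`, so independence of the decomposition reduces to
additivity and uniqueness for natural coefficients. -/
lemma isSolid.isIntSum_unique (hA : isSolid A) {x : Sec (piZ ℕ) S} {f : Sec A ℕ∪{∞}}
    (hf : res A pointInfty f = 0) {a a' : Sec A S} (h : IsIntSum x f a) (h' : IsIntSum x f a') :
    a = a' := by
  obtain ⟨c, c', b, b', hb, hb', hx, rfl⟩ := h
  obtain ⟨d, d', e, e', he, he', hx', rfl⟩ := h'
  have h1 := hb.add hf he'
  have h2 := he.add hf hb'
  have h3 : (fun n s => c n s + d' n s) = fun n s => d n s + c' n s := by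
    ext n s
    have := (hx n s).symm.trans (hx' n s)
    omega
  rw [h3] at h1
  rw [sub_eq_sub_iff_add_eq_add]
  exact hA.isSum_unique hf h1 h2

lemma IsIntSum.add {x y : Sec (piZ ℕ) S} {f : Sec A ℕ∪{∞}} (hf : LightSolid.res A pointInfty f = 0)
    {a a' : Sec A S} (h : IsIntSum x f a) (h' : IsIntSum y f a') : IsIntSum (x + y) f (a + a') := by
  obtain ⟨c, c', b, b', hb, hb', hx, rfl⟩ := h
  obtain ⟨d, d', e, e', he, he', hx', rfl⟩ := h'
  refine ⟨_, _, _, _, hb.add hf he, hb'.add hf he', fun n s => ?_, add_sub_add_comm _ _ _ _ |>.symm⟩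
  rw [coord_add, val_add, hx, hx']
  push_cast
  ring

lemma IsIntSum.res {x : Sec (piZ ℕ) T} {f : Sec A ℕ∪{∞}} {a : Sec A T} (h : IsIntSum x f a)
    (φ : S ⟶ T) : IsIntSum (res _ φ x) f (res A φ a) := by
  obtain ⟨c, c', b, b', hb, hb', hx, rfl⟩ := h
  refine ⟨_, _, _, _, hb.res φ, hb'.res φ, fun n s => ?_, map_sub _ _ _⟩
  rw [coord_res, val_res, hx]

lemma IsIntSum.map {x : Sec (piZ ℕ) S} {f : Sec A ℕ∪{∞}} {a : Sec A S} (h : IsIntSum x f a)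
    (g : A ⟶ B) : IsIntSum x (secMap g _ f) (secMap g _ a) := by
  obtain ⟨c, c', b, b', hb, hb', hx, rfl⟩ := h
  exact ⟨_, _, _, _, hb.map g, hb'.map g, hx, map_sub _ _ _⟩

/-- The universal null sequence of basis vectors in `∏_ℕ ℤ`. -/
def basisSec : Sec (piZ ℕ) ℕ∪{∞} :=
  (exists_coord fun n : ℕ => mkInt (S := ℕ∪{∞}) (fun s => (delta n s : ℤ))
    (continuous_of_discreteTopology.comp (continuous_delta n))).choose

lemma val_coord_basisSec (n : ℕ) (s : OnePoint ℕ) : val (coord n basisSec) s = delta n s :=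
  congrFun (congrArg val ((exists_coord fun n : ℕ => mkInt (S := ℕ∪{∞}) (fun s => (delta n s : ℤ))
    (continuous_of_discreteTopology.comp (continuous_delta n))).choose_spec n)) s

lemma res_pointInfty_basisSec : res (piZ ℕ) pointInfty basisSec = 0 := by
  refine coord_ext fun n => val_injective (funext fun s => ?_)
  rw [coord_res, val_res]
  refine (val_coord_basisSec n _).trans ?_
  rw [delta_neg (by exact OnePoint.infty_ne_coe n)]
  exact (congrFun (congrArg val (map_zero (secMap (Pi.π (fun _ : ℕ => intZ) n) _))) s).symm

/-- The section over `ℕ ∪ {∞}` underlying a morphism from `P`. -/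
def nullVal (g : nullSeq ⟶ A) : Sec A ℕ∪{∞} := freeEquiv _ A (nullSeqπ ≫ g)

lemma nullVal_injective : Function.Injective (nullVal : (nullSeq ⟶ A) → _) := fun g h hgh => by
  have := (freeEquiv _ _).injective hgh
  rwa [cancel_epi] at this

lemma res_pointInfty_nullVal (g : nullSeq ⟶ A) : res A pointInfty (nullVal g) = 0 := by
  unfold nullVal
  rw [← freeEquiv_map', ← Category.assoc, pointInfty_nullSeqπ, zero_comp]
  exact freeEquiv_zero _ _

lemma nullVal_comp (g : nullSeq ⟶ A) (f : A ⟶ B) : nullVal (g ≫ f) = secMap f _ (nullVal g) := by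
  unfold nullVal
  rw [← freeEquiv_comp', Category.assoc]

lemma exists_nullVal (f : Sec A ℕ∪{∞}) (hf : res A pointInfty f = 0) :
    ∃ g : nullSeq ⟶ A, nullVal g = f := by
  refine ⟨nullSeqDesc ((freeEquiv _ _).symm f) ?_, ?_⟩
  · apply (freeEquiv _ _).injective
    rw [freeEquiv_map', Equiv.apply_symm_apply, hf]
    exact (freeEquiv_zero _ _).symm
  · unfold nullVal
    rw [nullSeqπ_desc, Equiv.apply_symm_apply]

/-- The map `P ⟶ ∏_ℕ ℤ` classifying the null sequence of basis vectors. -/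
def basisMap : nullSeq ⟶ piZ ℕ := (exists_nullVal basisSec res_pointInfty_basisSec).choose

lemma nullVal_basisMap : nullVal basisMap = basisSec :=
  (exists_nullVal basisSec res_pointInfty_basisSec).choose_spec

lemma isSolid_piZ (I : Type) : isSolid (piZ I) := isSolid.prop_limit _ fun _ => isSolid_intZ

/-- Every section of `∏_ℕ ℤ` is the sum of the basis vectors multiplied by its coordinates. -/
lemma isIntSum_basisSec (x : Sec (piZ ℕ) S) : IsIntSum x basisSec x := by
  obtain ⟨a, ha⟩ := (isSolid_piZ ℕ).exists_isIntSum x basisSec res_pointInfty_basisSec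
  convert ha
  refine coord_ext fun k => val_injective (funext fun s => ?_)
  obtain ⟨c, c', b, b', hb, hb', hx, rfl⟩ := ha
  -- Projections preserve series, and the `k`-th coordinate of the basis sequence is the indicator
  -- of `k`.
  have key {c : ℕ → S → ℕ} {b : Sec (piZ ℕ) S} (hb : IsSum c basisSec b) :
      val (coord k b) s = c k s := by
    have h1 := hb.map (Pi.π (fun _ : ℕ => intZ) k)
    have h2 := isSum_intZ c hb.1 k (coord k basisSec) (val_coord_basisSec k)
    have h3 := isSolid_intZ.isSum_unique (by
      rw [res_secMap, res_pointInfty_basisSec, map_zero]) h1 h2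
    exact congrFun (congrArg val h3) s
  have h4 : coord k (b - b') = coord k b - coord k b' := map_sub _ _ _
  rw [hx, h4, val_sub, key hb, key hb']

lemma isIntSum_delta (f : Sec A ℕ∪{∞}) (hf : res A pointInfty f = 0) : IsIntSum basisSec f f := by
  refine ⟨_, _, _, _, isSum_delta f hf, isSum_zero f hf, fun n s => ?_, (sub_zero _).symm⟩
  rw [val_coord_basisSec]
  simp

/-- Maps from `∏_ℕ ℤ` to a solid abelian group are the same as null sequences. -/
lemma bijective_basisMap_comp (hA : isSolid A) :
    Function.Bijective (fun g : piZ ℕ ⟶ A => basisMap ≫ g) := by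
  constructor
  · intro g g' h
    -- Morphisms preserve series and `x = ∑ x_n e_n`, so `g x = ∑ x_n g(e_n)` depends only on the
    -- null sequence `g(e_n)`.
    have h1 (g : piZ ℕ ⟶ A) {S : LightProfinite.{0}} (x : Sec (piZ ℕ) S) :
        IsIntSum x (nullVal (basisMap ≫ g)) (secMap g S x) := by
      rw [nullVal_comp, nullVal_basisMap]
      exact (isIntSum_basisSec x).map g
    refine hom_ext_sec fun S x => hA.isIntSum_unique (res_pointInfty_nullVal _) (h1 g x) ?_
    have h2 : basisMap ≫ g = basisMap ≫ g' := h
    rw [h2]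
    exact h1 g' x
  · intro f
    have hf := res_pointInfty_nullVal f
    -- The null sequence `f` extends to `x ↦ ∑ x_n f_n`; uniqueness of sums makes this additive and
    -- natural in `S`.
    let F (S : LightProfinite.{0}) (x : Sec (piZ ℕ) S) : Sec A S :=
      (hA.exists_isIntSum x (nullVal f) hf).choose
    have hF (S : LightProfinite.{0}) (x : Sec (piZ ℕ) S) : IsIntSum x (nullVal f) (F S x) :=
      (hA.exists_isIntSum x (nullVal f) hf).choose_spec
    let g : piZ ℕ ⟶ A := homOfSec
      (fun S => AddMonoidHom.mk' (F S) fun x y =>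
        hA.isIntSum_unique hf (hF S (x + y)) ((hF S x).add hf (hF S y)))
      (fun φ x => hA.isIntSum_unique hf ((hF _ x).res φ) (hF _ _))
    refine ⟨g, nullVal_injective ?_⟩
    rw [nullVal_comp, nullVal_basisMap]
    exact hA.isIntSum_unique hf (hF _ _) (isIntSum_delta _ hf)

lemma solidEquivalences_basisMap : solidEquivalences basisMap :=
  (solidEquivalences_iff _).2 fun _ hA => bijective_basisMap_comp hA

end

/-! ### Compactness and projectivity of `∏_ℕ ℤ` -/

section

instance : HasColimitsOfSize.{0, 0} LightCondAb := IsGrothendieckAbelian.hasColimits.{0} LightCondAb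

instance : Reflective isSolid.ι := ⟨solidification, solidificationAdj⟩

instance : HasColimitsOfSize.{0, 0} Solid := hasColimits_of_reflective isSolid.ι

instance : PreservesFiniteColimits isSolid.ι where
  preservesFiniteColimits _ _ _ := inferInstance

lemma isCardinalPresentable_of_solidMaps {X Y : LightCondAb} (f : X ⟶ Y) (hf : solidMaps f) :
    IsCardinalPresentable X Cardinal.aleph0.{0} ∧ IsCardinalPresentable Y Cardinal.aleph0.{0} := by
  obtain ⟨S⟩ := hf
  constructor <;> infer_instance

instance : isSolid.ι.IsCardinalAccessible Cardinal.aleph0.{0} := by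
  rw [isSolid_eq_isLocal]
  exact MorphismProperty.isCardinalAccessible_ι_isLocal _ _
    fun _ _ f hf => isCardinalPresentable_of_solidMaps f hf

instance : IsCardinalPresentable nullSeq Cardinal.aleph0.{0} :=
  Retract.isCardinalPresentable nullSeqRetract _

instance : IsIso (solidification.map basisMap) := solidEquivalences_basisMap

/-- A solid abelian group is its own solidification. -/
def counitIso (M : Solid) : solidification.obj M.obj ≅ M :=
  (asIso solidificationAdj.counit).app M

/-- The solidification of `P` is `∏_ℕ ℤ`. -/
def solidificationNullSeqIso : solidification.obj nullSeq ≅ prodZ :=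
  asIso (solidification.map basisMap) ≪≫ counitIso prodZ

/-- The inclusion of solid groups preserves filtered colimits, so solidification preserves compact
objects, and `P` is compact as a summand of `ℤ[ℕ ∪ {∞}]`. -/
instance : IsCardinalPresentable prodZ Cardinal.aleph0.{0} :=
  have := solidificationAdj.isCardinalPresentable_leftAdjoint_obj Cardinal.aleph0.{0} nullSeq
  isCardinalPresentable_of_iso solidificationNullSeqIso _

/-- An epimorphism is surjective on sections after passing to a cover, and a cover of a point has a
section. -/
lemma exists_secMap_of_epi {A B : LightCondAb} (f : A ⟶ B) [Epi f]
    {T : LightProfinite.{0}} [Subsingleton T] (t : T) (y : Sec B T) : ∃ x, secMap f T x = y := by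
  obtain ⟨S, φ, hφ, x, hx⟩ :=
    (LightCondMod.epi_iff_locallySurjective_on_lightProfinite ℤ f).1 inferInstance _ y
  obtain ⟨s, -⟩ := hφ t
  let i : T ⟶ S := mkHom (fun _ => s) continuous_const
  refine ⟨res A i x, ?_⟩
  have h : secMap f S x = res B φ y := hx
  have hi : i ≫ φ = 𝟙 T := hom_ext_point fun _ => Subsingleton.elim _ _
  rw [← res_secMap, h, res_res, hi, res_id]

instance : Subsingleton (𝟙_ LightProfinite.{0} : LightProfinite.{0}) :=
  inferInstanceAs (Subsingleton PUnit)

/-- Internal projectivity makes the map of internal Homs an epimorphism. Its sections over the point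
are the morphisms out of `P`, and over the point an epimorphism is surjective. -/
instance : Projective nullSeq where
  factors {E X} f e _ := by
    have : Epi ((ihom nullSeq).map e) := inferInstance
    let T := 𝟙_ LightProfinite.{0}
    let ρ : nullSeq ⊗ freeAb.obj T ≅ nullSeq :=
      whiskerLeftIso nullSeq (Functor.Monoidal.εIso freeAb).symm ≪≫ ρ_ nullSeq
    obtain ⟨x, hx⟩ := exists_secMap_of_epi ((ihom nullSeq).map e) (T := T) PUnit.unit (freeEquiv T _
      (MonoidalClosed.curry (ρ.hom ≫ f)))
    obtain ⟨g, rfl⟩ := (freeEquiv T _).surjective x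
    rw [← freeEquiv_comp'] at hx
    have h := (freeEquiv T _).injective hx
    refine ⟨ρ.inv ≫ MonoidalClosed.uncurry g, ?_⟩
    rw [Category.assoc, Iso.inv_comp_eq, ← MonoidalClosed.uncurry_natural_right, h,
      MonoidalClosed.uncurry_curry]

instance : Projective prodZ :=
  have := solidificationAdj.map_projective nullSeq inferInstance
  Projective.of_iso solidificationNullSeqIso this

end

/-! ### The group `ℤ` and sections over a point -/

section

section Unit

variable {B : LightCondAb}

/-- The one-point light profinite set. -/
abbrev pt : LightProfinite.{0} := LightProfinite.of PUnit.{1}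

/-- The section `1` of `ℤ`. -/
def oneSec : Sec intZ pt := mkInt (fun _ => 1) continuous_const

/-- The discrete group `ℤ` classifies the sections over a point. -/
lemma bijective_secMap_oneSec :
    Function.Bijective (fun v : intZ ⟶ B => secMap v pt oneSec) := by
  let adj := LightCondMod.LocallyConstant.adjunction ℤ
  let ζ : Sec intZ pt := adj.unit.app (ModuleCat.of ℤ ℤ) (1 : ℤ)
  have : IsIso (adj.unit.app (ModuleCat.of ℤ ℤ)) := inferInstance
  have hb := (ConcreteCategory.isIso_iff_bijective (adj.unit.app (ModuleCat.of ℤ ℤ))).1 this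
  -- The adjunction gives the claim for the image `ζ` of `1` under the unit. To avoid computing `ζ`,
  -- it is only shown to differ from the section `1` by an invertible integer: evaluate `k • ζ = 1`
  -- at the point.
  obtain ⟨k, hk⟩ : ∃ k : ℤ, adj.unit.app (ModuleCat.of ℤ ℤ) k = oneSec := hb.2 oneSec
  have hk2 : k • ζ = oneSec := by
    rw [← hk]
    refine (map_zsmul (adj.unit.app (ModuleCat.of ℤ ℤ)).hom.toAddMonoidHom k (1 : ℤ)).symm.trans ?_
    exact congrArg (adj.unit.app (ModuleCat.of ℤ ℤ)) (mul_one k)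
  have hu : IsUnit k := by
    refine IsUnit.of_mul_eq_one (val ζ PUnit.unit) ?_
    exact congrFun (congrArg val hk2) PUnit.unit
  have h1 (v : intZ ⟶ B) : adj.homEquiv (ModuleCat.of ℤ ℤ) B v (1 : ℤ) = secMap v pt ζ :=
    (congrArg (fun φ : ModuleCat.of ℤ ℤ ⟶ (LightCondensed.underlying (ModuleCat ℤ)).obj B =>
      φ (1 : ℤ)) (adj.homEquiv_unit (X := ModuleCat.of ℤ ℤ) (f := v))).trans rfl
  have hz : Function.Bijective (fun v : intZ ⟶ B => secMap v pt ζ) := by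
    have : (fun v : intZ ⟶ B => secMap v pt ζ) =
        (fun φ : ModuleCat.of ℤ ℤ ⟶ (LightCondensed.underlying (ModuleCat ℤ)).obj B =>
          φ (1 : ℤ)) ∘
          adj.homEquiv (ModuleCat.of ℤ ℤ) B := by
      ext1 v
      exact (h1 v).symm
    rw [this]
    refine Function.Bijective.comp ⟨fun φ ψ h => ?_, fun b => ?_⟩ (Equiv.bijective _)
    · ext
      exact h
    · exact ⟨ModuleCat.ofHom (LinearMap.toSpanSingleton ℤ _ b),
        LinearMap.toSpanSingleton_apply_one ℤ _ b⟩
  have h2 : (fun v : intZ ⟶ B => secMap v pt oneSec) =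
      (fun b : Sec B pt => k • b) ∘ fun v : intZ ⟶ B => secMap v pt ζ := by
    ext1 v
    rw [← hk2]
    exact map_zsmul (secMap v pt) k ζ
  rw [h2]
  refine Function.Bijective.comp ?_ hz
  rcases Int.isUnit_iff.1 hu with rfl | rfl
  · simp only [one_smul]
    exact Function.bijective_id
  · simpa using neg_bijective (G := Sec B pt)

/-- The unit section gives an isomorphism `ℤ[*] ≅ ℤ`. -/
def freePtToInt : freeAb.obj pt ⟶ intZ := (freeEquiv pt intZ).symm oneSec

/-- Both objects corepresent sections over a point. -/
instance : IsIso freePtToInt := by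
  refine (isIso_iff_coyoneda_map_bijective _).2 fun B => ?_
  have h : (fun v : intZ ⟶ B => secMap v pt oneSec) =
      freeEquiv pt B ∘ fun v => freePtToInt ≫ v := by
    ext1 v
    refine Eq.trans ?_ (freeEquiv_comp' _ _).symm
    rw [freePtToInt, Equiv.apply_symm_apply]
  have h2 := bijective_secMap_oneSec (B := B)
  rw [h] at h2
  exact (Function.Bijective.of_comp_iff' (Equiv.bijective _) _).1 h2

/-- The section of `ℤ` over `ℕ ∪ {∞}` which is `1` at `n` and `0` elsewhere. -/
def deltaSec (n : ℕ) : Sec intZ ℕ∪{∞} := mkInt (fun s => (delta n s : ℤ))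
    (continuous_of_discreteTopology.comp (continuous_delta n))

lemma res_pointInfty_deltaSec (n : ℕ) : res intZ pointInfty (deltaSec n) = 0 := by
  refine val_injective (funext fun s => ?_)
  change ((delta n (OnePoint.infty : OnePoint ℕ) : ℕ) : ℤ) = 0
  rw [delta_neg (OnePoint.infty_ne_coe n)]
  rfl

/-- The inclusion of a point. -/
def ptMap {S : LightProfinite.{0}} (s : S) : pt ⟶ S := mkHom (fun _ => s) continuous_const

/-- The null sequence `(b, 0, 0, …)` is the image of `(1, 0, 0, …)` under the map `ℤ ⟶ B` attached
to `b`. -/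
lemma eq_zero_of_pt (h : ∀ f : Sec B ℕ∪{∞}, res B pointInfty f = 0 → f = 0) (b : Sec B pt) :
    b = 0 := by
  obtain ⟨v, rfl⟩ := bijective_secMap_oneSec.2 b
  have h1 := h (secMap v _ (deltaSec 0)) (by
    rw [res_secMap, res_pointInfty_deltaSec, map_zero])
  have h2 : res intZ (ptMap (S := ℕ∪{∞}) (OnePoint.some 0 : OnePoint ℕ)) (deltaSec 0) = oneSec :=
    val_injective (funext fun s => congrArg Nat.cast (delta_pos 0))
  change secMap v pt oneSec = 0
  rw [← h2, ← res_secMap, h1, map_zero]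

end Unit

/-! ### A solid group without null sequences is zero -/

section Generator

variable {A : LightCondAb} {S : LightProfinite.{0}}

/-- The empty family covers the empty set. -/
lemma sec_eq_zero_of_isEmpty [IsEmpty S] (a : Sec A S) : a = 0 := by
  have hs : Presieve.IsSheaf (coherentTopology LightProfinite.{0})
      (A.obj ⋙ CategoryTheory.forget _) :=
    (isSheaf_iff_isSheaf_of_type _ _).1 ((LightCondensed.forget ℤ).obj A).property
  let W : Empty → LightProfinite.{0} := fun _ => S
  let r : ∀ i, W i ⟶ S := fun _ => 𝟙 S
  have hr : EffectiveEpiFamily W r := by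
    rw [← effectiveEpi_desc_iff_effectiveEpiFamily, LightProfinite.effectiveEpi_iff_surjective]
    intro t
    exact isEmptyElim t
  have h3 : Presieve.IsSheafFor (A.obj ⋙ CategoryTheory.forget _) (Presieve.ofArrows W r) := by
    rw [Presieve.isSheafFor_iff_generate]
    exact hs _ ((coherentTopology.mem_sieves_iff_hasEffectiveEpiFamily _).2
      ⟨Empty, inferInstance, W, r, hr, fun i => i.elim⟩)
  refine h3.isSeparatedFor.ext ?_
  rintro _ _ ⟨⟨⟩⟩

/-- If `A` has no null sequences, then it has no sections over `X ∪ {∞}` vanishing at `∞` for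
countable discrete `X`. -/
lemma eq_zero_of_null (h : ∀ f : Sec A ℕ∪{∞}, res A pointInfty f = 0 → f = 0)
    {X : Type} [TopologicalSpace X] [DiscreteTopology X] [Countable X]
    (f : Sec A (LightProfinite.of (OnePoint X))) (hf : res A (ptMap (S := LightProfinite.of (OnePoint X))
      (OnePoint.infty : OnePoint X)) f = 0) : f = 0 := by
  classical
  -- An injection of `X` into `ℕ` makes `OnePoint X` a retract of `ℕ ∪ {∞}`: points outside the
  -- image are sent to `∞`.
  obtain ⟨e, he⟩ := exists_injective_nat X
  let i : LightProfinite.of (OnePoint X) ⟶ ℕ∪{∞} := mkHom (OnePoint.map e) (by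
    refine continuous_onePoint fun n => ?_
    by_cases hn : ∃ x, e x = n
    · obtain ⟨x, rfl⟩ := hn
      convert isClopen_singleton_coe x using 1
      ext y
      induction y using OnePoint.rec with
      | infty => simp
      | coe y => simp [he.eq_iff]
    · convert isClopen_empty using 1
      ext y
      induction y using OnePoint.rec with
      | infty => simp
      | coe y => simpa using fun h => hn ⟨y, h⟩)
  let rf : OnePoint ℕ → OnePoint X := fun n => match n with
    | OnePoint.infty => OnePoint.infty
    | OnePoint.some n => if hn : ∃ x, e x = n then (hn.choose : OnePoint X) else OnePoint.infty
  have hrf (x : X) : rf (e x) = x := by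
    have hx : ∃ y, e y = e x := ⟨x, rfl⟩
    refine (dif_pos hx).trans ?_
    exact congrArg _ (he hx.choose_spec)
  let r : ℕ∪{∞} ⟶ LightProfinite.of (OnePoint X) := mkHom rf (by
    refine continuous_onePoint fun x => ?_
    convert isClopen_singleton_coe (e x) using 1
    ext n
    constructor
    · intro h
      induction n using OnePoint.rec with
      | infty => exact absurd h (OnePoint.infty_ne_coe x)
      | coe n =>
        by_cases hn : ∃ x, e x = n
        · obtain ⟨y, rfl⟩ := hn
          have h' : (y : OnePoint X) = x := (hrf y).symm.trans h
          rw [OnePoint.coe_injective h']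
          rfl
        · exact absurd ((dif_neg hn).symm.trans h) (OnePoint.infty_ne_coe x)
    · rintro rfl
      exact hrf x)
  have h1 : i ≫ r = 𝟙 _ := by
    refine hom_ext_point fun y => ?_
    induction y using OnePoint.rec with
    | infty => rfl
    | coe x => exact hrf x
  have h2 : pointInfty ≫ r = ptMap (S := LightProfinite.of (OnePoint X))
      (OnePoint.infty : OnePoint X) := rfl
  have h3 := h (res A r f) (by rw [res_res, h2, hf])
  rw [← res_id f, ← h1, ← res_res, h3, map_zero]

/-- A sequence of retractions onto finite subsets exhausting `S`. -/
lemma exists_finite_retractions (S : LightProfinite.{0}) [Nonempty S] : ∃ ρ : ℕ → S → S,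
    (∀ n, Continuous (ρ n)) ∧ (∀ n, (Set.range (ρ n)).Finite) ∧
    (∀ n s, ρ n (ρ n s) = ρ n s) ∧ (∀ n s, ρ n (ρ (n + 1) s) = ρ n s) ∧
    (∃ s₀, ∀ s, ρ 0 s = s₀) ∧
    Continuous (fun x : OnePoint ℕ × S => (x.1.elim x.2 fun n => ρ n x.2 : S)) := by
  -- A section of the projection to the `n`-th finite quotient gives the retraction with index `n +
  -- 1`; index `0` is reserved for a constant map.
  let σ (n : ℕ) : S.component n → S := fun i => (S.proj_surjective n i).choose
  have hσ (n : ℕ) (i : S.component n) : S.proj n (σ n i) = i := (S.proj_surjective n i).choose_spec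
  have hd (n : ℕ) : DiscreteTopology (S.component n) := ⟨rfl⟩
  have hfin (n : ℕ) : Finite (S.component n) :=
    inferInstanceAs (Finite (S.fintypeDiagram.obj ⟨n⟩))
  have hle {n m : ℕ} (h : n ≤ m) (s : S) : S.proj n (σ m (S.proj m s)) = S.proj n s := by
    have h1 (t : S) : S.proj n t = S.transitionMapLE h (S.proj m t) :=
      (congrFun (S.proj_comp_transitionMapLE' h) t).symm
    rw [h1, h1, hσ]
  let F : S → ∀ n, S.component n := fun s n => S.proj n s
  have hind : Topology.IsInducing F := by
    have hc : Continuous F := continuous_pi fun n =>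
      continuous_hom (T := S.component n) (S.proj n)
    refine (hc.isClosedEmbedding fun s t h => ?_).isInducing
    have : ptMap s = ptMap t := S.asLimit.hom_ext fun ⟨n⟩ => hom_ext_point fun _ => congrFun h n
    exact ConcreteCategory.congr_hom this PUnit.unit
  obtain ⟨s₀⟩ := ‹Nonempty S›
  let ρ : ℕ → S → S := fun n => match n with
    | 0 => fun _ => s₀
    | n + 1 => fun s => σ n (S.proj n s)
  have hρ : ∀ n, Continuous (ρ n) := by
    rintro (_ | n)
    · exact continuous_const
    · exact Continuous.comp (g := σ n) continuous_of_discreteTopology (continuous_hom (S.proj n))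
  refine ⟨ρ, hρ, ?_, ?_, ?_, ⟨s₀, fun _ => rfl⟩, ?_⟩
  · rintro (_ | n)
    · exact (Set.finite_singleton s₀).subset (by rintro _ ⟨s, rfl⟩; rfl)
    · exact (Set.finite_range (σ n)).subset (by rintro _ ⟨s, rfl⟩; exact ⟨_, rfl⟩)
  · rintro (_ | n) s
    · rfl
    · exact congrArg (σ n) (hσ n _)
  · rintro (_ | n) s
    · rfl
    · exact congrArg (σ n) (hle (Nat.le_succ n) s)
  -- The topology of `S` is induced by its finite quotients. The `m`-th projection does not see `ρ
  -- n` once `n ≥ m + 1`, so near `∞` the map to that quotient depends only on the second variable.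
  · refine hind.continuous_iff.2 (continuous_pi fun m => continuous_iff_continuousAt.2 ?_)
    rintro ⟨x, s⟩
    induction x using OnePoint.rec with
    | infty =>
      have hx : {y : OnePoint ℕ | ∀ n : ℕ, y = n → m + 1 ≤ n} ∈ nhds (OnePoint.infty : OnePoint ℕ) := by
        have : {y : OnePoint ℕ | ∀ n : ℕ, y = n → m + 1 ≤ n} =
            (⋃ n ∈ Finset.range (m + 1), {(OnePoint.some n : OnePoint ℕ)})ᶜ := by
          ext y
          induction y using OnePoint.rec with
          | infty => simp
          | coe x =>
            simp only [Set.mem_ofPred_eq, Set.mem_compl_iff, Set.mem_iUnion, Finset.mem_range,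
              Set.mem_singleton_iff, OnePoint.coe_eq_coe, exists_prop, not_exists, not_and]
            grind
        rw [this]
        refine IsOpen.mem_nhds (isOpen_compl_iff.2 ?_) (by simp)
        exact isClosed_biUnion_finset fun n _ => isClosed_singleton
      refine (((continuous_hom (S.proj m)).comp continuous_snd).continuousAt
        (x := ((OnePoint.infty : OnePoint ℕ), s))).congr ?_
      filter_upwards [prod_mem_nhds hx Filter.univ_mem] with ⟨y, t⟩ ⟨hy, _⟩
      induction y using OnePoint.rec with
      | infty => rfl
      | coe n =>
        obtain ⟨k, rfl⟩ := Nat.exists_eq_add_of_le' (hy n rfl)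
        exact (hle (Nat.le_add_left m k) t).symm
    | coe n =>
      have hx : ({OnePoint.some n} : Set (OnePoint ℕ)) ∈ nhds (OnePoint.some n) :=
        (isClopen_singleton_coe n).isOpen.mem_nhds rfl
      have hc : Continuous fun y : OnePoint ℕ × S => F (ρ n y.2) m :=
        (continuous_hom (S.proj m)).comp ((hρ n).comp continuous_snd)
      refine (hc.continuousAt (x := ((OnePoint.some n : OnePoint ℕ), s))).congr ?_
      filter_upwards [prod_mem_nhds hx Filter.univ_mem] with ⟨y, t⟩ ⟨hy, _⟩
      obtain rfl : y = OnePoint.some n := hy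
      rfl

/-- A solid abelian group without null sequences is zero. -/
lemma isSolid.eq_zero_of_null (hA : isSolid A)
    (h : ∀ f : Sec A ℕ∪{∞}, res A pointInfty f = 0 → f = 0) (a : Sec A S) : a = 0 := by
  rcases isEmpty_or_nonempty S with hS | hS
  · exact sec_eq_zero_of_isEmpty a
  obtain ⟨ρ, hρ, hfin, hid, hsucc, ⟨s₀, hs₀⟩, hc⟩ := exists_finite_retractions S
  let r : smash ℕ S ⟶ S := mkHom _ hc
  let pr : smash ℕ S ⟶ S := mkHom (fun x => x.2) continuous_snd
  -- `d_n = a ∘ ρ_n - a` is a null sequence over `S`, because `ρ_n` tends to the identity.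
  let d := res A r a - res A pr a
  have hd0 : res A (inf ℕ S) d = 0 := by
    rw [map_sub, res_res, res_res, sub_eq_zero]
    rfl
  let X : Type := Σ n : ℕ, Set.range (ρ (n + 1))
  have (n : ℕ) : Countable (Set.range (ρ (n + 1))) := (hfin (n + 1)).countable
  let _ : TopologicalSpace X := ⊥
  have : DiscreteTopology X := ⟨rfl⟩
  let r' : smash ℕ S ⟶ smash ℕ S := mkHom
    (fun x => (x.1, x.1.elim x.2 fun n => ρ (n + 1) x.2)) (continuous_fst.prodMk (by
      refine (continuous_hom (smashShift S ≫ r)).congr ?_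
      rintro ⟨y, s⟩
      induction y using OnePoint.rec <;> rfl))
  let W : Set (smash ℕ S) := {w | r' w = w}
  have hW : IsClosed W := isClosed_eq (continuous_hom r') continuous_id
  have := isCompact_iff_compactSpace.1 hW.isCompact
  let ι : LightProfinite.of W ⟶ smash ℕ S := mkHom (fun w => w.1) continuous_subtype_val
  let q : smash ℕ S ⟶ LightProfinite.of W := mkHom (fun x => ⟨r' x, show r' (r' x) = r' x by
    obtain ⟨y, s⟩ := x
    induction y using OnePoint.rec with
    | infty => rfl
    | coe n => exact Prod.ext rfl (hid (n + 1) s)⟩) ((continuous_hom r').subtype_mk _)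
  -- `g_n = a ∘ ρ_n - a ∘ ρ_{n+1}` depends at `s` only on `ρ_{n+1} s`. So `g` is determined by its
  -- restriction to the closed set `W` of pairs with `s` fixed by `ρ_{n+1}`, and as it vanishes on
  -- `{∞} × S` it descends from `W` to the compactification of the countable disjoint union `X` of
  -- the finite images.
  let g : Sec A (smash ℕ S) := d - res A (smashShift S) d
  let j : S ⟶ LightProfinite.of W := inf ℕ S ≫ q
  let f₀ : W → OnePoint X := fun w => w.1.1.elim OnePoint.infty fun n =>
    ((⟨n, ⟨ρ (n + 1) w.1.2, ⟨_, rfl⟩⟩⟩ : X) : OnePoint X)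
  have hf₀ : Continuous f₀ := by
    refine continuous_onePoint ?_
    rintro ⟨n, i, hi⟩
    have h1 : IsClopen {s | ρ (n + 1) s = i} := by
      refine ⟨isClosed_singleton.preimage (hρ (n + 1)), ?_⟩
      convert ((hfin (n + 1)).subset (Set.sdiff_subset (t := {i}))).isClosed.isOpen_compl.preimage
        (hρ (n + 1))
      ext s
      simp
    convert ((isClopen_singleton_coe n).prod h1).preimage (continuous_hom ι) using 1
    ext ⟨⟨y, s⟩, hw⟩
    induction y using OnePoint.rec with
    | infty => exact iff_of_false (fun h => OnePoint.infty_ne_coe _ h) fun h => OnePoint.infty_ne_coe _ h.1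
    | coe m =>
      constructor
      · intro h
        have h' : (⟨m, ⟨ρ (m + 1) s, ⟨_, rfl⟩⟩⟩ : X) = ⟨n, ⟨i, hi⟩⟩ := OnePoint.coe_injective h
        obtain ⟨rfl, h2⟩ := Sigma.mk.inj h'
        exact ⟨rfl, congrArg Subtype.val (eq_of_heq h2)⟩
      · rintro ⟨h2, h3⟩
        obtain rfl : m = n := OnePoint.coe_injective h2
        obtain rfl : ρ (m + 1) s = i := h3
        rfl
  let f : LightProfinite.of W ⟶ LightProfinite.of (OnePoint X) := mkHom f₀ hf₀
  have hf : Function.Surjective f := by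
    intro y
    induction y using OnePoint.rec with
    | infty => exact ⟨j s₀, rfl⟩
    | coe x =>
      obtain ⟨n, ⟨_, ⟨s, rfl⟩⟩⟩ := x
      refine ⟨⟨((n : OnePoint ℕ), ρ (n + 1) s), Prod.ext rfl (hid _ _)⟩, ?_⟩
      refine congrArg (OnePoint.some : X → OnePoint X) ?_
      exact congrArg (Sigma.mk n) (Subtype.ext (hid (n + 1) s))
  have hg' : g = res A r a - res A (smashShift S ≫ r) a := by
    have h1 : smashShift S ≫ pr = pr := rfl
    change (res A r a - res A pr a) - res A (smashShift S) (res A r a - res A pr a) = _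
    rw [map_sub, res_res, res_res, h1]
    abel
  have hg : res A q (res A ι g) = g := by
    have h1 : q ≫ ι ≫ r = r := smash_hom_ext (fun _ => rfl) fun n s => hsucc n s
    have h2 : q ≫ ι ≫ smashShift S ≫ r = smashShift S ≫ r :=
      smash_hom_ext (fun _ => rfl) fun n s => hid (n + 1) s
    rw [hg', map_sub, map_sub, res_res, res_res, res_res, res_res, Category.assoc,
      Category.assoc, h1, h2]
  have hg0 : res A (inf ℕ S) g = 0 := by
    rw [map_sub, hd0, res_res]
    change 0 - res A (inf ℕ S) d = 0
    rw [hd0, sub_zero]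
  obtain ⟨x, hx⟩ := exists_res_eq f hf j (by
    rintro ⟨⟨y, s⟩, hw⟩ ⟨⟨y', s'⟩, hw'⟩ hy
    induction y using OnePoint.rec with
    | infty =>
      induction y' using OnePoint.rec with
      | infty => exact Or.inr ⟨⟨s, rfl⟩, ⟨s', rfl⟩⟩
      | coe n' => exact absurd hy (OnePoint.infty_ne_coe _)
    | coe n =>
      induction y' using OnePoint.rec with
      | infty => exact absurd hy (OnePoint.coe_ne_infty _)
      | coe n' =>
        have h1 : (⟨n, ⟨ρ (n + 1) s, ⟨_, rfl⟩⟩⟩ : X) = ⟨n', ⟨ρ (n' + 1) s', ⟨_, rfl⟩⟩⟩ :=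
          OnePoint.coe_injective hy
        obtain ⟨rfl, h2⟩ := Sigma.mk.inj h1
        left
        have h3 : s = s' := (congrArg Prod.snd hw).symm.trans
          ((congrArg Subtype.val (eq_of_heq h2)).trans (congrArg Prod.snd hw'))
        exact Subtype.ext (Prod.ext rfl h3)) (res A ι g) (by
    rw [res_res]
    exact hg0)
  have hx0 : x = 0 := LightSolid.eq_zero_of_null h x (by
    have h1 : ptMap (S := LightProfinite.of (OnePoint X)) (OnePoint.infty : OnePoint X) =
      ptMap s₀ ≫ j ≫ f := rfl
    have h2 : res A j (res A ι g) = 0 := by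
      rw [res_res]
      exact hg0
    rw [h1, ← res_res, ← res_res, hx, h2, map_zero])
  -- Now `d` is fixed by the shift and hence zero. At `n = 0` this says `a = a ∘ ρ_0`, so `a` is
  -- pulled back from a point.
  have hd : d = 0 := by
    refine hA.eq_zero_of_eq_shift hd0 (sub_eq_zero.1 ?_).symm
    change g = 0
    rw [← hg, ← hx, hx0, map_zero, map_zero]
  have h1 : sliceAt (OnePoint.some 0) S ≫ r = mkHom (fun _ => PUnit.unit) continuous_const ≫ ptMap s₀ :=
    hom_ext_point hs₀
  have h2 : sliceAt (OnePoint.some 0) S ≫ pr = 𝟙 S := rfl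
  rw [← res_id a, ← h2, ← res_res, ← sub_eq_zero.1 hd, res_res, h1, ← res_res,
    eq_zero_of_pt h (res A (ptMap s₀) a), map_zero]

end Generator

end

/-! ### `∏_ℕ ℤ` is a strong generator -/

section

lemma isZero_of_hom_prodZ (A : Solid) (h : ∀ f : prodZ ⟶ A, f = 0) : IsZero A := by
  have h0 (f : Sec A.obj ℕ∪{∞}) (hf : res A.obj pointInfty f = 0) : f = 0 := by
    obtain ⟨g, rfl⟩ := exists_nullVal f hf
    obtain ⟨k, rfl⟩ := (bijective_basisMap_comp A.property).2 g
    have hk : k = 0 := congrArg (fun z => z.hom) (h (ObjectProperty.homMk k))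
    subst hk
    change freeEquiv _ _ (nullSeqπ ≫ basisMap ≫ 0) = 0
    rw [comp_zero, comp_zero, freeEquiv_zero]
  rw [IsZero.iff_id_eq_zero]
  apply ObjectProperty.hom_ext
  refine hom_ext_sec fun S x => ?_
  rw [A.property.eq_zero_of_null h0 x, map_zero, map_zero]

/-- By projectivity, maps from `∏_ℕ ℤ` to the image of `f`, or to the cokernel of `i`, lift to the
source of `f`, respectively the target of `i`. The hypotheses make them vanish, so the image or the
cokernel is zero. -/
lemma isStrongGenerator_prodZ : (ObjectProperty.singleton prodZ).IsStrongGenerator := by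
  rw [ObjectProperty.isStrongGenerator_iff]
  constructor
  · change IsSeparator prodZ
    rw [Preadditive.isSeparator_iff]
    intro A B f hf
    have h1 : IsZero (Abelian.image f) := isZero_of_hom_prodZ _ fun g => by
      rw [← cancel_mono (Abelian.image.ι f), zero_comp,
        ← Projective.factorThru_comp g (Abelian.factorThruImage f), Category.assoc,
        Abelian.image.fac, hf]
    rw [← Abelian.image.fac f, h1.eq_zero_of_tgt (Abelian.factorThruImage f), zero_comp]
  · intro A B i _ hi
    have h1 : IsZero (cokernel i) := isZero_of_hom_prodZ _ fun g => by
      obtain ⟨k, hk⟩ := hi prodZ (by simp) (Projective.factorThru g (cokernel.π i))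
      rw [← Projective.factorThru_comp g (cokernel.π i), ← hk]
      simp
    have : Epi i := Preadditive.epi_of_isZero_cokernel i h1
    exact isIso_of_mono_of_epi i

lemma singleton_prodZ_le : ObjectProperty.singleton prodZ ≤
    isCardinalPresentable Solid Cardinal.aleph0.{0} := by
  simp only [ObjectProperty.singleton_le_iff]
  exact inferInstanceAs (IsCardinalPresentable prodZ Cardinal.aleph0.{0})

end

/-! ### Finitely presented objects over a coherent projective -/

section

section Coherent

universe u v

variable {C : Type u} [Category.{v} C] [Abelian C]

/-- `X` is a projective object with `X ⊞ X ≅ X`, and every endomorphism of `X` factors as a split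
epimorphism onto a direct summand of `X`, followed by a monomorphism. -/
structure IsCoherentProjective (X : C) : Prop where
  projective : Projective X
  sum : Nonempty (X ≅ X ⊞ X)
  factor (f : X ⟶ X) : ∃ (Y : C) (p : X ⟶ Y) (s : Y ⟶ X) (i : Y ⟶ X),
    s ≫ p = 𝟙 Y ∧ Mono i ∧ p ≫ i = f ∧ Nonempty (X ≅ Y ⊞ X)

variable {X : C}

/-- `M` has a presentation by `X`. -/
def IsPresentedBy (X M : C) : Prop :=
  ∃ (k e : _) (w : (k : X ⟶ X) ≫ (e : X ⟶ M) = 0), (ShortComplex.mk k e w).Exact ∧ Epi e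

lemma IsPresentedBy.of_exact {M : C} {L : C} (l : L ⟶ X) (e : X ⟶ M) (w : l ≫ e = 0)
    (h : (ShortComplex.mk l e w).Exact) [Epi e] (a : X ⟶ L) [Epi a] : IsPresentedBy X M := by
  refine ⟨a ≫ l, e, by simp [w], ?_, inferInstance⟩
  rw [ShortComplex.exact_iff_exact_up_to_refinements]
  intro A x hx
  obtain ⟨A₁, q₁, _, z, hz⟩ := h.exact_up_to_refinements x hx
  obtain ⟨A₂, q₂, _, y, hy⟩ := surjective_up_to_refinements_of_epi a z
  exact ⟨A₂, q₂ ≫ q₁, inferInstance, y, by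
    have hz' : q₁ ≫ x = z ≫ l := hz
    simp [hz', reassoc_of% hy]⟩

namespace IsCoherentProjective

variable (hX : IsCoherentProjective X)
include hX

/-- The kernel of `p ≫ i` with `i` monic is that of the split epimorphism `p`, which is the image of
the idempotent `1 - p ≫ s`. -/
lemma exists_kernel (f : X ⟶ X) :
    ∃ (k : X ⟶ X) (w : k ≫ f = 0), (ShortComplex.mk k f w).Exact := by
  obtain ⟨Y, p, s, i, hs, hi, rfl, -⟩ := hX.factor f
  refine ⟨𝟙 X - p ≫ s, ?_, ?_⟩
  · simp [Preadditive.sub_comp, reassoc_of% hs]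
  · rw [ShortComplex.exact_iff_exact_up_to_refinements]
    intro A x hx
    have h1 : x ≫ p = 0 := by
      rw [← cancel_mono i, Category.assoc, zero_comp]
      exact hx
    refine ⟨A, 𝟙 A, inferInstance, x, ?_⟩
    simp [Preadditive.comp_sub, reassoc_of% h1]

/-- Lift `g` to `g'` with values in `X`. An element `x` is killed by `g` exactly when, locally, some
`z` has `g' x = f z`, so the kernel of `g` is the first projection of the kernel of `(g', -f)` on `X
⊞ X ≅ X`. -/
lemma exists_kernel_of_isPresentedBy {M : C} (hM : IsPresentedBy X M) (g : X ⟶ M) :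
    ∃ (k : X ⟶ X) (w : k ≫ g = 0), (ShortComplex.mk k g w).Exact := by
  have := hX.projective
  obtain ⟨f, π, w, hf, _⟩ := hM
  obtain ⟨e⟩ := hX.sum
  obtain ⟨k, hk, hk'⟩ := hX.exists_kernel (e.hom ≫ biprod.desc (Projective.factorThru g π) (-f))
  have h1 : (k ≫ e.hom ≫ biprod.fst) ≫ Projective.factorThru g π =
      (k ≫ e.hom ≫ biprod.snd) ≫ f := by
    rw [← sub_eq_zero]
    refine Eq.trans ?_ hk
    simp [biprod.desc_eq, Preadditive.comp_add, sub_eq_add_neg]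
  refine ⟨k ≫ e.hom ≫ biprod.fst, ?_, ?_⟩
  · rw [← Projective.factorThru_comp g π, ← Category.assoc, h1, Category.assoc, w, comp_zero]
  · rw [ShortComplex.exact_iff_exact_up_to_refinements]
    intro A x hx
    obtain ⟨A₁, q₁, _, z, hz⟩ := hf.exact_up_to_refinements (x ≫ Projective.factorThru g π)
      (by
        have hx' : x ≫ g = 0 := hx
        simpa using hx')
    obtain ⟨A₂, q₂, _, y, hy⟩ := hk'.exact_up_to_refinements
      (biprod.lift (q₁ ≫ x) z ≫ e.inv) (by
        have hz' : q₁ ≫ x ≫ Projective.factorThru g π = z ≫ f := hz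
        simp [hz'])
    refine ⟨A₂, q₂ ≫ q₁, inferInstance, y, ?_⟩
    have hy' : q₂ ≫ biprod.lift (q₁ ≫ x) z ≫ e.inv = y ≫ k := hy
    have := congrArg (· ≫ e.hom ≫ biprod.fst) hy'
    simpa using this

lemma isPresentedBy_of_mono {K M : C} (hM : IsPresentedBy X M) (m : K ⟶ M) [Mono m] (e : X ⟶ K)
    [Epi e] : IsPresentedBy X K := by
  obtain ⟨k, w, hk⟩ := hX.exists_kernel_of_isPresentedBy hM (e ≫ m)
  have w' : k ≫ e = 0 := by rwa [← cancel_mono m, Category.assoc, zero_comp]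
  refine ⟨k, e, w', ?_, inferInstance⟩
  rw [ShortComplex.exact_iff_exact_up_to_refinements]
  intro A x hx
  have hx' : x ≫ e = 0 := hx
  exact hk.exact_up_to_refinements x (by simp [reassoc_of% hx'])

/-- The kernel of `X ⟶ M ⟶ N` is covered by `X` and maps onto the kernel of `h`. A quotient of `X`
embedded in a presented object is presented. -/
lemma isPresentedBy_kernel {M N : C} (hM : IsPresentedBy X M) (hN : IsPresentedBy X N) (h : M ⟶ N)
    {K : C} (m : K ⟶ M) (w : m ≫ h = 0) [Mono m] (hm : (ShortComplex.mk m h w).Exact) :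
    IsPresentedBy X K := by
  obtain ⟨f, π, w₁, hf, _⟩ := id hM
  obtain ⟨k, w₂, hk⟩ := hX.exists_kernel_of_isPresentedBy hN (π ≫ h)
  let e : X ⟶ K := hm.lift (k ≫ π) (by simpa using w₂)
  have he : e ≫ m = k ≫ π := hm.lift_f _ _
  have : Epi e := by
    rw [epi_iff_surjective_up_to_refinements]
    intro A y
    obtain ⟨A₁, q₁, _, x, hx⟩ := surjective_up_to_refinements_of_epi π (y ≫ m)
    obtain ⟨A₂, q₂, _, z, hz⟩ := hk.exact_up_to_refinements x (by
      change x ≫ π ≫ h = 0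
      rw [← reassoc_of% hx, w, comp_zero, comp_zero])
    refine ⟨A₂, q₂ ≫ q₁, inferInstance, z, ?_⟩
    have hz' : q₂ ≫ x = z ≫ k := hz
    rw [← cancel_mono m]
    simp [he, hx, reassoc_of% hz']
  exact hX.isPresentedBy_of_mono hM m e

/-- To the relations of `N` one adds the images of the generators of `M`, lifted to the generators
of `N`; together they are indexed by `X ⊞ X ≅ X`. -/
lemma isPresentedBy_cokernel {M N : C} (hM : IsPresentedBy X M) (hN : IsPresentedBy X N) (h : M ⟶ N)
    {Q : C} (c : N ⟶ Q) (w : h ≫ c = 0) [Epi c] (hc : (ShortComplex.mk h c w).Exact) :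
    IsPresentedBy X Q := by
  have := hX.projective
  obtain ⟨f, π, w₁, hf, _⟩ := hM
  obtain ⟨f', π', w₁', hf', _⟩ := hN
  obtain ⟨e⟩ := hX.sum
  have hg := Projective.factorThru_comp (π ≫ h) π'
  set g := Projective.factorThru (π ≫ h) π'
  refine IsPresentedBy.of_exact (biprod.desc g f') (π' ≫ c) ?_ ?_ e.hom
  · ext
    · simp [reassoc_of% hg, w]
    · simp [reassoc_of% w₁']
  · rw [ShortComplex.exact_iff_exact_up_to_refinements]
    intro A x hx
    obtain ⟨A₁, q₁, _, z, hz⟩ := hc.exact_up_to_refinements (x ≫ π') (by simpa using hx)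
    obtain ⟨A₂, q₂, _, y, hy⟩ := surjective_up_to_refinements_of_epi π z
    have hz' : q₁ ≫ x ≫ π' = z ≫ h := hz
    obtain ⟨A₃, q₃, _, t, ht⟩ := hf'.exact_up_to_refinements (q₂ ≫ q₁ ≫ x - y ≫ g) (by
      simp [Preadditive.sub_comp, hz', hg, reassoc_of% hy])
    have ht' : q₃ ≫ (q₂ ≫ q₁ ≫ x - y ≫ g) = t ≫ f' := ht
    refine ⟨A₃, q₃ ≫ q₂ ≫ q₁, inferInstance, biprod.lift (q₃ ≫ y) t, ?_⟩
    simp [← ht', Preadditive.comp_sub]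

/-- Generators of the two ends give generators `X ⊞ X ≅ X` of the middle. Relations are found in two
steps: cover the kernel of the map to the quotient, then the kernel of the induced map to the
subobject. -/
lemma isPresentedBy_extension {S : ShortComplex C} (hS : S.ShortExact) (h₁ : IsPresentedBy X S.X₁)
    (h₃ : IsPresentedBy X S.X₃) : IsPresentedBy X S.X₂ := by
  have := hX.projective
  have := hS.epi_g
  have := hS.mono_f
  obtain ⟨_, π₁, _, -, _⟩ := id h₁
  obtain ⟨_, π₃, _, -, _⟩ := id h₃
  obtain ⟨σ⟩ := hX.sum
  let b : X ⊞ X ⟶ S.X₂ := biprod.desc (π₁ ≫ S.f) (Projective.factorThru π₃ S.g)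
  have : Epi b := Preadditive.epi_of_cancel_zero _ fun {Z} t ht => by
    have ht₁ : S.f ≫ t = 0 := by
      rw [← cancel_epi π₁, comp_zero]
      simpa [b] using biprod.inl ≫= ht
    have ht₂ : Projective.factorThru π₃ S.g ≫ t = 0 := by simpa [b] using biprod.inr ≫= ht
    have h : t = S.g ≫ hS.exact.desc t ht₁ := (hS.exact.g_desc t ht₁).symm
    rw [h, ← Category.assoc, Projective.factorThru_comp] at ht₂
    rw [h, zero_of_epi_comp π₃ ht₂, comp_zero]
  let e : X ⟶ S.X₂ := σ.hom ≫ b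
  have : Epi e := epi_comp _ _
  obtain ⟨l, hl, hl'⟩ := hX.exists_kernel_of_isPresentedBy h₃ (e ≫ S.g)
  have hl₁ : (l ≫ e) ≫ S.g = 0 := by rw [Category.assoc, hl]
  obtain ⟨k, hk, hk'⟩ := hX.exists_kernel_of_isPresentedBy h₁ (hS.exact.lift (l ≫ e) hl₁)
  have hk₁ : (k ≫ l) ≫ e = 0 := by
    have := hk =≫ S.f
    simpa using this
  refine ⟨k ≫ l, e, hk₁, ?_, inferInstance⟩
  rw [ShortComplex.exact_iff_exact_up_to_refinements]
  intro A x hx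
  have hx' : x ≫ e = 0 := hx
  obtain ⟨A₁, q₁, _, y, hy⟩ := hl'.exact_up_to_refinements x (by simp [reassoc_of% hx'])
  have hy' : q₁ ≫ x = y ≫ l := hy
  obtain ⟨A₂, q₂, _, z, hz⟩ := hk'.exact_up_to_refinements y (by
    rw [← cancel_mono S.f]
    simp [← reassoc_of% hy', hx'])
  have hz' : q₂ ≫ y = z ≫ k := hz
  exact ⟨A₂, q₂ ≫ q₁, inferInstance, z, by simp [hy', reassoc_of% hz']⟩

/-- Factoring the relations as `p ≫ i` gives the short exact sequence `0 ⟶ Y ⟶ X ⟶ M ⟶ 0`. Adding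
the identity of `X` to `i` turns both terms into copies of `X`, as `Y ⊞ X ≅ X` and `X ⊞ X ≅ X`. -/
lemma exists_resolution {M : C} (hM : IsPresentedBy X M) :
    ∃ (f : X ⟶ X) (g : X ⟶ M) (w : f ≫ g = 0), (ShortComplex.mk f g w).ShortExact := by
  obtain ⟨f, π, w, hf, _⟩ := hM
  obtain ⟨Y, p, s, i, hs, _, rfl, ⟨τ⟩⟩ := hX.factor f
  obtain ⟨σ⟩ := hX.sum
  have hi : i ≫ π = 0 := by
    rw [← Category.id_comp i, ← hs, Category.assoc, Category.assoc]
    rw [Category.assoc] at w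
    rw [w, comp_zero]
  have : Mono (biprod.map i (𝟙 X)) := inferInstance
  have : Epi (biprod.fst ≫ π : X ⊞ X ⟶ M) := epi_comp _ _
  refine ⟨τ.hom ≫ biprod.map i (𝟙 X) ≫ σ.inv, σ.hom ≫ biprod.fst ≫ π, by simp [hi], ?_⟩
  refine @ShortComplex.ShortExact.mk _ _ _ _ ?_ (mono_comp _ _) (epi_comp _ _)
  rw [ShortComplex.exact_iff_exact_up_to_refinements]
  intro A x hx
  obtain ⟨A₁, q, _, y, hy⟩ := hf.exact_up_to_refinements (x ≫ σ.hom ≫ biprod.fst)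
    (by simpa using hx)
  have hy' : q ≫ x ≫ σ.hom ≫ biprod.fst = y ≫ p ≫ i := by simpa using hy
  refine ⟨A₁, q, inferInstance, biprod.lift (y ≫ p) (q ≫ x ≫ σ.hom ≫ biprod.snd) ≫ τ.inv, ?_⟩
  rw [← cancel_mono σ.hom]
  ext
  · simp [hy']
  · simp

end IsCoherentProjective

end Coherent

lemma finPres_iff (M : Solid) : finPres M ↔ IsPresentedBy prodZ M := by
  constructor
  · rintro ⟨f, ⟨e⟩⟩
    refine ⟨f, cokernel.π f ≫ e.hom, by simp, ?_, inferInstance⟩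
    refine ShortComplex.exact_of_iso ?_ (ShortComplex.exact_cokernel f)
    exact ShortComplex.isoMk (Iso.refl _) (Iso.refl _) e
  · rintro ⟨f, e, w, h, _⟩
    exact ⟨f, ⟨(cokernelIsCokernel f).coconePointUniqueUpToIso h.gIsCokernel⟩⟩

end

/-! ### Pontryagin's criterion for countable free abelian groups -/

section

section Torsionless

variable {Q : Type*} [AddCommGroup Q]

/-- A submodule is saturated if the quotient by it is torsion-free. -/
def IsSaturated (V : Submodule ℤ Q) : Prop := ∀ (k : ℤ) (x : Q), k ≠ 0 → k • x ∈ V → x ∈ V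

lemma IsSaturated.isTorsionFree {V : Submodule ℤ Q} (hV : IsSaturated V) :
    Module.IsTorsionFree ℤ (Q ⧸ V) := by
  rw [Module.isTorsionFree_iff_smul_eq_zero]
  intro k x hx
  obtain ⟨x, rfl⟩ := V.mkQ_surjective x
  rw [or_iff_not_imp_left]
  intro hk
  rw [Submodule.mkQ_apply, Submodule.Quotient.mk_eq_zero]
  rw [← map_smul, Submodule.mkQ_apply, Submodule.Quotient.mk_eq_zero] at hx
  exact hV k x hk hx

/-- The image of `V'` in the torsion-free group `Q ⧸ V` is finitely generated, hence free, so the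
projection onto it splits. -/
lemma IsSaturated.exists_complement {V V' : Submodule ℤ Q} (hV : IsSaturated V) (h : V ≤ V')
    (hV' : V'.FG) : ∃ C : Submodule ℤ Q, Disjoint V C ∧ V ⊔ C = V' := by
  have := hV.isTorsionFree
  have : Module.Finite ℤ V' := Module.Finite.iff_fg.2 hV'
  let φ : V' →ₗ[ℤ] Q ⧸ V := V.mkQ ∘ₗ V'.subtype
  obtain ⟨σ, hσ⟩ := Module.projective_lifting_property φ.rangeRestrict LinearMap.id
    φ.surjective_rangeRestrict
  have hσ' (r : LinearMap.range φ) : φ (σ r) = r :=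
    congrArg Subtype.val (LinearMap.congr_fun hσ r)
  refine ⟨LinearMap.range (V'.subtype ∘ₗ σ), ?_, le_antisymm (sup_le h ?_) ?_⟩
  · rw [Submodule.disjoint_def]
    rintro _ hx ⟨r, rfl⟩
    have h0 : φ (σ r) = 0 := (Submodule.Quotient.mk_eq_zero V).2 hx
    have : r = 0 := Subtype.ext ((hσ' r).symm.trans h0)
    rw [this, map_zero]
  · rintro _ ⟨r, rfl⟩
    exact (σ r).2
  · intro x hx
    let r := φ.rangeRestrict ⟨x, hx⟩
    rw [← sub_add_cancel x (σ r : Q)]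
    refine Submodule.add_mem_sup ?_ ⟨r, rfl⟩
    rw [← Submodule.Quotient.mk_eq_zero V, Submodule.Quotient.mk_sub, sub_eq_zero]
    exact (hσ' r).symm

/-- The saturation of the subgroup generated by the first `n` elements of a sequence. -/
def saturation (q : ℕ → Q) (n : ℕ) : Submodule ℤ Q :=
  (Submodule.torsion ℤ (Q ⧸ Submodule.span ℤ (q '' Set.Iio n))).comap (Submodule.mkQ _)

lemma mem_saturation_iff (q : ℕ → Q) (n : ℕ) (x : Q) :
    x ∈ saturation q n ↔ ∃ k : ℤ, k ≠ 0 ∧ k • x ∈ Submodule.span ℤ (q '' Set.Iio n) := by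
  rw [saturation, Submodule.mem_comap, Submodule.mem_torsion_iff]
  constructor
  · rintro ⟨⟨k, hk⟩, h⟩
    refine ⟨k, nonZeroDivisors.ne_zero hk, ?_⟩
    rwa [← Submodule.Quotient.mk_eq_zero]
  · rintro ⟨k, hk, h⟩
    refine ⟨⟨k, mem_nonZeroDivisors_of_ne_zero hk⟩, ?_⟩
    rwa [← Submodule.Quotient.mk_eq_zero] at h

lemma isSaturated_saturation (q : ℕ → Q) (n : ℕ) : IsSaturated (saturation q n) := by
  intro k x hk hx
  rw [mem_saturation_iff] at hx ⊢
  obtain ⟨l, hl, h⟩ := hx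
  exact ⟨l * k, mul_ne_zero hl hk, by rwa [mul_smul]⟩

lemma saturation_mono (q : ℕ → Q) : Monotone (saturation q) := by
  intro m n hmn x hx
  rw [mem_saturation_iff] at hx ⊢
  obtain ⟨k, hk, h⟩ := hx
  exact ⟨k, hk, Submodule.span_mono (Set.image_mono (Set.Iio_subset_Iio hmn)) h⟩

lemma mem_saturation (q : ℕ → Q) {m n : ℕ} (h : m < n) : q m ∈ saturation q n :=
  (mem_saturation_iff q n _).2 ⟨1, one_ne_zero, by
    rw [one_smul]
    exact Submodule.subset_span ⟨m, h, rfl⟩⟩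

/-- If the additive maps to `ℤ` separate the elements of `Q`, then the saturation of a finitely
generated subgroup is finitely generated. -/
lemma fg_saturation (hQ : ∀ x : Q, x ≠ 0 → ∃ ψ : Q →ₗ[ℤ] ℤ, ψ x ≠ 0) (q : ℕ → Q) (n : ℕ) :
    (saturation q n).FG := by
  -- `E` records the values of a functional on the generators. Its range, a subgroup of `ℤ^n`, is
  -- finitely generated, so finitely many functionals already separate the span, and then also its
  -- saturation, which thereby embeds into a finite power of `ℤ`.
  let E : (Q →ₗ[ℤ] ℤ) →ₗ[ℤ] (Fin n → ℤ) := LinearMap.pi fun i => LinearMap.applyₗ (q i)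
  obtain ⟨s, hs⟩ := IsNoetherian.noetherian (LinearMap.range E)
  have h1 (i : s) : ∃ ψ, E ψ = i := by
    have : (i : Fin n → ℤ) ∈ LinearMap.range E := hs ▸ Submodule.subset_span i.2
    exact this
  choose ψ hψ using h1
  let Ψ : Q →ₗ[ℤ] (s → ℤ) := LinearMap.pi ψ
  have h2 {x : Q} (hx : x ∈ Submodule.span ℤ (q '' Set.Iio n)) (h0 : Ψ x = 0) : x = 0 := by
    by_contra hne
    obtain ⟨χ, hχ⟩ := hQ x hne
    apply hχ
    have h3 : E χ ∈ Submodule.span ℤ (Set.range fun i : s => E (ψ i)) := by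
      have : (Set.range fun i : s => E (ψ i)) = s := by
        simp [hψ]
      rw [this, hs]
      exact ⟨χ, rfl⟩
    obtain ⟨c, hc⟩ := (Submodule.mem_span_range_iff_exists_fun ℤ).1 h3
    have h4 : Set.EqOn (∑ i, c i • ψ i : Q →ₗ[ℤ] ℤ) χ (q '' Set.Iio n) := by
      rintro _ ⟨m, hm, rfl⟩
      have := congrFun hc ⟨m, hm⟩
      simpa [E] using this
    rw [← LinearMap.eqOn_span h4 hx]
    simp only [LinearMap.coe_sum, LinearMap.smul_apply, Finset.sum_apply]
    exact Finset.sum_eq_zero fun i _ => by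
      have : ψ i x = 0 := congrFun h0 i
      rw [this, smul_zero]
  have h3 : Function.Injective (Ψ ∘ₗ (saturation q n).subtype) := by
    rw [injective_iff_map_eq_zero]
    rintro ⟨x, hx⟩ h0
    obtain ⟨k, hk, h⟩ := (mem_saturation_iff q n x).1 hx
    have h0' : Ψ x = 0 := h0
    have h4 := h2 h (by rw [map_smul, h0', smul_zero])
    by_contra hne
    obtain ⟨χ, hχ⟩ := hQ x fun h => hne (Subtype.ext h)
    have h5 := congrArg χ h4
    rw [map_smul, map_zero, smul_eq_mul, mul_eq_zero] at h5
    exact h5.elim hk hχ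
  exact Module.Finite.iff_fg.1 (Module.Finite.of_injective _ h3)

/-- Pontryagin: a countable abelian group whose elements are separated by the maps to `ℤ` is
free. -/
theorem free_of_countable [Countable Q] (hQ : ∀ x : Q, x ≠ 0 → ∃ ψ : Q →ₗ[ℤ] ℤ, ψ x ≠ 0) :
    Module.Free ℤ Q := by
  obtain ⟨q, hq⟩ := exists_surjective_nat Q
  let V := saturation q
  have htf : Module.IsTorsionFree ℤ Q := by
    rw [Module.isTorsionFree_iff_smul_eq_zero]
    intro k x hx
    by_contra! h
    obtain ⟨χ, hχ⟩ := hQ x h.2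
    have h5 := congrArg χ hx
    rw [map_smul, map_zero, smul_eq_mul, mul_eq_zero] at h5
    exact h5.elim h.1 hχ
  -- The saturations form an increasing chain of finitely generated subgroups exhausting `Q`, each a
  -- direct summand of the next. The complements are free and `Q` is their direct sum.
  have hC (n : ℕ) := (isSaturated_saturation q n).exists_complement
    (saturation_mono q (Nat.le_succ n)) (fg_saturation hQ q (n + 1))
  choose C hC₁ hC₂ using hC
  have hV0 : V 0 = ⊥ := by
    rw [eq_bot_iff]
    intro x hx
    obtain ⟨k, hk, h⟩ := (mem_saturation_iff q 0 x).1 hx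
    have he : Set.Iio (0 : ℕ) = ∅ := by ext; simp
    rw [he, Set.image_empty, Submodule.span_empty] at h
    exact (smul_eq_zero.1 ((Submodule.mem_bot ℤ).1 h)).resolve_left hk
  have hCV {m n : ℕ} (h : m < n) : C m ≤ V n :=
    le_trans (le_sup_right.trans (hC₂ m).le) (saturation_mono q h)
  have hfree (n : ℕ) : Module.Free ℤ (C n) := by
    have : Module.Finite ℤ (V (n + 1)) := Module.Finite.iff_fg.2 (fg_saturation hQ q (n + 1))
    have : Module.Finite ℤ (C n) := Module.Finite.of_injective
      (Submodule.inclusion (hCV (Nat.lt_succ_self n))) (Submodule.inclusion_injective _)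
    infer_instance
  have hVC (n : ℕ) : V n ≤ ⨆ m, C m := by
    induction n with
    | zero => rw [hV0]; exact bot_le
    | succ n ih => 
      change saturation q (n + 1) ≤ _
      rw [← hC₂ n]
      exact sup_le ih (le_iSup C n)
  have hind : iSupIndep C := by
    classical
    rw [iSupIndep_iff_finsetSum_eq_zero_imp_eq_zero]
    intro s v hv hsum
    by_contra! hne
    let t := s.filter fun i => v i ≠ 0
    have ht : t.Nonempty := by
      obtain ⟨i, hi, hi'⟩ := hne
      exact ⟨i, Finset.mem_filter.2 ⟨hi, hi'⟩⟩
    -- In a nontrivial relation the term of largest index is minus a sum of earlier ones, so it lies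
    -- in `V n` as well as in `C n`.
    let n := t.max' ht
    have hn : n ∈ t := t.max'_mem ht
    have hsum' : ∑ i ∈ t, v i = 0 := by rw [Finset.sum_filter_ne_zero, hsum]
    rw [← Finset.add_sum_erase _ _ hn] at hsum'
    have hmem (i : ℕ) (hi : i ∈ t) : v i ∈ C i := hv i (Finset.mem_filter.1 hi).1
    have h1 : v n ∈ V n := by
      rw [eq_neg_of_add_eq_zero_left hsum']
      refine neg_mem (Submodule.sum_mem _ fun i hi => ?_)
      have h2 : i < n := lt_of_le_of_ne (t.le_max' i (Finset.mem_of_mem_erase hi))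
        (Finset.ne_of_mem_erase hi)
      exact hCV h2 (hmem i (Finset.mem_of_mem_erase hi))
    exact (Finset.mem_filter.1 hn).2 (Submodule.disjoint_def.1 (hC₁ n) _ h1 (hmem n hn))
  have htop : ⨆ m, C m = ⊤ := by
    rw [eq_top_iff]
    intro x _
    obtain ⟨m, rfl⟩ := hq x
    exact hVC (m + 1) (mem_saturation q (Nat.lt_succ_self m))
  have hint := DirectSum.isInternal_submodule_of_iSupIndep_of_iSup_eq_top hind htop
  exact Module.Free.of_basis (hint.collectedBasis fun n => Module.Free.chooseBasis ℤ (C n))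

end Torsionless

end

/-! ### Maps between products of copies of `ℤ` as matrices -/

section

section Matrix

variable {A B : LightCondAb} {S : LightProfinite.{0}} {I J K : Type}

/-- The action of morphisms on a section, as an additive map. -/
def secEval (B : LightCondAb) (x : Sec A S) : (A ⟶ B) →+ Sec B S where
  toFun f := secMap f S x
  map_zero' := by
    have h := freeEquiv_comp' ((freeEquiv S A).symm x) (0 : A ⟶ B)
    rw [comp_zero, freeEquiv_zero, Equiv.apply_symm_apply] at h
    exact h.symm
  map_add' f g := by
    have h (f : A ⟶ B) := freeEquiv_comp' ((freeEquiv S A).symm x) f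
    simp only [Equiv.apply_symm_apply] at h
    rw [← h, ← h, ← h, Preadditive.comp_add, freeEquiv_add]

lemma secEval_apply (x : Sec A S) (f : A ⟶ B) : secEval B x f = secMap f S x := rfl

/-- Evaluation of sections of `ℤ` at a point. -/
def valHom (s : S) : Sec intZ S →+ ℤ where
  toFun a := val a s
  map_zero' := rfl
  map_add' _ _ := rfl

/-- The map `∏_I ℤ ⟶ ℤ` given by a finitely supported function. -/
def ev (φ : I →₀ ℤ) : piZ I ⟶ intZ := φ.sum fun i c => c • Pi.π (fun _ : I => intZ) i

lemma val_secMap_ev (φ : I →₀ ℤ) (x : Sec (piZ I) S) (s : S) :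
    val (secMap (ev φ) S x) s =
      Finsupp.linearCombination ℤ (fun i => val (coord i x) s) φ := by
  change ((valHom s).comp (secEval intZ x)) (ev φ) = _
  rw [ev, Finsupp.linearCombination_apply, Finsupp.sum, map_sum]
  exact Finset.sum_congr rfl fun i _ => map_zsmul _ _ _

/-- The map `∏_I ℤ ⟶ ∏_J ℤ` given by a matrix with finitely supported rows. -/
def matMap (a : J → I →₀ ℤ) : piZ I ⟶ piZ J := Pi.lift fun j => ev (a j)

lemma val_coord_matMap (a : J → I →₀ ℤ) (j : J) (x : Sec (piZ I) S) (s : S) :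
    val (coord j (secMap (matMap a) S x)) s =
      Finsupp.linearCombination ℤ (fun i => val (coord i x) s) (a j) := by
  rw [← val_secMap_ev, coord, ← secMap_comp, matMap, Pi.lift_π]

lemma hom_piZ_ext {f g : A ⟶ piZ J} (h : ∀ (S : LightProfinite.{0}) (x : Sec A S) (j : J) (s : S),
    val (coord j (secMap f S x)) s = val (coord j (secMap g S x)) s) : f = g :=
  hom_ext_sec fun S x => coord_ext fun j => val_injective (funext (h S x j))

/-- The matrix `a` is also the map `⊕_J ℤ → ⊕_I ℤ` with `a j` as value on the `j`-th basis vector,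
and `matMap a` is its dual; hence the reversed order of composition. -/
lemma matMap_comp (a : J → I →₀ ℤ) (b : K → J →₀ ℤ) :
    matMap a ≫ matMap b = matMap fun k => Finsupp.linearCombination ℤ a (b k) := by
  refine hom_piZ_ext fun S x k s => ?_
  rw [secMap_comp, val_coord_matMap, val_coord_matMap,
    Finsupp.linearCombination_linearCombination]
  simp only [val_coord_matMap]

lemma matMap_id : matMap (fun i : I => Finsupp.single i 1) = 𝟙 (piZ I) := by
  refine hom_piZ_ext fun S x i s => ?_
  rw [val_coord_matMap, Finsupp.linearCombination_single, one_smul]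
  rfl

lemma matMap_zero : matMap (fun _ : J => (0 : I →₀ ℤ)) = 0 := by
  refine hom_piZ_ext fun S x i s => ?_
  rw [val_coord_matMap, map_zero]
  have : secMap (0 : piZ I ⟶ piZ J) S x = 0 := map_zero (secEval (piZ J) x)
  rw [this, coord, map_zero]
  rfl

lemma matMap_add (a b : J → I →₀ ℤ) : matMap (fun j => a j + b j) = matMap a + matMap b := by
  refine hom_piZ_ext fun S x i s => ?_
  have : secMap (matMap a + matMap b) S x = _ := map_add (secEval (piZ J) x) _ _
  rw [this, coord_add, val_add, val_coord_matMap, map_add]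
  simp only [secEval_apply, val_coord_matMap]

lemma finite_support_of_null (f : Sec intZ ℕ∪{∞}) (hf : res intZ pointInfty f = 0) :
    {n : ℕ | val f (OnePoint.some n : OnePoint ℕ) ≠ 0}.Finite := by
  have h1 : IsOpen {x : OnePoint ℕ | val f x = 0} :=
    (isOpen_discrete {(0 : ℤ)}).preimage (continuous_val f)
  have h0 : (OnePoint.infty : OnePoint ℕ) ∈ {x : OnePoint ℕ | val f x = 0} :=
    congrFun (congrArg val hf) PUnit.unit
  have h2 := (OnePoint.tendsto_coe_infty (X := ℕ)).eventually (h1.mem_nhds h0)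
  rw [Filter.coclosedCompact_eq_cocompact, Filter.cocompact_eq_cofinite] at h2
  exact h2

/-- `φ` is determined by its null sequence of values on the basis vectors, and a null sequence in
the discrete group `ℤ` is eventually zero. -/
lemma exists_eq_ev (φ : piZ ℕ ⟶ intZ) : ∃ a : ℕ →₀ ℤ, φ = ev a := by
  have h0 := res_pointInfty_nullVal (basisMap ≫ φ)
  have hfin := finite_support_of_null _ h0
  refine ⟨Finsupp.ofSupportFinite (fun n => val (nullVal (basisMap ≫ φ))
    (OnePoint.some n : OnePoint ℕ)) hfin, ?_⟩
  apply (bijective_basisMap_comp isSolid_intZ).1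
  apply nullVal_injective
  refine val_injective (funext fun s => ?_)
  beta_reduce
  rw [nullVal_comp basisMap (ev _), nullVal_basisMap, val_secMap_ev]
  simp only [val_coord_basisSec]
  rw [Finsupp.linearCombination_apply, Finsupp.sum]
  induction s using OnePoint.rec with
  | infty =>
    refine (congrFun (congrArg val h0) PUnit.unit).trans (Finset.sum_eq_zero fun n _ => ?_).symm
    rw [delta_neg (OnePoint.infty_ne_coe n)]
    simp
  | coe n =>
    rw [Finset.sum_eq_single n]
    · rw [delta_pos, Nat.cast_one, smul_eq_mul, mul_one]
      rfl
    · intro m _ hm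
      rw [delta_neg (fun h => hm (OnePoint.coe_injective h).symm)]
      simp
    · intro hn
      rw [Finsupp.notMem_support_iff.1 hn, zero_smul]

lemma exists_eq_matMap (f : piZ ℕ ⟶ piZ J) : ∃ a : J → ℕ →₀ ℤ, f = matMap a := by
  choose a ha using fun j => exists_eq_ev (f ≫ Pi.π _ j)
  refine ⟨a, Limits.Pi.hom_ext _ _ fun j => ?_⟩
  rw [ha, matMap, Pi.lift_π]

/-- The solid abelian group `∏_I ℤ`. -/
def piSolid (I : Type) : Solid := ⟨piZ I, isSolid_piZ I⟩

/-- The map of solid abelian groups `∏_I ℤ ⟶ ∏_J ℤ` given by a matrix. -/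
def matHom (a : J → I →₀ ℤ) : piSolid I ⟶ piSolid J := ObjectProperty.homMk (matMap a)

lemma matHom_comp (a : J → I →₀ ℤ) (b : K → J →₀ ℤ) :
    matHom a ≫ matHom b = matHom fun k => Finsupp.linearCombination ℤ a (b k) :=
  ObjectProperty.hom_ext _ (matMap_comp a b)

lemma matHom_id : matHom (fun i : I => Finsupp.single i 1) = 𝟙 (piSolid I) :=
  ObjectProperty.hom_ext _ matMap_id

lemma matHom_zero : matHom (fun _ : J => (0 : I →₀ ℤ)) = 0 :=
  ObjectProperty.hom_ext _ matMap_zero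

lemma matHom_add (a b : J → I →₀ ℤ) : matHom (fun j => a j + b j) = matHom a + matHom b :=
  ObjectProperty.hom_ext _ (matMap_add a b)

/-- Reindexing. -/
def piSolidCongr (e : I ≃ J) : piSolid I ≅ piSolid J where
  hom := matHom fun j => Finsupp.single (e.symm j) 1
  inv := matHom fun i => Finsupp.single (e i) 1
  hom_inv_id := by
    rw [matHom_comp, ← matHom_id]
    simp
  inv_hom_id := by
    rw [matHom_comp, ← matHom_id]
    simp

/-- The product of two products of copies of `ℤ`, as a bicone. -/
def piSolidBicone (I J : Type) : BinaryBicone (piSolid I) (piSolid J) where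
  pt := piSolid (I ⊕ J)
  fst := matHom fun i => Finsupp.single (Sum.inl i) 1
  snd := matHom fun j => Finsupp.single (Sum.inr j) 1
  inl := matHom (Sum.elim (fun i => Finsupp.single i 1) fun _ => 0)
  inr := matHom (Sum.elim (fun _ => 0) fun j => Finsupp.single j 1)
  inl_fst := by rw [matHom_comp, ← matHom_id]; simp
  inl_snd := by rw [matHom_comp, ← matHom_zero]; simp
  inr_fst := by rw [matHom_comp, ← matHom_zero]; simp
  inr_snd := by rw [matHom_comp, ← matHom_id]; simp

/-- The isomorphism `∏_{I ⊕ J} ℤ ≅ ∏_I ℤ ⊞ ∏_J ℤ`. -/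
def piSolidSum (I J : Type) : piSolid (I ⊕ J) ≅ piSolid I ⊞ piSolid J :=
  biprod.uniqueUpToIso _ _ (b := piSolidBicone I J) (isBinaryBilimitOfTotal _ (by
    have h : (matHom fun i => Finsupp.single (Sum.inl i) 1) ≫
        matHom (Sum.elim (fun i => Finsupp.single i 1) fun _ => 0) +
        (matHom fun j => Finsupp.single (Sum.inr j) 1) ≫
        matHom (Sum.elim (fun _ => 0) fun j => Finsupp.single j 1) = 𝟙 (piSolid (I ⊕ J)) := by
      rw [matHom_comp, matHom_comp, ← matHom_add, ← matHom_id]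
      congr 1
      ext1 (i | j) <;> simp
    exact h))

lemma mono_of_secMap {M N : Solid} (f : M ⟶ N)
    (h : ∀ (S : LightProfinite.{0}) (x : Sec M.obj S), secMap f.hom S x = 0 → x = 0) : Mono f := by
  refine Preadditive.mono_of_cancel_zero _ fun {L} g hg => ?_
  apply ObjectProperty.hom_ext
  refine hom_ext_sec fun S x => ?_
  have h0 : secMap (0 : L.obj ⟶ M.obj) S x = 0 := map_zero (secEval M.obj x)
  refine (h S _ ?_).trans h0.symm
  rw [← secMap_comp]
  have h1 : g.hom ≫ f.hom = 0 := congrArg (fun z => z.hom) hg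
  rw [h1]
  exact map_zero (secEval N.obj x)

/-- Sections over `S` are determined by integer vectors at the points of `S`, so injectivity on
integer vectors suffices. -/
lemma mono_matHom (c : J → I →₀ ℤ)
    (h : ∀ v : I → ℤ, (∀ j, Finsupp.linearCombination ℤ v (c j) = 0) → v = 0) :
    Mono (matHom c) := by
  refine mono_of_secMap _ fun S y hy => coord_ext (x := y) (y := 0) fun i =>
    val_injective (funext fun s => ?_)
  refine (congrFun (h (fun i => val (coord i y) s) fun j => ?_) i).trans ?_
  · rw [← val_coord_matMap c j y s]
    have hy' : secMap (matMap c) S y = 0 := hy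
    rw [hy', coord, map_zero]
    rfl
  · rw [coord, map_zero]
    rfl

lemma nonempty_iso_biprod [Countable J] : Nonempty (piSolid ℕ ≅ piSolid J ⊞ piSolid ℕ) := by
  obtain ⟨e⟩ := nonempty_equiv_of_countable (α := ℕ) (β := J ⊕ ℕ)
  exact ⟨piSolidCongr e ≪≫ piSolidSum J ℕ⟩

end Matrix

/-- Let `f` be dual to the endomorphism `a` of the free group `⊕_ℕ ℤ`, and let `G` consist of the
vectors killed by every functional that kills all `a m`. The quotient by `G` is countable and
torsionless, hence free, so `G` is a direct summand, and `G` is free too. Factoring `a` through `G`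
and dualizing gives a split epimorphism from `∏_ℕ ℤ` onto the dual of `G`, followed by the dual of
`⊕_ℕ ℤ → G`. The latter is monic because a functional on `G` vanishing on all `a m` is zero. -/
lemma isCoherentProjective_piSolid : IsCoherentProjective (piSolid ℕ) where
  projective := inferInstanceAs (Projective prodZ)
  sum := nonempty_iso_biprod (J := ℕ)
  factor f := by
    obtain ⟨a, ha⟩ := exists_eq_matMap f.hom
    obtain rfl : f = matHom a := ObjectProperty.hom_ext _ ha
    clear ha
    let G : Submodule ℤ (ℕ →₀ ℤ) :=
      ⨅ ψ : {ψ : (ℕ →₀ ℤ) →ₗ[ℤ] ℤ // ∀ m, ψ (a m) = 0}, LinearMap.ker ψ.1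
    have hG {x : ℕ →₀ ℤ} : x ∈ G ↔ ∀ ψ : (ℕ →₀ ℤ) →ₗ[ℤ] ℤ, (∀ m, ψ (a m) = 0) → ψ x = 0 := by
      simp [G, Submodule.mem_iInf]
    have haG (m : ℕ) : a m ∈ G := hG.2 fun ψ hψ => hψ m
    have : Countable ((ℕ →₀ ℤ) ⧸ G) := G.mkQ_surjective.countable
    have : Module.Free ℤ ((ℕ →₀ ℤ) ⧸ G) := free_of_countable fun x hx => by
      obtain ⟨x, rfl⟩ := G.mkQ_surjective x
      have hx' : x ∉ G := fun h => hx ((Submodule.Quotient.mk_eq_zero G).2 h)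
      rw [hG] at hx'
      push Not at hx'
      obtain ⟨ψ, hψ, h⟩ := hx'
      exact ⟨G.liftQ ψ fun y hy => hG.1 hy ψ hψ, h⟩
    have : Module.Free ℤ G := free_of_countable fun x hx => by
      have : (x : ℕ →₀ ℤ) ≠ 0 := fun h => hx (Subtype.ext h)
      obtain ⟨n, hn⟩ := Finsupp.ne_iff.1 this
      exact ⟨Finsupp.lapply n ∘ₗ G.subtype, hn⟩
    let b := Module.Free.chooseBasis ℤ G
    obtain ⟨σ, hσ⟩ := Module.projective_lifting_property G.mkQ LinearMap.id G.mkQ_surjective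
    have hρ (x : ℕ →₀ ℤ) : x - σ (G.mkQ x) ∈ G := by
      rw [← Submodule.Quotient.mk_eq_zero, Submodule.Quotient.mk_sub, sub_eq_zero]
      exact (LinearMap.congr_fun hσ (G.mkQ x)).symm
    let ρ : (ℕ →₀ ℤ) →ₗ[ℤ] G := LinearMap.codRestrict G (LinearMap.id - σ ∘ₗ G.mkQ) hρ
    have hρG (x : G) : ρ x = x := by
      apply Subtype.ext
      have : G.mkQ x = 0 := (Submodule.Quotient.mk_eq_zero G).2 x.2
      change (x : ℕ →₀ ℤ) - σ (G.mkQ x) = x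
      rw [this, map_zero, sub_zero]
    have : Countable (Module.Free.ChooseBasisIndex ℤ G) := b.injective.countable
    let c (m : ℕ) := b.repr ⟨a m, haG m⟩
    refine ⟨piSolid (Module.Free.ChooseBasisIndex ℤ G), matHom fun j => (b j : ℕ →₀ ℤ),
      matHom fun n => b.repr (ρ (Finsupp.single n 1)), matHom c, ?_, ?_, ?_, nonempty_iso_biprod⟩
    · rw [matHom_comp, ← matHom_id]
      congr 1
      ext1 j
      have h1 : Finsupp.linearCombination ℤ (fun n => b.repr (ρ (Finsupp.single n 1))) =
          (b.repr : G →ₗ[ℤ] _) ∘ₗ ρ := by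
        ext n : 2
        simp
      rw [h1, LinearMap.comp_apply, hρG]
      simp
    · refine mono_matHom _ fun v hv => funext fun j => ?_
      -- The retraction `ρ` extends the functional `v` from `G` to the whole group. The extension
      -- kills all `a m`, so by definition of `G` it kills `G`.
      let ψ : (ℕ →₀ ℤ) →ₗ[ℤ] ℤ := Finsupp.linearCombination ℤ v ∘ₗ (b.repr : G →ₗ[ℤ] _) ∘ₗ ρ
      have h1 (x : G) : ψ x = Finsupp.linearCombination ℤ v (b.repr x) :=
        congrArg (fun y => Finsupp.linearCombination ℤ v (b.repr y)) (hρG x)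
      have h2 := hG.1 (b j).2 ψ fun m => (h1 ⟨a m, haG m⟩).trans (hv m)
      rw [h1] at h2
      simpa using h2
    · rw [matHom_comp]
      congr 1
      ext1 m
      have h1 : Finsupp.linearCombination ℤ (fun j => (b j : ℕ →₀ ℤ)) (c m) =
          G.subtype (Finsupp.linearCombination ℤ b (c m)) := by
        rw [Finsupp.apply_linearCombination]
        rfl
      rw [h1, b.linearCombination_repr]
      rfl

lemma isCoherentProjective_prodZ : IsCoherentProjective prodZ := isCoherentProjective_piSolid

end

/-! ### The abelian category of finitely presented solid groups -/

section

instance : finPres.IsClosedUnderIsomorphisms where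
  of_iso := by
    rintro _ _ e ⟨f, ⟨e'⟩⟩
    exact ⟨f, ⟨e' ≪≫ e⟩⟩

instance : finPres.IsClosedUnderKernels where
  kernels_le := by
    rintro _ ⟨f, k, hk, hf⟩
    have : Mono k.ι := Fork.IsLimit.mono hk
    rw [finPres_iff]
    refine isCoherentProjective_prodZ.isPresentedBy_kernel ((finPres_iff _).1 hf.1)
      ((finPres_iff _).1 hf.2) f k.ι k.condition ?_
    exact ShortComplex.exact_of_f_is_kernel _
      (IsLimit.ofIsoLimit hk (Fork.ext (Iso.refl _)))

instance : finPres.IsClosedUnderCokernels where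
  cokernels_le := by
    rintro _ ⟨f, k, hk, hf⟩
    have : Epi k.π := Cofork.IsColimit.epi hk
    rw [finPres_iff]
    refine isCoherentProjective_prodZ.isPresentedBy_cokernel ((finPres_iff _).1 hf.1)
      ((finPres_iff _).1 hf.2) f k.π k.condition ?_
    exact ShortComplex.exact_of_g_is_cokernel _
      (IsColimit.ofIsoColimit hk (Cofork.ext (Iso.refl _)))

instance : finPres.IsClosedUnderExtensions where
  prop_X₂_of_shortExact hS h₁ h₃ := by
    rw [finPres_iff] at h₁ h₃ ⊢
    exact isCoherentProjective_prodZ.isPresentedBy_extension hS h₁ h₃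

lemma finPres_prodZ : finPres prodZ := ⟨0, ⟨cokernelZeroIsoTarget⟩⟩

instance : finPres.ContainsZero where
  exists_zero := ⟨cokernel (𝟙 prodZ), isZero_cokernel_of_epi _, 𝟙 _, ⟨Iso.refl _⟩⟩

instance : finPres.IsClosedUnderBinaryProducts where
  limitsOfShape_le := by
    rintro X ⟨p⟩
    refine finPres.prop_of_iso ?_ (finPres.prop_biprod
      (p.prop_diag_obj (.mk .left)) (p.prop_diag_obj (.mk .right)))
    exact biprod.isoProd _ _ ≪≫ IsLimit.conePointUniqueUpToIso (prodIsProd _ _)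
      ((IsLimit.postcomposeHomEquiv (diagramIsoPair p.diag) _).2 p.isLimit)

instance : finPres.IsClosedUnderFiniteProducts := .mk'

instance : Abelian SolidFP := inferInstance

instance : finPres.ι.Additive := inferInstance

instance : PreservesFiniteLimits finPres.ι :=
  have (X Y : SolidFP) (f : X ⟶ Y) : PreservesLimit (parallelPair f 0) finPres.ι :=
    finPres.preservesKernels_ι f
  Functor.preservesFiniteLimits_of_preservesKernels finPres.ι

instance : PreservesFiniteColimits finPres.ι :=
  have (X Y : SolidFP) (f : X ⟶ Y) : PreservesColimit (parallelPair f 0) finPres.ι :=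
    finPres.preservesCokernels_ι f
  Functor.preservesFiniteColimits_of_preservesCokernels finPres.ι

lemma exists_resolution (M : Solid) (hM : finPres M) :
    ∃ (f : prodZ ⟶ prodZ) (g : prodZ ⟶ M) (w : f ≫ g = 0), (ShortComplex.mk f g w).ShortExact :=
  isCoherentProjective_prodZ.exists_resolution ((finPres_iff M).1 hM)

end

end LightSolid

/-! ### Ind-completions recognized by dense subcategories of compact objects -/

namespace CategoryTheory.Functor

universe v u₁ u₂

variable {C : Type u₁} {D : Type u₂} [Category.{v} C] [Category.{v} D] (G : C ⥤ D)

/-- The presheaf `X ↦ (G X ⟶ Y)` attached to an object `Y` of the target of a functor `G`. -/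
def nerve : D ⥤ Cᵒᵖ ⥤ Type v :=
  yoneda ⋙ (Functor.whiskeringLeft _ _ _).obj G.op

/-- By density every `Y` is the colimit of the objects `G X` over it, so a map out of `Y` amounts to
a natural family of maps on the `G X ⟶ Y`. -/
instance [G.IsDense] : G.nerve.Faithful where
  map_injective h := (G.denseAt _).hom_ext' fun X p =>
    (Category.id_comp _).trans (Eq.trans
      (ConcreteCategory.congr_hom (NatTrans.congr_app h (Opposite.op X)) p)
      (Category.id_comp _).symm)

instance [G.IsDense] : G.nerve.Full where
  map_surjective {Y Z} f := by
    let c : Cocone (CostructuredArrow.proj G Y ⋙ G) :=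
      { pt := Z
        ι :=
          { app g := (f.app (Opposite.op g.left) : (G.obj g.left ⟶ Y) → (G.obj g.left ⟶ Z)) g.hom
            naturality g₁ g₂ φ := by
              have h := ConcreteCategory.congr_hom (f.naturality φ.left.op) g₂.hom
              have h2 : G.map φ.left ≫ g₂.hom = g₁.hom := CostructuredArrow.w φ
              refine Eq.trans ?_ (Category.comp_id _).symm
              refine h.symm.trans ?_
              exact congrArg (fun t => f.app (Opposite.op g₁.left) t) h2 } }
    refine ⟨(G.denseAt Y).desc c, ?_⟩
    ext ⟨X⟩ x
    refine Eq.trans ?_ ((G.denseAt Y).fac c (.mk x))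
    exact (Category.id_comp (x ≫ (G.denseAt Y).desc c)).symm.trans
      (Category.assoc _ _ _).symm

/-- The nerve of a fully faithful functor extends the Yoneda embedding. -/
def yonedaIsoCompNerve [G.Full] [G.Faithful] : yoneda ≅ G ⋙ G.nerve :=
  NatIso.ofComponents (fun X => NatIso.ofComponents
    (fun Y => ((FullyFaithful.ofFullyFaithful G).homEquiv).toIso)
    (fun {Y Z} f => by
      ext x
      exact G.map_comp f.unop x))
    (fun {X Y} f => by
      ext Z x
      exact G.map_comp x f)

lemma preservesColimitsOfShape_nerve {J : Type v} [SmallCategory J]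
    (h : ∀ X, PreservesColimitsOfShape J (coyoneda.obj (Opposite.op (G.obj X)))) :
    PreservesColimitsOfShape J G.nerve where
  preservesColimit {K} := by
    refine ⟨fun {c} hc => ⟨evaluationJointlyReflectsColimits _ fun X => ?_⟩⟩
    have := h X.unop
    exact isColimitOfPreserves (coyoneda.obj (Opposite.op (G.obj X.unop))) hc

variable [G.Full] [G.Faithful] [G.IsDense]
  (hfilt : ∀ Y, IsFiltered (CostructuredArrow G Y))
  [EssentiallySmall.{v} C]
  (hG : ∀ (J : Type v) [SmallCategory J] [IsFiltered J] (X : C),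
    PreservesColimitsOfShape J (coyoneda.obj (Opposite.op (G.obj X))))

-- `Y` is a filtered colimit of objects `G X`. By compactness the nerve preserves it, and it carries
-- `G X` to a representable presheaf; ind-objects are closed under filtered colimits.
include hfilt hG in
lemma isIndObject_nerve (Y : D) : IsIndObject (G.nerve.obj Y) := by
  have := hfilt Y
  let e := equivSmallModel.{v} (CostructuredArrow G Y)
  have : IsFiltered (SmallModel.{v} (CostructuredArrow G Y)) := IsFiltered.of_equivalence e
  have := G.preservesColimitsOfShape_nerve
    (hG (SmallModel.{v} (CostructuredArrow G Y)))
  have hc := isColimitOfPreserves G.nerve ((G.denseAt Y).whiskerEquivalence e.symm)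
  refine ObjectProperty.prop_of_isColimit (IsIndObject (C := C)) hc fun j => ?_
  exact (ObjectProperty.prop_iff_of_iso _ (G.yonedaIsoCompNerve.symm.app _)).2 (isIndObject_yoneda _)

-- A diagram presenting `A` has a filtered colimit in `D`, which the nerve carries back to `A`.
omit [G.IsDense] [EssentiallySmall.{v} C] in
include hG in
lemma exists_nerve_iso [HasFilteredColimitsOfSize.{v, v} D] {A : Cᵒᵖ ⥤ Type v}
    (hA : IsIndObject A) : ∃ Y, Nonempty (G.nerve.obj Y ≅ A) := by
  let P := hA.presentation
  have := HasFilteredColimitsOfSize.HasColimitsOfShape (C := D) P.I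
  have := G.preservesColimitsOfShape_nerve (hG P.I)
  refine ⟨colimit (P.F ⋙ G), ⟨?_⟩⟩
  exact (isColimitOfPreserves G.nerve (colimit.isColimit (P.F ⋙ G))).coconePointsIsoOfNatIso
    P.isColimit (isoWhiskerLeft P.F G.yonedaIsoCompNerve.symm)

include hfilt hG in
theorem exists_indEquivalence [HasFilteredColimitsOfSize.{v, v} D] :
    ∃ e : Ind C ≌ D, Nonempty (Ind.yoneda ⋙ e.functor ≅ G) := by
  let R : D ⥤ ObjectProperty.FullSubcategory (IsIndObject (C := C)) :=
    ObjectProperty.lift _ G.nerve (G.isIndObject_nerve hfilt hG)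
  have : R.EssSurj := ⟨fun A => by
    obtain ⟨Y, ⟨e⟩⟩ := G.exists_nerve_iso hG A.2
    exact ⟨Y, ⟨ObjectProperty.isoMk _ e⟩⟩⟩
  have : R.Full := inferInstanceAs (ObjectProperty.lift _ _ _).Full
  have : R.Faithful := inferInstanceAs (ObjectProperty.lift _ _ _).Faithful
  have : R.IsEquivalence := {}
  refine ⟨(Ind.equivalence C).trans R.asEquivalence.symm, ⟨?_⟩⟩
  let i : ObjectProperty.lift _ CategoryTheory.yoneda isIndObject_yoneda ≅ G ⋙ R :=
    (FullyFaithful.whiskeringRight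
      (FullyFaithful.ofFullyFaithful (ObjectProperty.ι (IsIndObject (C := C)))) C).preimageIso
      G.yonedaIsoCompNerve
  exact isoWhiskerLeft (ObjectProperty.lift _ CategoryTheory.yoneda isIndObject_yoneda)
      (isoWhiskerRight (Ind.equivalence C).counitIso R.inv) ≪≫
    isoWhiskerRight i R.inv ≪≫ isoWhiskerLeft G R.asEquivalence.unitIso.symm

end CategoryTheory.Functor

namespace LightSolid

/-! ### Solid groups as ind-objects -/

section

/-- Finitely presented solid groups are closed under finite colimits, since their inclusion is
exact, and each is itself a finite colimit of copies of `∏_ℕ ℤ`. -/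
lemma colimitsCardinalClosure_prodZ :
    (ObjectProperty.singleton prodZ).colimitsCardinalClosure Cardinal.aleph0.{0} = finPres := by
  apply le_antisymm
  · refine ObjectProperty.colimitsCardinalClosure_le _ _ (fun J _ hJ => ?_) ?_
    · have hA : Finite (Arrow J) := by rwa [hasCardinalLT_aleph0_iff] at hJ
      have : FinCategory J := by
        have h1 : Finite J := Finite.of_injective (fun j => Arrow.mk (𝟙 j)) fun a b h =>
          congrArg (fun f : Arrow J => f.left) h
        have h2 (a b : J) : Finite (a ⟶ b) := Finite.of_injective (fun f => Arrow.mk f)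
          (Arrow.mk_injective a b)
        exact { fintypeObj := Fintype.ofFinite _, fintypeHom _ _ := Fintype.ofFinite _ }
      have : HasColimitsOfShape J SolidFP := inferInstance
      exact finPres.isClosedUnderColimitsOfShape_of_preservesColimitsOfShape_ι J
    · simpa using finPres_prodZ
  · rintro M ⟨f, ⟨e⟩⟩
    refine ObjectProperty.prop_of_iso _ e ?_
    have h : (ObjectProperty.singleton prodZ).colimitsCardinalClosure Cardinal.aleph0.{0} prodZ :=
      ObjectProperty.le_colimitsCardinalClosure _ _ _ (by simp)
    have := (ObjectProperty.singleton prodZ).isClosedUnderColimitsOfShape_colimitsCardinalClosure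
      Cardinal.aleph0.{0} WalkingParallelPair (by
        rw [hasCardinalLT_aleph0_iff]; infer_instance)
    refine ObjectProperty.prop_colimit _ _ ?_
    rintro (_ | _) <;> exact h

/-- For a strong generator consisting of a compact object, the compact objects are exactly its
closure under finite colimits. -/
lemma finPres_eq_isCardinalPresentable :
    finPres = isCardinalPresentable Solid Cardinal.aleph0.{0} := by
  rw [← colimitsCardinalClosure_prodZ]
  exact (IsStrongGenerator.colimitsCardinalClosure_eq_isCardinalPresentable
    isStrongGenerator_prodZ singleton_prodZ_le).symm

instance : finPres.ι.IsDense := by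
  rw [← colimitsCardinalClosure_prodZ]
  exact isStrongGenerator_prodZ.isDense_colimitsCardinalClosure_ι singleton_prodZ_le

instance (M : Solid) : IsFiltered (CostructuredArrow finPres.ι M) := by
  rw [← colimitsCardinalClosure_prodZ]
  infer_instance

instance : ObjectProperty.EssentiallySmall.{0} finPres := by
  rw [← colimitsCardinalClosure_prodZ]
  infer_instance

instance : EssentiallySmall.{0} SolidFP := inferInstance

instance (M : SolidFP) : IsCardinalPresentable (finPres.ι.obj M) Cardinal.aleph0.{0} := by
  exact (isCardinalPresentable_iff _ _).1
    (finPres_eq_isCardinalPresentable.le _ M.property)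

instance : smallSolidFPι.Full := inferInstanceAs (_ ⋙ _).Full
instance : smallSolidFPι.Faithful := inferInstanceAs (_ ⋙ _).Faithful
instance : smallSolidFPι.IsDense := inferInstanceAs (_ ⋙ _).IsDense

instance (M : Solid) : IsFiltered (CostructuredArrow smallSolidFPι M) :=
  IsFiltered.of_equivalence
    (CostructuredArrow.pre (ShrinkHoms.equivalence.{0} SolidFP).inverse
      finPres.ι M).asEquivalence.symm

/-- The inclusion of finitely presented solid abelian groups into solid abelian groups, with
morphisms in `Type` on both sides. -/
def shrinkSolidFPι : SmallSolidFP ⥤ ShrinkHoms.{1} Solid :=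
  smallSolidFPι ⋙ (ShrinkHoms.equivalence.{0} Solid).functor

/-- The general criterion needs morphisms on both sides in the universe of the indexing diagrams, so
it is applied to `Solid` with shrunken hom-sets and the result is transported back. -/
theorem exists_indEquivalence : ∃ e : Ind SmallSolidFP ≌ Solid,
    Nonempty (Ind.yoneda ⋙ e.functor ≅ smallSolidFPι) := by
  have : EssentiallySmall.{0} SmallSolidFP :=
    (essentiallySmall_congr (ShrinkHoms.equivalence.{0} SolidFP)).1 inferInstance
  have : shrinkSolidFPι.Full := inferInstanceAs (_ ⋙ _).Full
  have : shrinkSolidFPι.Faithful := inferInstanceAs (_ ⋙ _).Faithful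
  have : shrinkSolidFPι.IsDense := inferInstanceAs (_ ⋙ _).IsDense
  have : HasColimitsOfSize.{0, 0} (ShrinkHoms.{1} Solid) :=
    Adjunction.has_colimits_of_equivalence (ShrinkHoms.equivalence.{0} Solid).inverse
  have hcolim : HasFilteredColimitsOfSize.{0, 0} (ShrinkHoms.{1} Solid) := ⟨inferInstance⟩
  have hfilt (Y : ShrinkHoms.{1} Solid) : IsFiltered (CostructuredArrow shrinkSolidFPι Y) :=
    IsFiltered.of_equivalence (CostructuredArrow.post smallSolidFPι
      (ShrinkHoms.equivalence.{0} Solid).functor (ShrinkHoms.fromShrinkHoms Y)).asEquivalence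
  obtain ⟨e, ⟨i⟩⟩ := shrinkSolidFPι.exists_indEquivalence hfilt fun J _ _ X => by
    have : IsCardinalPresentable (shrinkSolidFPι.obj X) Cardinal.aleph0.{0} :=
      inferInstanceAs (IsCardinalPresentable ((ShrinkHoms.equivalence.{0} Solid).functor.obj
        (finPres.ι.obj ((ShrinkHoms.equivalence.{0} SolidFP).inverse.obj X))) _)
    have : IsCardinalFiltered J Cardinal.aleph0.{0} := (isCardinalFiltered_aleph0_iff J).2 ‹_›
    exact preservesColimitsOfShape_of_isCardinalPresentable _ Cardinal.aleph0.{0} J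
  refine ⟨e.trans (ShrinkHoms.equivalence.{0} Solid).symm, ⟨?_⟩⟩
  exact Functor.isoWhiskerRight i (ShrinkHoms.equivalence.{0} Solid).inverse ≪≫
    Functor.associator _ _ _ ≪≫
    Functor.isoWhiskerLeft smallSolidFPι (ShrinkHoms.equivalence.{0} Solid).unitIso.symm ≪≫
    Functor.rightUnitor _

end

/-! ### `P ⊗ P` is isomorphic to `P` -/

section

section Square

variable {A B : LightCondAb}

/-- The section over `S × T` underlying a morphism from `ℤ[S] ⊗ ℤ[T]`. -/
def tensorVal {S T : LightProfinite.{0}} (g : freeAb.obj S ⊗ freeAb.obj T ⟶ A) : Sec A (S ⊗ T) :=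
  freeEquiv (S ⊗ T) A ((Functor.Monoidal.μIso freeAb S T).inv ≫ g)

lemma tensorVal_bijective (S T : LightProfinite.{0}) :
    Function.Bijective (tensorVal : (freeAb.obj S ⊗ freeAb.obj T ⟶ A) → _) := by
  refine (freeEquiv (S ⊗ T) A).bijective.comp ⟨fun g h hgh => (cancel_epi _).1 hgh, fun g =>
    ⟨(Functor.Monoidal.μIso freeAb S T).hom ≫ g, Iso.inv_hom_id_assoc _ _⟩⟩

lemma tensorVal_zero (S T : LightProfinite.{0}) :
    tensorVal (0 : freeAb.obj S ⊗ freeAb.obj T ⟶ A) = 0 := by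
  unfold tensorVal
  rw [comp_zero]
  exact freeEquiv_zero _ _

lemma tensorVal_comp {S T : LightProfinite.{0}} (g : freeAb.obj S ⊗ freeAb.obj T ⟶ A)
    (f : A ⟶ B) : tensorVal (g ≫ f) = secMap f _ (tensorVal g) := by
  unfold tensorVal
  rw [← freeEquiv_comp', Category.assoc]

lemma res_tensorVal {S S' T T' : LightProfinite.{0}} (φ : S ⟶ S') (χ : T ⟶ T')
    (g : freeAb.obj S' ⊗ freeAb.obj T' ⟶ A) :
    res A (φ ⊗ₘ χ) (tensorVal g) = tensorVal ((freeAb.map φ ⊗ₘ freeAb.map χ) ≫ g) := by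
  unfold tensorVal
  rw [← freeEquiv_map']
  congr 1
  rw [Iso.eq_inv_comp]
  have h := Functor.LaxMonoidal.μ_natural freeAb φ χ
  refine (Category.assoc _ _ _).symm.trans ?_
  refine (congrArg (· ≫ (Functor.Monoidal.μIso freeAb S' T').inv ≫ g) h.symm).trans ?_
  refine (Category.assoc _ _ _).trans ?_
  exact congrArg (_ ≫ ·) ((Functor.Monoidal.μIso freeAb S' T').hom_inv_id_assoc g)

/-- The section over `(ℕ ∪ {∞})²` underlying a morphism from `P ⊗ P`. -/
def squareVal (g : nullSeq ⊗ nullSeq ⟶ A) : Sec A (ℕ∪{∞} ⊗ ℕ∪{∞}) :=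
  tensorVal ((nullSeqπ ⊗ₘ nullSeqπ) ≫ g)

instance (X : LightCondAb) : Epi (X ◁ nullSeqπ) :=
  inferInstanceAs (Epi ((tensorLeft X).map nullSeqπ))

instance : Epi (nullSeqπ ⊗ₘ nullSeqπ) := by
  rw [MonoidalCategory.tensorHom_def]
  exact epi_comp _ _

lemma squareVal_injective : Function.Injective (squareVal : (nullSeq ⊗ nullSeq ⟶ A) → _) :=
  (tensorVal_bijective _ _).1.comp fun _ _ h => (cancel_epi _).1 h

lemma squareVal_comp (g : nullSeq ⊗ nullSeq ⟶ A) (f : A ⟶ B) :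
    squareVal (g ≫ f) = secMap f _ (squareVal g) := by
  unfold squareVal
  rw [← tensorVal_comp, Category.assoc]

instance (X : LightCondAb) : (tensorLeft X).Additive :=
  have : PreservesColimitsOfShape (Discrete WalkingPair) (tensorLeft X) :=
    PreservesColimitsOfSize.preservesColimitsOfShape.{0, 0}
  have := preservesBinaryBiproducts_of_preservesBinaryCoproducts (tensorLeft X)
  Functor.additive_of_preservesBinaryBiproducts _

lemma res_left_squareVal (g : nullSeq ⊗ nullSeq ⟶ A) :
    res A (pointInfty ⊗ₘ 𝟙 ℕ∪{∞}) (squareVal g) = 0 := by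
  unfold squareVal
  rw [res_tensorVal, tensorHom_comp_tensorHom_assoc, pointInfty_nullSeqπ, MonoidalCategory.tensorHom_def,
    Category.assoc]
  refine Eq.trans (congrArg _ ?_) (tensorVal_zero _ _)
  exact (congrArg (· ≫ _) ((tensorRight _).map_zero _ _)).trans zero_comp

lemma res_right_squareVal (g : nullSeq ⊗ nullSeq ⟶ A) :
    res A (𝟙 ℕ∪{∞} ⊗ₘ pointInfty) (squareVal g) = 0 := by
  unfold squareVal
  rw [res_tensorVal, tensorHom_comp_tensorHom_assoc, pointInfty_nullSeqπ, tensorHom_def',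
    Category.assoc]
  refine Eq.trans (congrArg _ ?_) (tensorVal_zero _ _)
  exact (congrArg (· ≫ _) ((tensorLeft _).map_zero _ _)).trans zero_comp

lemma nullSeqπ_retract : nullSeqπ ≫ nullSeqRetract.i = 𝟙 (freeAb.obj ℕ∪{∞}) -
    freeAb.map (CompHausLike.isTerminalPUnit.from ℕ∪{∞}) ≫ freeAb.map pointInfty := by
  rw [← freeAb.map_comp]
  exact nullSeqπ_desc _ _

/-- Every additive functor preserves the cokernel defining `P`. -/
lemma exists_map_nullSeqπ_comp {C : Type*} [Category C] [Preadditive C] (F : LightCondAb ⥤ C)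
    [F.Additive] {Y : C} (k : F.obj (freeAb.obj ℕ∪{∞}) ⟶ Y)
    (hk : F.map (freeAb.map pointInfty) ≫ k = 0) : ∃ g, F.map nullSeqπ ≫ g = k := by
  refine ⟨F.map nullSeqRetract.i ≫ k, ?_⟩
  rw [← F.map_comp_assoc, nullSeqπ_retract, F.map_sub, F.map_id, Preadditive.sub_comp,
    Category.id_comp, F.map_comp, Category.assoc, hk, comp_zero, sub_zero]

/-- The section descends to `P` in one variable at a time, each time because the cokernel defining
`P` is preserved by additive functors. -/
lemma exists_squareVal (f : Sec A (ℕ∪{∞} ⊗ ℕ∪{∞}))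
    (h₁ : res A (pointInfty ⊗ₘ 𝟙 ℕ∪{∞}) f = 0) (h₂ : res A (𝟙 ℕ∪{∞} ⊗ₘ pointInfty) f = 0) :
    ∃ g : nullSeq ⊗ nullSeq ⟶ A, squareVal g = f := by
  obtain ⟨k, rfl⟩ := (tensorVal_bijective _ _).2 f
  rw [res_tensorVal, ← tensorVal_zero] at h₁ h₂
  replace h₁ := (tensorVal_bijective _ _).1 h₁
  replace h₂ := (tensorVal_bijective _ _).1 h₂
  rw [freeAb.map_id, tensorHom_id] at h₁
  rw [freeAb.map_id, id_tensorHom] at h₂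
  obtain ⟨g, rfl⟩ := exists_map_nullSeqπ_comp (tensorRight (freeAb.obj ℕ∪{∞})) k h₁
  have h₃ : (nullSeq ◁ freeAb.map pointInfty) ≫ g = 0 := by
    rw [← cancel_epi (nullSeqπ ▷ _), comp_zero, ← whisker_exchange_assoc]
    exact h₂
  obtain ⟨l, rfl⟩ := exists_map_nullSeqπ_comp (tensorLeft nullSeq) g h₃
  refine ⟨l, ?_⟩
  unfold squareVal
  rw [MonoidalCategory.tensorHom_def, Category.assoc]
  rfl

/-- The map `(ℕ ∪ {∞})² → ℕ ∪ {∞}` which sends the two axes to `∞` and is a bijection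
elsewhere. -/
def collapseFun (w : OnePoint ℕ × OnePoint ℕ) : OnePoint ℕ :=
  w.1.elim OnePoint.infty fun n => w.2.elim OnePoint.infty fun m => OnePoint.some (Nat.pair n m)

lemma collapseFun_coe (n m : ℕ) : collapseFun (OnePoint.some n, OnePoint.some m) =
    OnePoint.some (Nat.pair n m) := rfl

lemma collapseFun_right (x : OnePoint ℕ) :
    collapseFun (x, OnePoint.infty) = OnePoint.infty := by
  induction x using OnePoint.rec <;> rfl

lemma collapseFun_eq_coe {w : OnePoint ℕ × OnePoint ℕ} {k : ℕ}
    (h : collapseFun w = OnePoint.some k) :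
    w = (OnePoint.some k.unpair.1, OnePoint.some k.unpair.2) := by
  obtain ⟨x, y⟩ := w
  induction x using OnePoint.rec with
  | infty => exact absurd h (OnePoint.infty_ne_coe k)
  | coe n =>
    induction y using OnePoint.rec with
    | infty => exact absurd h (OnePoint.infty_ne_coe k)
    | coe m =>
      have h2 : Nat.pair n m = k := OnePoint.coe_injective h
      rw [← h2, Nat.unpair_pair]

lemma collapseFun_unpair (k : ℕ) :
    collapseFun (OnePoint.some k.unpair.1, OnePoint.some k.unpair.2) = OnePoint.some k := by
  rw [collapseFun_coe, Nat.pair_unpair]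

lemma collapseFun_eq_infty {w : OnePoint ℕ × OnePoint ℕ}
    (h : collapseFun w = OnePoint.infty) : w.1 = OnePoint.infty ∨ w.2 = OnePoint.infty := by
  obtain ⟨x, y⟩ := w
  induction x using OnePoint.rec with
  | infty => exact .inl rfl
  | coe n =>
    induction y using OnePoint.rec with
    | infty => exact .inr rfl
    | coe m => exact absurd h (OnePoint.coe_ne_infty _)

lemma continuous_collapseFun : Continuous collapseFun := by
  refine continuous_onePoint fun k => ?_
  convert (isClopen_singleton_coe k.unpair.1).prod (isClopen_singleton_coe k.unpair.2) using 1
  ext w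
  simp only [Set.mem_ofPred_eq, Set.mem_prod, Set.mem_singleton_iff]
  constructor
  · intro h
    rw [collapseFun_eq_coe h]
    exact ⟨rfl, rfl⟩
  · rintro ⟨h₁, h₂⟩
    rw [← collapseFun_unpair k, ← h₁, ← h₂]

/-- The map `(ℕ ∪ {∞})² ⟶ ℕ ∪ {∞}` collapsing the axes. -/
def collapse : ℕ∪{∞} ⊗ ℕ∪{∞} ⟶ ℕ∪{∞} := mkHom collapseFun continuous_collapseFun

lemma collapse_surjective : Function.Surjective collapse := fun (y : OnePoint ℕ) => by
  induction y using OnePoint.rec with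
  | infty => exact ⟨(OnePoint.infty, OnePoint.infty), rfl⟩
  | coe k => exact ⟨(OnePoint.some k.unpair.1, OnePoint.some k.unpair.2), collapseFun_unpair k⟩

lemma res_left_res_collapse (f : Sec A ℕ∪{∞}) (hf : res A pointInfty f = 0) :
    res A (pointInfty ⊗ₘ 𝟙 ℕ∪{∞}) (res A collapse f) = 0 := by
  have h : (pointInfty ⊗ₘ 𝟙 ℕ∪{∞}) ≫ collapse =
      CompHausLike.isTerminalPUnit.from _ ≫ pointInfty := rfl
  rw [res_res, h, ← res_res, hf, map_zero]

lemma res_right_res_collapse (f : Sec A ℕ∪{∞}) (hf : res A pointInfty f = 0) :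
    res A (𝟙 ℕ∪{∞} ⊗ₘ pointInfty) (res A collapse f) = 0 := by
  have h : (𝟙 ℕ∪{∞} ⊗ₘ pointInfty) ≫ collapse =
      CompHausLike.isTerminalPUnit.from _ ≫ pointInfty :=
    hom_ext_point fun w => collapseFun_right w.1
  rw [res_res, h, ← res_res, hf, map_zero]

/-- The inclusion of the two axes into `(ℕ ∪ {∞})²`. -/
def axes : LightProfinite.of (OnePoint ℕ ⊕ OnePoint ℕ) ⟶ ℕ∪{∞} ⊗ ℕ∪{∞} :=
  mkHom (Sum.elim (fun x : OnePoint ℕ => ((OnePoint.infty, x) : OnePoint ℕ × OnePoint ℕ))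
    (fun x : OnePoint ℕ => ((x, OnePoint.infty) : OnePoint ℕ × OnePoint ℕ))) (by fun_prop)

/-- `collapse` is injective away from the axes, where `f` vanishes, so `exists_res_eq` applies. -/
lemma exists_res_collapse (f : Sec A (ℕ∪{∞} ⊗ ℕ∪{∞}))
    (h₁ : res A (pointInfty ⊗ₘ 𝟙 ℕ∪{∞}) f = 0) (h₂ : res A (𝟙 ℕ∪{∞} ⊗ₘ pointInfty) f = 0) :
    ∃ b, res A pointInfty b = 0 ∧ res A collapse b = f := by
  have hax {w : OnePoint ℕ × OnePoint ℕ} (h : collapseFun w = OnePoint.infty) :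
      ∃ z, axes z = w := by
    obtain ⟨x, y⟩ := w
    rcases collapseFun_eq_infty h with rfl | rfl
    · exact ⟨Sum.inl y, rfl⟩
    · exact ⟨Sum.inr x, rfl⟩
  have h0 : res A axes f = 0 := by
    let inl : ℕ∪{∞} ⟶ LightProfinite.of (OnePoint ℕ ⊕ OnePoint ℕ) := mkHom Sum.inl (by fun_prop)
    let inr : ℕ∪{∞} ⟶ LightProfinite.of (OnePoint ℕ ⊕ OnePoint ℕ) := mkHom Sum.inr (by fun_prop)
    refine eq_of_jointly_surjective inl inr ?_ ?_ ?_
    · rintro (x | x)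
      · exact .inl ⟨x, rfl⟩
      · exact .inr ⟨x, rfl⟩
    · let i : ℕ∪{∞} ⟶ LightProfinite.of PUnit.{1} ⊗ ℕ∪{∞} :=
        mkHom (fun s => (⟨⟩, s)) (continuous_const.prodMk continuous_id)
      have h : inl ≫ axes = i ≫ (pointInfty ⊗ₘ 𝟙 ℕ∪{∞}) := rfl
      rw [res_res, h, ← res_res, h₁, map_zero, map_zero]
    · let i : ℕ∪{∞} ⟶ ℕ∪{∞} ⊗ LightProfinite.of PUnit.{1} :=
        mkHom (fun s => (s, ⟨⟩)) (continuous_id.prodMk continuous_const)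
      have h : inr ≫ axes = i ≫ (𝟙 ℕ∪{∞} ⊗ₘ pointInfty) := rfl
      rw [res_res, h, ← res_res, h₂, map_zero, map_zero]
  obtain ⟨b, hb⟩ := exists_res_eq collapse collapse_surjective axes (fun w w' h => by
    change collapseFun w = collapseFun w' at h
    cases hw : collapseFun w' using OnePoint.rec with
    | infty => exact .inr ⟨hax (h.trans hw), hax hw⟩
    | coe k => exact .inl ((collapseFun_eq_coe (h.trans hw)).trans (collapseFun_eq_coe hw).symm))
    f h0
  refine ⟨b, ?_, hb⟩
  let i : LightProfinite.of PUnit.{1} ⟶ LightProfinite.of (OnePoint ℕ ⊕ OnePoint ℕ) :=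
    mkHom (fun _ => Sum.inl OnePoint.infty) continuous_const
  have h : pointInfty = i ≫ axes ≫ collapse := rfl
  rw [h, ← res_res, ← res_res, hb, h0, map_zero]

/-- The morphism `P ⊗ P ⟶ P` induced by the map collapsing the axes. -/
def squareMap : nullSeq ⊗ nullSeq ⟶ nullSeq :=
  (exists_squareVal (res _ collapse (nullVal (𝟙 nullSeq)))
    (res_left_res_collapse _ (res_pointInfty_nullVal _))
    (res_right_res_collapse _ (res_pointInfty_nullVal _))).choose

lemma squareVal_squareMap_comp (g : nullSeq ⟶ A) :
    squareVal (squareMap ≫ g) = res A collapse (nullVal g) := by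
  have h : squareVal squareMap = res _ collapse (nullVal (𝟙 nullSeq)) :=
    (exists_squareVal (res _ collapse (nullVal (𝟙 nullSeq)))
      (res_left_res_collapse _ (res_pointInfty_nullVal _))
      (res_right_res_collapse _ (res_pointInfty_nullVal _))).choose_spec
  rw [squareVal_comp, h, ← res_secMap, ← nullVal_comp, Category.id_comp]

/-- `P ⊗ P` is isomorphic to `P`. -/
instance : IsIso squareMap := by
  -- Maps out of `P ⊗ P` are sections over the square vanishing on the axes, and `collapse`
  -- identifies these with sections over `ℕ ∪ {∞}` vanishing at `∞`, that is, with maps out of `P`.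
  refine (isIso_iff_coyoneda_map_bijective _).2 fun B => ⟨fun g h hgh => ?_, fun g => ?_⟩
  · have h1 := congrArg squareVal hgh
    rw [squareVal_squareMap_comp, squareVal_squareMap_comp] at h1
    exact nullVal_injective (eq_of_surjective collapse collapse_surjective h1)
  · obtain ⟨b, hb, hb'⟩ := exists_res_collapse (squareVal g) (res_left_squareVal g)
      (res_right_squareVal g)
    obtain ⟨h, rfl⟩ := exists_nullVal b hb
    refine ⟨h, squareVal_injective ?_⟩
    rw [← hb', ← squareVal_squareMap_comp]

end Square

end

/-! ### Coordinates of `P` and of `P ⊗ P` -/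

section

/-- The isomorphism between the tensor unit and the discrete group `ℤ`. -/
def unitToInt : 𝟙_ LightCondAb ⟶ intZ :=
  (Functor.Monoidal.εIso freeAb).hom ≫ (freeEquiv (𝟙_ LightProfinite) intZ).symm
    (mkInt (fun _ => 1) continuous_const)

instance : IsIso unitToInt := by
  let e : 𝟙_ LightProfinite.{0} ≅ pt := ⟨mkHom (fun _ => ⟨⟩) continuous_const,
    mkHom (fun _ => PUnit.unit) continuous_const, rfl, rfl⟩
  have h : (freeEquiv (𝟙_ LightProfinite) intZ).symm (mkInt (fun _ => 1) continuous_const) =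
      freeAb.map e.hom ≫ freePtToInt := by
    rw [Equiv.symm_apply_eq, freeEquiv_map', freePtToInt, Equiv.apply_symm_apply]
    rfl
  unfold unitToInt
  rw [h]
  exact IsIso.comp_isIso' inferInstance (IsIso.comp_isIso' (freeAb.mapIso e).isIso_hom inferInstance)

/-- The `n`-th coordinate `P ⟶ 1`. -/
def coordUnit (n : ℕ) : nullSeq ⟶ 𝟙_ LightCondAb :=
  (exists_nullVal (deltaSec n) (res_pointInfty_deltaSec n)).choose ≫ inv unitToInt

lemma nullVal_coordUnit (n : ℕ) : nullVal (coordUnit n ≫ unitToInt) = deltaSec n := by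
  unfold coordUnit
  rw [Category.assoc, IsIso.inv_hom_id, Category.comp_id]
  exact (exists_nullVal (deltaSec n) (res_pointInfty_deltaSec n)).choose_spec

/-- A point of `ℕ ∪ {∞}`. -/
def natPoint (s : OnePoint ℕ) : 𝟙_ LightProfinite.{0} ⟶ ℕ∪{∞} := mkHom (fun _ => s) continuous_const

/-- The morphism `1 ⟶ P` attached to a point of `ℕ ∪ {∞}`. -/
def nullPoint (s : OnePoint ℕ) : 𝟙_ LightCondAb ⟶ nullSeq :=
  (Functor.Monoidal.εIso freeAb).hom ≫ freeAb.map (natPoint s) ≫ nullSeqπ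

lemma nullPoint_coordUnit_self (n : ℕ) :
    nullPoint (OnePoint.some n) ≫ coordUnit n = 𝟙 _ := by
  rw [← cancel_mono unitToInt, Category.id_comp]
  unfold nullPoint unitToInt
  simp only [Category.assoc]
  congr 1
  rw [Equiv.eq_symm_apply, freeEquiv_map']
  have h := nullVal_coordUnit n
  unfold nullVal unitToInt at h
  rw [h]
  exact val_injective (funext fun s => congrArg Nat.cast (delta_pos n))

lemma nullPoint_coordUnit_of_ne {n : ℕ} {s : OnePoint ℕ} (hs : s ≠ OnePoint.some n) :
    nullPoint s ≫ coordUnit n = 0 := by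
  rw [← cancel_mono unitToInt, zero_comp]
  unfold nullPoint
  simp only [Category.assoc]
  refine Eq.trans (congrArg _ ?_) comp_zero
  apply (freeEquiv _ _).injective
  rw [freeEquiv_map', freeEquiv_zero]
  have h := nullVal_coordUnit n
  unfold nullVal at h
  rw [h]
  exact val_injective (funext fun _ => congrArg Nat.cast (delta_neg hs))

section

variable {A : LightCondAb}

lemma nullPoint_tensor_comp (s t : OnePoint ℕ) (g : nullSeq ⊗ nullSeq ⟶ A) :
    (nullPoint s ⊗ₘ nullPoint t) ≫ g =
      ((Functor.Monoidal.εIso freeAb).hom ⊗ₘ (Functor.Monoidal.εIso freeAb).hom) ≫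
        (freeAb.map (natPoint s) ⊗ₘ freeAb.map (natPoint t)) ≫ (nullSeqπ ⊗ₘ nullSeqπ) ≫ g := by
  unfold nullPoint
  simp only [← tensorHom_comp_tensorHom, Category.assoc]

lemma nullPoint_tensor_comp_eq_iff (s t : OnePoint ℕ) (g h : nullSeq ⊗ nullSeq ⟶ A) :
    (nullPoint s ⊗ₘ nullPoint t) ≫ g = (nullPoint s ⊗ₘ nullPoint t) ≫ h ↔
      res A (natPoint s ⊗ₘ natPoint t) (squareVal g) =
        res A (natPoint s ⊗ₘ natPoint t) (squareVal h) := by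
  rw [nullPoint_tensor_comp, nullPoint_tensor_comp, cancel_epi]
  unfold squareVal
  rw [res_tensorVal, res_tensorVal]
  exact (tensorVal_bijective _ _).1.eq_iff.symm

/-- As the unit is `ℤ`, a map from `P ⊗ P` to it is an integer-valued function on the square,
determined by its values at points. -/
lemma eq_of_nullPoint_tensor_comp {g h : nullSeq ⊗ nullSeq ⟶ 𝟙_ LightCondAb}
    (H : ∀ s t, (nullPoint s ⊗ₘ nullPoint t) ≫ g = (nullPoint s ⊗ₘ nullPoint t) ≫ h) : g = h := by
  rw [← cancel_mono unitToInt]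
  refine squareVal_injective (val_injective (funext fun w => ?_))
  have h1 := (nullPoint_tensor_comp_eq_iff w.1 w.2 (g ≫ unitToInt) (h ≫ unitToInt)).1 (by
    rw [← Category.assoc, H, Category.assoc])
  exact congrFun (congrArg val h1) (PUnit.unit, PUnit.unit)

lemma nullPoint_tensor_comp_squareMap_eq_zero {s t : OnePoint ℕ} {k : ℕ}
    (h : collapseFun (s, t) ≠ OnePoint.some k) :
    (nullPoint s ⊗ₘ nullPoint t) ≫ squareMap ≫ coordUnit k = 0 := by
  rw [← cancel_mono unitToInt, zero_comp, Category.assoc, Category.assoc,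
    ← comp_zero (f := nullPoint s ⊗ₘ nullPoint t), nullPoint_tensor_comp_eq_iff,
    squareVal_squareMap_comp, nullVal_coordUnit]
  have h0 : squareVal (0 : nullSeq ⊗ nullSeq ⟶ intZ) = 0 := by
    unfold squareVal
    rw [comp_zero, tensorVal_zero]
  rw [h0, map_zero]
  exact val_injective (funext fun _ => congrArg Nat.cast (delta_neg h))

/-- The coordinates of `P ⊗ P ≅ P` are the tensor products of the coordinates of `P`. -/
lemma exists_squareMap_coordUnit (k : ℕ) : ∃ w, squareMap ≫ coordUnit k =
    (coordUnit k.unpair.1 ⊗ₘ coordUnit k.unpair.2) ≫ w := by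
  -- The factor `w` is the value of the left side at the only point `(s, t)` of the square
  -- collapsing to `k`. At all other points both sides vanish.
  refine ⟨(nullPoint (OnePoint.some k.unpair.1) ⊗ₘ nullPoint (OnePoint.some k.unpair.2)) ≫
    squareMap ≫ coordUnit k, eq_of_nullPoint_tensor_comp fun s t => ?_⟩
  rw [tensorHom_comp_tensorHom_assoc]
  by_cases hs : s = OnePoint.some k.unpair.1
  · by_cases ht : t = OnePoint.some k.unpair.2
    · rw [hs, ht, nullPoint_coordUnit_self, nullPoint_coordUnit_self, id_tensorHom_id,
        Category.id_comp]
    · rw [nullPoint_coordUnit_of_ne ht, nullPoint_tensor_comp_squareMap_eq_zero fun h =>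
        ht (Prod.ext_iff.1 (collapseFun_eq_coe h)).2, MonoidalCategory.tensorHom_def',
        Category.assoc]
      exact (congrArg (· ≫ _) ((tensorLeft _).map_zero _ _)).trans zero_comp |>.symm
  · rw [nullPoint_coordUnit_of_ne hs, nullPoint_tensor_comp_squareMap_eq_zero fun h =>
        hs (Prod.ext_iff.1 (collapseFun_eq_coe h)).1, MonoidalCategory.tensorHom_def,
        Category.assoc]
    exact (congrArg (· ≫ _) ((tensorRight _).map_zero _ _)).trans zero_comp |>.symm

end

end

/-! ### Tensoring monic endomorphisms of `∏_ℕ ℤ` -/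

section

lemma basisMap_π (n : ℕ) : basisMap ≫ Pi.π (fun _ : ℕ => intZ) n = coordUnit n ≫ unitToInt := by
  refine nullVal_injective (val_injective (funext fun s => ?_))
  rw [nullVal_coordUnit, nullVal_comp, nullVal_basisMap]
  exact val_coord_basisSec n s

/-- The discrete group `ℤ` as a solid abelian group. -/
def solidZ : Solid := ⟨intZ, isSolid_intZ⟩

/-- The coordinates of `∏_ℕ ℤ`. -/
def prodZπ (n : ℕ) : prodZ ⟶ solidZ := ObjectProperty.homMk (Pi.π (fun _ : ℕ => intZ) n)

lemma solidificationNullSeqIso_hom_π (n : ℕ) : solidificationNullSeqIso.hom ≫ prodZπ n =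
    solidification.map (coordUnit n) ≫ solidification.map unitToInt ≫ (counitIso solidZ).hom := by
  have h : (counitIso prodZ).hom ≫ prodZπ n =
      solidification.map (Pi.π (fun _ : ℕ => intZ) n) ≫ (counitIso solidZ).hom :=
    (solidificationAdj.counit.naturality (prodZπ n)).symm
  have h2 := (solidification.map_comp basisMap (Pi.π (fun _ : ℕ => intZ) n)).symm.trans
    ((congrArg solidification.map (basisMap_π n)).trans
      (solidification.map_comp (coordUnit n) unitToInt))
  refine (Category.assoc _ _ _).trans ((congrArg (_ ≫ ·) h).trans ?_)
  refine (Category.assoc _ _ _).symm.trans ((congrArg (· ≫ _) h2).trans ?_)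
  exact Category.assoc _ _ _

/-- Under the isomorphism with `∏_ℕ ℤ` the solidified coordinates become the projections, up to the
identification of the unit with `ℤ`. -/
lemma eq_zero_of_comp_coordUnit {A : Solid} (y : A ⟶ solidification.obj nullSeq)
    (h : ∀ n, y ≫ solidification.map (coordUnit n) = 0) : y = 0 := by
  rw [← cancel_mono solidificationNullSeqIso.hom, zero_comp]
  refine ObjectProperty.hom_ext _ (Limits.Pi.hom_ext _ _ fun n => ?_)
  have h1 : (y ≫ solidificationNullSeqIso.hom) ≫ prodZπ n = 0 := by
    rw [Category.assoc, solidificationNullSeqIso_hom_π, reassoc_of% (h n), zero_comp]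
  exact (congrArg (fun z => z.hom) h1).trans zero_comp.symm

/-- Via `P ⊗ P ≅ P` this follows from the case of `P`, since each coordinate there factors through a
tensor product of two coordinates. -/
lemma eq_zero_of_comp_coordUnit_tensor {A : Solid} (y : A ⟶ solidification.obj (nullSeq ⊗ nullSeq))
    (h : ∀ n m, y ≫ solidification.map (coordUnit n ⊗ₘ coordUnit m) = 0) : y = 0 := by
  rw [← cancel_mono (solidification.map squareMap), zero_comp]
  refine eq_zero_of_comp_coordUnit _ fun k => ?_
  obtain ⟨w, hw⟩ := exists_squareMap_coordUnit k
  rw [Category.assoc, ← solidification.map_comp, hw, solidification.map_comp, ← Category.assoc, h,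
    zero_comp]

/-- The morphisms `P ⊗ P ⟶ P` given by the coordinates of the first factor are jointly monic after
solidification. -/
lemma eq_zero_of_comp_coordUnit_whiskerRight {A : Solid}
    (y : A ⟶ solidification.obj nullSeq ⊗ solidification.obj nullSeq)
    (h : ∀ n, y ≫ (solidification.map (coordUnit n) ▷ solidification.obj nullSeq) = 0) :
    y = 0 := by
  rw [← cancel_mono (Functor.LaxMonoidal.μ solidification nullSeq nullSeq), zero_comp]
  refine eq_zero_of_comp_coordUnit_tensor _ fun n m => ?_
  rw [MonoidalCategory.tensorHom_def, solidification.map_comp, Category.assoc,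
    ← Functor.LaxMonoidal.μ_natural_left_assoc, reassoc_of% (h n), zero_comp]

/-- Apply a coordinate to the first factor of an element `y` killed by the tensored map. The result
lies in `1 ⊗ P ≅ P` (solidified) and is killed by the monomorphism `f`, so it vanishes. The
coordinates of the first factor are jointly monic, hence `y = 0`. -/
lemma mono_tensor_of_mono (f : solidification.obj nullSeq ⟶ solidification.obj nullSeq) [Mono f] :
    Mono (solidification.obj nullSeq ◁ f) := by
  refine Preadditive.mono_of_cancel_zero _ fun {A} y hy => ?_
  refine eq_zero_of_comp_coordUnit_whiskerRight y fun n => ?_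
  let e : solidification.obj (𝟙_ LightCondAb) ≅ 𝟙_ Solid := (Functor.Monoidal.εIso _).symm
  rw [← cancel_mono (e.hom ▷ solidification.obj nullSeq), ← cancel_mono (λ_ _).hom,
    ← cancel_mono f]
  simp only [zero_comp, Category.assoc]
  rw [← leftUnitor_naturality, ← whisker_exchange_assoc, ← whisker_exchange_assoc,
    reassoc_of% hy, zero_comp]

end

/-! ### Right exactness of the solid tensor product, and pushouts of presentations -/

section

/-- A functor out of a reflective subcategory preserves the colimits which are preserved by its
composition with the reflector. -/
lemma preservesColimitsOfShape_of_reflective {C D E : Type*} [Category C] [Category D] [Category E]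
    {i : D ⥤ C} {L : C ⥤ D} (adj : L ⊣ i) [i.Full] [i.Faithful] (G : D ⥤ E) (J : Type*) [Category J]
    [HasColimitsOfShape J C] [PreservesColimitsOfShape J (L ⋙ G)] :
    PreservesColimitsOfShape J G where
  preservesColimit {K} := by
    have := adj.leftAdjoint_preservesColimits
    have h : PreservesColimit ((K ⋙ i) ⋙ L) G :=
      preservesColimit_of_preserves_colimit_cocone
        (isColimitOfPreserves L (colimit.isColimit (K ⋙ i)))
        (isColimitOfPreserves (L ⋙ G) (colimit.isColimit (K ⋙ i)))
    exact preservesColimit_of_iso_diagram G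
      (Functor.associator _ _ _ ≪≫ Functor.isoWhiskerLeft K (asIso adj.counit) ≪≫
        Functor.rightUnitor K)

/-- Solidification is monoidal, so composing this functor with solidification gives tensoring with
`Y` followed by solidification; both are left adjoints. -/
instance (Y : LightCondAb) (J : Type) [SmallCategory J] :
    PreservesColimitsOfShape J (tensorLeft (solidification.obj Y)) := by
  have : PreservesColimitsOfShape J solidification :=
    solidificationAdj.leftAdjoint_preservesColimits.preservesColimitsOfShape
  have : PreservesColimitsOfShape J (solidification ⋙ tensorLeft (solidification.obj Y)) :=
    preservesColimitsOfShape_of_natIso (Functor.Monoidal.commTensorLeft solidification Y).symm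
  exact preservesColimitsOfShape_of_reflective solidificationAdj _ J

section Abelian

variable {C D : Type*} [Category C] [Abelian C] [Category D] [Abelian D]

/-- A morphism of short exact sequences which is the identity on the quotients gives a pushout
square. -/
lemma isPushout_of_shortExact {K M N P Q : C} {k : K ⟶ P} {p : P ⟶ Q} {i : M ⟶ N} {q : N ⟶ Q}
    {w : k ≫ p = 0} {w' : i ≫ q = 0} (h : (ShortComplex.mk k p w).ShortExact)
    (h' : (ShortComplex.mk i q w').ShortExact) {m : K ⟶ M} {l : P ⟶ N} (hl : l ≫ q = p)
    (hm : m ≫ i = k ≫ l) : IsPushout m k i l := by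
  have := h'.mono_f
  have := h.epi_g
  have sq : CommSq m k i l := ⟨hm⟩
  have hepi : Epi sq.shortComplex.g := by
    rw [epi_iff_surjective_up_to_refinements]
    intro A (y : A ⟶ N)
    obtain ⟨A₁, π₁, _, z, hz⟩ := surjective_up_to_refinements_of_epi p (y ≫ q)
    obtain ⟨A₂, π₂, _, v, hv⟩ := h'.exact.exact_up_to_refinements (π₁ ≫ y - z ≫ l) (by
      change (π₁ ≫ y - z ≫ l) ≫ q = 0
      rw [Preadditive.sub_comp, Category.assoc, Category.assoc, hl, hz, sub_self])
    replace hv : π₂ ≫ (π₁ ≫ y - z ≫ l) = v ≫ i := hv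
    refine ⟨A₂, π₂ ≫ π₁, inferInstance, biprod.lift v (π₂ ≫ z), ?_⟩
    change _ = biprod.lift v (π₂ ≫ z) ≫ biprod.desc i l
    rw [biprod.lift_desc, ← hv, Preadditive.comp_sub, Category.assoc, sub_add_cancel]
    exact Category.assoc _ _ _
  have hex : sq.shortComplex.Exact := by
    rw [ShortComplex.exact_iff_exact_up_to_refinements]
    intro A (x : A ⟶ M ⊞ P) (hx : x ≫ biprod.desc i l = 0)
    rw [biprod.desc_eq, Preadditive.comp_add] at hx
    have h2 : (x ≫ biprod.snd) ≫ p = 0 := by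
      have := hx =≫ q
      simpa [w', hl] using this
    obtain ⟨A₁, π, _, z, hz⟩ := h.exact.exact_up_to_refinements (x ≫ biprod.snd) h2
    replace hz : π ≫ x ≫ biprod.snd = z ≫ k := hz
    refine ⟨A₁, π, inferInstance, -z, ?_⟩
    change π ≫ x = (-z) ≫ biprod.lift m (-k)
    apply biprod.hom_ext
    · rw [← cancel_mono i]
      have h3 : x ≫ biprod.fst ≫ i = - (x ≫ biprod.snd ≫ l) := eq_neg_of_add_eq_zero_left hx
      simp [h3, hm, ← reassoc_of% hz]
    · simp [hz]
  exact ⟨sq, ⟨sq.isColimitEquivIsColimitCokernelCofork.symm hex.gIsCokernel⟩⟩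

/-- A right exact functor which preserves the injectivity of the first map of a projective
presentation of `Q` preserves all monomorphisms with cokernel `Q`. -/
lemma mono_map_of_shortExact (T : C ⥤ D) [PreservesFiniteColimits T] {K M N P Q : C} {k : K ⟶ P}
    {p : P ⟶ Q} {i : M ⟶ N} {q : N ⟶ Q} {w : k ≫ p = 0} {w' : i ≫ q = 0}
    (h : (ShortComplex.mk k p w).ShortExact) (h' : (ShortComplex.mk i q w').ShortExact)
    [Projective P] [Mono (T.map k)] : Mono (T.map i) := by
  have := h'.mono_f
  have := h'.epi_g
  -- Lifting `p` along `q` exhibits `i` as a pushout of `k`. Right exact functors preserve pushouts,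
  -- and monomorphisms in an abelian category are stable under them.
  have hl : Projective.factorThru p q ≫ q = p := Projective.factorThru_comp p q
  let m := h'.exact.lift (k ≫ Projective.factorThru p q) (by
    change (k ≫ Projective.factorThru p q) ≫ q = 0
    rw [Category.assoc, hl, w])
  have hm : m ≫ i = k ≫ Projective.factorThru p q := h'.exact.lift_f _ _
  have sq := (isPushout_of_shortExact h h' hl hm).map T
  exact MorphismProperty.of_isPushout (P := MorphismProperty.monomorphisms D) sq ‹_›

end Abelian

end

/-! ### Flatness of `∏_ℕ ℤ` -/

section

/-- The functor of tensoring with the solidification of `P`, which is isomorphic to `∏_ℕ ℤ`. -/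
abbrev tensorNull : Solid ⥤ Solid := tensorLeft (solidification.obj nullSeq)

instance : PreservesFiniteColimits tensorNull where
  preservesFiniteColimits _ _ _ := inferInstance

instance : tensorNull.Additive :=
  have : PreservesColimitsOfShape (Discrete WalkingPair) tensorNull := inferInstance
  have := preservesBinaryBiproducts_of_preservesBinaryCoproducts tensorNull
  Functor.additive_of_preservesBinaryBiproducts _

lemma mono_tensorNull_map_prodZ (f : prodZ ⟶ prodZ) [Mono f] : Mono (tensorNull.map f) := by
  let e := solidificationNullSeqIso
  have h : Mono (tensorNull.map (e.hom ≫ f ≫ e.inv)) := mono_tensor_of_mono _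
  have h2 : tensorNull.map f =
      tensorNull.map e.inv ≫ tensorNull.map (e.hom ≫ f ≫ e.inv) ≫ tensorNull.map e.hom := by
    simp only [← tensorNull.map_comp]
    simp
  rw [h2]
  infer_instance

/-- In the resolution of the cokernel by two copies of `∏_ℕ ℤ` the first map stays monic after
tensoring. This amounts to the vanishing of the first Tor group of the cokernel. -/
lemma mono_tensorNull_map_of_finPres_cokernel {M N : Solid} (i : M ⟶ N) [Mono i]
    (h : finPres (cokernel i)) : Mono (tensorNull.map i) := by
  obtain ⟨k, p, w, hS⟩ := exists_resolution _ h
  have := hS.mono_f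
  have : Mono (tensorNull.map k) := mono_tensorNull_map_prodZ k
  have hS' : (ShortComplex.mk i (cokernel.π i) (cokernel.condition i)).ShortExact :=
    { exact := ShortComplex.exact_of_g_is_cokernel _ (cokernelIsCokernel i) }
  exact mono_map_of_shortExact tensorNull hS hS'

instance (M : Solid) : PreservesColimitsOfShape (CostructuredArrow finPres.ι M) tensorNull :=
  preservesColimitsOfShape_of_equiv
    (equivSmallModel.{0} (CostructuredArrow finPres.ι M)).symm tensorNull

/-- An element of a tensor product which dies in `N` already dies in a finitely presented
approximation of `N`. -/
lemma exists_tensorNull_eq_zero {N : Solid} {M₀ : SolidFP} (n : M₀.obj ⟶ N)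
    (x : prodZ ⟶ tensorNull.obj M₀.obj) (hx : x ≫ tensorNull.map n = 0) :
    ∃ (N₀ : SolidFP) (u : M₀.obj ⟶ N₀.obj) (n' : N₀.obj ⟶ N), u ≫ n' = n ∧
      x ≫ tensorNull.map u = 0 := by
  have : IsCardinalFiltered (CostructuredArrow finPres.ι N) Cardinal.aleph0.{0} :=
    (isCardinalFiltered_aleph0_iff _).2 inferInstance
  -- Tensoring preserves the filtered colimit of the finitely presented objects over `N`, and `∏_ℕ
  -- ℤ` is compact, so the vanishing already happens at some stage.
  obtain ⟨k, v, hv⟩ := IsCardinalPresentable.exists_eq_of_isColimit' Cardinal.aleph0.{0}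
    (isColimitOfPreserves tensorNull (finPres.ι.denseAt N))
    (i := CostructuredArrow.mk (Y := M₀) n) x 0 (by
      refine Eq.trans ?_ (hx.trans zero_comp.symm)
      exact congrArg (fun z => x ≫ tensorNull.map z) (Category.id_comp _))
  exact ⟨k.left, v.left.hom, k.hom, CostructuredArrow.w v, hv.trans zero_comp⟩

lemma exists_tensorNull_lift {M : Solid} (x : prodZ ⟶ tensorNull.obj M) :
    ∃ (M₀ : SolidFP) (m : M₀.obj ⟶ M) (x' : prodZ ⟶ tensorNull.obj M₀.obj),
      x' ≫ tensorNull.map m = x := by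
  have : IsCardinalFiltered (CostructuredArrow finPres.ι M) Cardinal.aleph0.{0} :=
    (isCardinalFiltered_aleph0_iff _).2 inferInstance
  obtain ⟨j, x', hx'⟩ := IsCardinalPresentable.exists_hom_of_isColimit Cardinal.aleph0.{0}
    (isColimitOfPreserves tensorNull (finPres.ι.denseAt M)) x
  refine ⟨j.left, j.hom, x', Eq.trans ?_ hx'⟩
  exact (congrArg (fun z => x' ≫ tensorNull.map z) (Category.id_comp _)).symm

/-- The element `x` comes from a finitely presented `M₀` over `M` and dies in a finitely presented
`N₀` over `N`. The image of `u : M₀ ⟶ N₀` has finitely presented cokernel in `N₀`, so tensoring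
keeps its inclusion monic and `x` already dies in the tensor product with the image. Since `i` is
monic, `M₀ ⟶ M` kills the kernel of `u` and factors through that image, so `x` dies over `M`. -/
lemma eq_zero_of_comp_tensorNull_map {M N : Solid} (i : M ⟶ N) [Mono i]
    (x : prodZ ⟶ tensorNull.obj M) (hx : x ≫ tensorNull.map i = 0) : x = 0 := by
  obtain ⟨M₀, m, x, rfl⟩ := exists_tensorNull_lift x
  obtain ⟨N₀, u, n, hn, hu⟩ := exists_tensorNull_eq_zero (m ≫ i) x (by
    rwa [tensorNull.map_comp, ← Category.assoc])
  have hfac : Abelian.factorThruImage u ≫ Abelian.image.ι u = u := Abelian.image.fac u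
  have hmono : Mono (tensorNull.map (Abelian.image.ι u)) := by
    refine mono_tensorNull_map_of_finPres_cokernel _ ?_
    have e : cokernel (Abelian.image.ι u) ≅ cokernel u :=
      (cokernelEpiComp (Abelian.factorThruImage u) (Abelian.image.ι u)).symm ≪≫
        cokernelIsoOfEq hfac
    exact finPres.prop_of_iso e.symm (finPres.prop_cokernel u M₀.property N₀.property)
  have h1 : x ≫ tensorNull.map (Abelian.factorThruImage u) = 0 := by
    rw [← cancel_mono (tensorNull.map (Abelian.image.ι u)), zero_comp, Category.assoc,
      ← tensorNull.map_comp, hfac, hu]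
  have h2 : kernel.ι (Abelian.factorThruImage u) ≫ m = 0 := by
    have h3 : m ≫ i = Abelian.factorThruImage u ≫ Abelian.image.ι u ≫ n := by
      rw [← hn, ← Category.assoc, hfac]
    rw [← cancel_mono i, zero_comp, Category.assoc, h3, kernel.condition_assoc, zero_comp]
  rw [← Abelian.comp_epiDesc (Abelian.factorThruImage u) m h2, tensorNull.map_comp,
    reassoc_of% h1, zero_comp]

lemma mono_tensorNull_map {M N : Solid} (i : M ⟶ N) [Mono i] : Mono (tensorNull.map i) := by
  refine Preadditive.mono_of_isZero_kernel _ (isZero_of_hom_prodZ _ fun f => ?_)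
  rw [← cancel_mono (kernel.ι (tensorNull.map i)), zero_comp]
  refine eq_zero_of_comp_tensorNull_map i _ ?_
  rw [Category.assoc, kernel.condition, comp_zero]

instance : PreservesFiniteLimits tensorNull := by
  have h := (Functor.exact_tfae tensorNull).out 0 3
  refine (h.1 fun S hS => ?_).1
  have := hS.mono_f
  have := hS.epi_g
  have : Mono (S.map tensorNull).f := mono_tensorNull_map S.f
  have : Epi (S.map tensorNull).g := inferInstanceAs (Epi (tensorNull.map S.g))
  exact ⟨ShortComplex.exact_of_g_is_cokernel _
    (CokernelCofork.mapIsColimit _ hS.gIsCokernel tensorNull)⟩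

/-- Tensoring with `∏_ℕ ℤ` is the same as tensoring with the solidification of `P`. -/
def tensorNullIso : tensorNull ≅ tensorLeft prodZ :=
  (curriedTensor Solid).mapIso solidificationNullSeqIso

instance : PreservesFiniteLimits (tensorLeft prodZ) :=
  preservesFiniteLimits_of_natIso tensorNullIso

instance : PreservesFiniteColimits (tensorLeft prodZ) :=
  preservesFiniteColimits_of_natIso tensorNullIso

end

end LightSolid

end

theorem mainTheorem9 :
    (LightSolid.finPres.IsClosedUnderKernels ∧
      LightSolid.finPres.IsClosedUnderCokernels ∧
      LightSolid.finPres.IsClosedUnderExtensions ∧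
      Nonempty (Abelian LightSolid.SolidFP) ∧
      PreservesFiniteLimits LightSolid.finPres.ι ∧
      PreservesFiniteColimits LightSolid.finPres.ι) ∧
    (∃ e : Ind LightSolid.SmallSolidFP ≌ LightSolid.Solid,
      Nonempty (Ind.yoneda ⋙ e.functor ≅ LightSolid.smallSolidFPι)) ∧
    (∀ M : LightSolid.Solid, LightSolid.finPres M →
      ∃ (f : LightSolid.prodZ ⟶ LightSolid.prodZ) (g : LightSolid.prodZ ⟶ M) (w : f ≫ g = 0),
        (ShortComplex.mk f g w).ShortExact) ∧
    (PreservesFiniteLimits (tensorLeft LightSolid.prodZ) ∧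
      PreservesFiniteColimits (tensorLeft LightSolid.prodZ)) := by
  refine ⟨⟨inferInstance, inferInstance, inferInstance, ⟨inferInstance⟩, inferInstance,
    inferInstance⟩, LightSolid.exists_indEquivalence, LightSolid.exists_resolution,
    inferInstance, inferInstance⟩
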